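/- Let $d,N\in\mathbb N$, and let $\Phi:\mathbb R^{2d}\to\mathbb R$ be a phase function such that (i) $\Phi\in C^\infty(\mathbb R^{2d})$; (ii) for every multi-index $\alpha$ with $|\alpha|\ge 2$ there is a constant $C_\alpha$ with $|\partial_z^\alpha\Phi(z)|\le C_\alpha$ for all $z=(x,\eta)\in\mathbb R^{2d}$; (iii) there is $\delta>0$ with $|\det\partial^2_{x,\eta}\Phi(x,\eta)|\ge\delta$ for all $(x,\eta)\in\mathbb R^{2d}$. Let $\chi$ be the canonical transformation generated by $\Phi$: $(x,\xi)=\chi(y,\eta)$ is obtained by solving $y=\nabla_\eta\Phi(x,\eta)$ for $x$ and putting $\xi=\nabla_x\Phi(x,\eta)$. Let $\sigma$ be a symbol on $\mathbb R^{2d}$ whose distributional derivatives $\partial_z^\alpha\sigma$, $|\alpha|\le 2N$, are all functions in $L^\infty(\mathbb R^{2d})$. For $f\in\mathcal S(\mathbb R^d)$ put $$Tf(x)=\int_{\mathbb R^d}e^{2\pi i\Phi(x,\eta)}\,\sigma(x,\eta)\,\hat f(\eta)\,d\eta,\qquad \hat f(\eta)=\int_{\mathbb R^d} f(t)e^{-2\pi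 i t\cdot\eta}\,dt .$$ Let $0\le s<2N-2d$, put $v_s(x,\eta)=(1+|x|^2+|\eta|^2)^{s/2}$, and let $\mu>0$ be a (measurable) $v_s$-moderate weight on $\mathbb R^{2d}$, i.e. for some constant $C$, $\mu(z_1+z_2)\le C\,v_s(z_1)\,\mu(z_2)$ for all $z_1,z_2\in\mathbb R^{2d}$. Fix a window $g\in\mathcal S(\mathbb R^d)\setminus\{0\}$. For $f\in\mathcal S'(\mathbb R^d)$ let $V_gf(x,\eta)=\langle f,M_\eta T_xg\rangle$ with $M_\eta T_xg(t)=e^{2\pi i\eta\cdot t}g(t-x)$, where $\langle\cdot,\cdot\rangle$ extends the $L^2$ inner product (antilinear in the second entry). For a weight $m$ and $1\le p\le\infty$ let $M^p_m=\{f\in\mathcal S'(\mathbb R^d): m\,V_gf\in L^p(\mathbb R^{2d})\}$ with norm $\|f\|_{M^p_m}=\|m\,V_gf\|_{L^p(\mathbb R^{2d})}$, and let $\tilde M^\infty_m$ be the closure of $\mathcal S(\mathbb R^d)$ in $M^\infty_m$. Then, for every $1\le p<\infty$, $T$ extends from $\mathcal S(\mathbb R^d)$ to a bounded linear operator from $M^p_{\mu\circ\chi}$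 to $M^p_\mu$; and $T$ extends from $\mathcal S(\mathbb R^d)$ to a bounded linear operator from $\tilde M^\infty_{\mu\circ\chi}$ to $\tilde M^\infty_\mu$. -/

import Mathlib

open MeasureTheory SchwartzMap
open scoped ENNReal LineDeriv FourierTransform

noncomputable section

/-- The configuration space `ℝ^d` with its Euclidean norm. -/
abbrev Rd (d : ℕ) : Type := EuclideanSpace ℝ (Fin d)

/-- The time-frequency plane `ℝ^{2d} = ℝ^d × ℝ^d`, with points `z = (x, η)`. Its `volume` is
Lebesgue measure on `ℝ^{2d}`. -/
abbrev TFPlane (d : ℕ) : Type := Rd d × Rd d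

/-- The `2d` coordinate directions of `ℝ^{2d}`: `inl i` is the direction of `x_i` and `inr j` the
direction of `η_j`. -/
def coordDir {d : ℕ} : Fin d ⊕ Fin d → TFPlane d
  | Sum.inl i => (EuclideanSpace.single i 1, 0)
  | Sum.inr j => (0, EuclideanSpace.single j 1)

instance instHasTemperateGrowthVolume {d : ℕ} :
    (volume : Measure (TFPlane d)).HasTemperateGrowth := by
  have : (volume : Measure (TFPlane d)).IsAddHaarMeasure :=
    inferInstanceAs (((volume : Measure (Rd d)).prod (volume : Measure (Rd d))).IsAddHaarMeasure)
  infer_instance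

/-! ### Phases, canonical transformations, symbols -/

/-- `∇_x Φ(x, η)`. -/
def gradX {d : ℕ} (Φ : TFPlane d → ℝ) (x η : Rd d) : Rd d :=
  gradient (fun x' => Φ (x', η)) x

/-- `∇_η Φ(x, η)`. -/
def gradEta {d : ℕ} (Φ : TFPlane d → ℝ) (x η : Rd d) : Rd d :=
  gradient (fun η' => Φ (x, η')) η

/-- The matrix `∂²_{x,η} Φ(z) = (∂²Φ / ∂x_i ∂η_j)(z)` of mixed second derivatives. -/
def mixedHessian {d : ℕ} (Φ : TFPlane d → ℝ) (z : TFPlane d) : Matrix (Fin d) (Fin d) ℝ :=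
  Matrix.of fun i j =>
    iteratedFDeriv ℝ 2 Φ z ![coordDir (Sum.inl i), coordDir (Sum.inr j)]

/-- The conditions on a real phase function: it is smooth, all its derivatives of order
at least two are bounded, and its mixed Hessian is uniformly nondegenerate. -/
structure IsPhase {d : ℕ} (Φ : TFPlane d → ℝ) : Prop where
  smooth : ContDiff ℝ (⊤ : ℕ∞) Φ
  bounded_deriv : ∀ k : ℕ, 2 ≤ k → ∃ C : ℝ, ∀ z, ‖iteratedFDeriv ℝ k Φ z‖ ≤ C
  nondegenerate : ∃ δ : ℝ, 0 < δ ∧ ∀ z, δ ≤ |(mixedHessian Φ z).det|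

/-- The transformation `(x, ξ) = χ(y, η)` generated by `Φ`: solve `y = ∇_η Φ(x, η)` for `x` and
put `ξ = ∇_x Φ(x, η)`. For a phase as in `IsPhase` the solution `x` exists and is unique. -/
def canonicalTransformation {d : ℕ} (Φ : TFPlane d → ℝ) (w : TFPlane d) : TFPlane d :=
  (Function.invFun (fun x => gradEta Φ x w.2) w.1,
    gradX Φ (Function.invFun (fun x => gradEta Φ x w.2) w.1) w.2)

/-- Whenever `y = ∇_η Φ(x, η)` is uniquely solvable for `x`, the map `canonicalTransformation Φ` is
the one determined by `y = ∇_η Φ(x, η)`, `ξ = ∇_x Φ(x, η)`. -/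
theorem canonicalTransformation_eq_iff {d : ℕ} {Φ : TFPlane d → ℝ} {η : Rd d}
    (h : Function.Bijective fun x => gradEta Φ x η) (x y ξ : Rd d) :
    canonicalTransformation Φ (y, η) = (x, ξ) ↔ y = gradEta Φ x η ∧ ξ = gradX Φ x η := by
  have hr := Function.rightInverse_invFun h.surjective y
  have hl := Function.leftInverse_invFun h.injective x
  simp only [canonicalTransformation, Prod.mk.injEq]
  constructor
  · rintro ⟨rfl, rfl⟩
    exact ⟨hr.symm, rfl⟩
  · rintro ⟨rfl, rfl⟩
    exact ⟨hl, by rw [hl]⟩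

/-- The symbol condition of order `k`: `σ` is an essentially bounded function on `ℝ^{2d}`, and
every distributional partial derivative of `σ` of order at most `k` is an essentially bounded
function. The multi-index is the list `m` of the coordinates in which one differentiates. -/
def IsSymbol {d : ℕ} (k : ℕ) (σ : TFPlane d → ℂ) : Prop :=
  ∃ hσ : MemLp σ ∞ (volume : Measure (TFPlane d)),
    ∀ n : ℕ, n ≤ k → ∀ m : Fin n → Fin d ⊕ Fin d,
      ∃ τ : Lp ℂ ∞ (volume : Measure (TFPlane d)),
        ∂^{fun i => coordDir (m i)} (Lp.toTemperedDistribution (hσ.toLp σ)) =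
          Lp.toTemperedDistribution τ

/-- The Fourier integral operator with phase `Φ` and symbol `σ` on Schwartz functions,
`Tf(x) = ∫ e^{2πiΦ(x,η)} σ(x,η) f̂(η) dη`, where `f̂(η) = ∫ f(t) e^{-2πi t·η} dt`. -/
def fio {d : ℕ} (Φ : TFPlane d → ℝ) (σ : TFPlane d → ℂ) (f : 𝓢(Rd d, ℂ)) (x : Rd d) : ℂ :=
  ∫ η : Rd d, Complex.exp (2 * Real.pi * Complex.I * (Φ (x, η) : ℂ)) * σ (x, η) * (𝓕 f) η

/-- The tempered distribution `u` is given by the function `h` on `ℝ^d`. -/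
def IsGivenBy {d : ℕ} (u : 𝓢'(Rd d, ℂ)) (h : Rd d → ℂ) : Prop :=
  ∀ φ : 𝓢(Rd d, ℂ), u φ = ∫ x : Rd d, h x * φ x

/-! ### Weights -/

/-- The polynomial weight `v_s(x, η) = (1 + |x|² + |η|²)^{s/2}`. -/
def polyWeight {d : ℕ} (s : ℝ) (z : TFPlane d) : ℝ :=
  (1 + ‖z.1‖ ^ 2 + ‖z.2‖ ^ 2) ^ (s / 2)

/-- `μ` is a (positive, measurable) `v`-moderate weight on `ℝ^{2d}`. -/
structure IsModerate {d : ℕ} (v μ : TFPlane d → ℝ) : Prop where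
  measurable : Measurable μ
  pos : ∀ z, 0 < μ z
  moderate : ∃ C : ℝ, ∀ z₁ z₂, μ (z₁ + z₂) ≤ C * v z₁ * μ z₂

/-! ### Short-time Fourier transform -/

/-- The character `t ↦ e^{-2πi η·t}`. -/
def modChar {d : ℕ} (η : Rd d) (t : Rd d) : ℂ :=
  Complex.exp (-(2 * Real.pi * Complex.I * (inner ℝ η t : ℝ)))

/-- Characters and all their derivatives are bounded, hence of temperate growth. -/
theorem modChar_hasTemperateGrowth {d : ℕ} (η : Rd d) :
    Function.HasTemperateGrowth (modChar η) := by
  have hd : ∀ y : ℝ, HasDerivAt (fun y : ℝ => Complex.exp (-(2 * Real.pi * Complex.I * (y : ℂ))))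
      (-(2 * Real.pi * Complex.I) *
        Complex.exp (-(2 * Real.pi * Complex.I * (y : ℂ)))) y := by
    intro y
    have h1 : HasDerivAt (fun y : ℝ => -(2 * Real.pi * Complex.I * (y : ℂ)))
        (-(2 * Real.pi * Complex.I * 1)) y :=
      ((Complex.ofRealCLM.hasDerivAt (x := y)).const_mul (2 * Real.pi * Complex.I)).neg
    simpa [mul_comm] using h1.cexp
  have hi : ∀ n : ℕ,
      iteratedDeriv n (fun y : ℝ => Complex.exp (-(2 * Real.pi * Complex.I * (y : ℂ)))) =
        fun y : ℝ => (-(2 * Real.pi * Complex.I)) ^ n *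
          Complex.exp (-(2 * Real.pi * Complex.I * (y : ℂ))) := by
    intro n
    induction n with
    | zero => simp
    | succ n ih =>
      rw [iteratedDeriv_succ, ih]
      funext y
      rw [((hd y).const_mul _).deriv]
      ring
  have h1 : Function.HasTemperateGrowth
      (fun y : ℝ => Complex.exp (-(2 * Real.pi * Complex.I * (y : ℂ)))) := by
    have hc : ContDiff ℝ (⊤ : ℕ∞) (fun y : ℝ => (y : ℂ)) := Complex.ofRealCLM.contDiff
    refine ⟨(contDiff_const.mul hc).neg.cexp, fun n => ⟨0, (2 * Real.pi) ^ n, fun y => ?_⟩⟩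
    rw [norm_iteratedFDeriv_eq_norm_iteratedDeriv, hi n]
    have : ‖Complex.exp (-(2 * Real.pi * Complex.I * (y : ℂ)))‖ = 1 := by
      rw [Complex.norm_exp]
      simp
    simp [this, abs_of_pos Real.pi_pos]
  exact h1.comp (Function.hasTemperateGrowth_inner_right η)

/-- The Schwartz function `t ↦ conj (M_η T_x g (t)) = conj (g (t - x)) e^{-2πi η·t}`. -/
def conjShift {d : ℕ} (g : 𝓢(Rd d, ℂ)) (z : TFPlane d) : 𝓢(Rd d, ℂ) :=
  smulLeftCLM ℂ (modChar z.2)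
    (compSubConstCLM ℂ z.1
      (postcompCLM (𝕜 := ℝ) (Complex.conjCLE : ℂ →L[ℝ] ℂ) g))

theorem conjShift_apply {d : ℕ} (g : 𝓢(Rd d, ℂ)) (x η t : Rd d) :
    conjShift g (x, η) t =
      (starRingEnd ℂ) (g (t - x)) *
        Complex.exp (-(2 * Real.pi * Complex.I * (inner ℝ η t : ℝ))) := by
  simp [conjShift, smulLeftCLM_apply_apply (modChar_hasTemperateGrowth η), modChar, mul_comm]

/-- The short-time Fourier transform `V_g f(x, η) = ⟨f, M_η T_x g⟩` of a tempered distribution. -/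
def stft {d : ℕ} (g : 𝓢(Rd d, ℂ)) (f : 𝓢'(Rd d, ℂ)) (z : TFPlane d) : ℂ :=
  f (conjShift g z)

/-- On functions, `V_g f(x, η) = ∫ f(t) conj (g(t - x)) e^{-2πi η·t} dt`. -/
theorem stft_coe {d : ℕ} (g f : 𝓢(Rd d, ℂ)) (x η : Rd d) :
    stft g (f : 𝓢'(Rd d, ℂ)) (x, η) =
      ∫ t : Rd d, f t * (starRingEnd ℂ) (g (t - x)) *
        Complex.exp (-(2 * Real.pi * Complex.I * (inner ℝ η t : ℝ))) := by
  rw [stft, SchwartzMap.coe_apply]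
  refine integral_congr_ae (Filter.Eventually.of_forall fun t => ?_)
  simp only [conjShift_apply, smul_eq_mul]
  ring

/-! ### Modulation spaces -/

/-- The vector space `M^p_μ(ℝ^d)` of all tempered distributions `f` with `μ · V_g f ∈ L^p(ℝ^{2d})`,
for the window `g`. -/
def modulationSubmodule {d : ℕ} (g : 𝓢(Rd d, ℂ)) (p : ℝ≥0∞) (μ : TFPlane d → ℝ) :
    Submodule ℂ 𝓢'(Rd d, ℂ) where
  carrier := {f | MemLp (fun z => (μ z : ℂ) * stft g f z) p (volume : Measure (TFPlane d))}
  add_mem' {a b} ha hb := by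
    have h := MemLp.add ha hb
    refine h.ae_eq (Filter.Eventually.of_forall fun z => ?_)
    simp [stft, mul_add]
  zero_mem' := by simp [stft]
  smul_mem' c a ha := by
    have h := MemLp.const_smul ha c
    refine h.ae_eq (Filter.Eventually.of_forall fun z => ?_)
    simp [stft, mul_left_comm]

/-- The modulation space `M^p_μ(ℝ^d)`, as a type that carries the modulation space norm. -/
def ModulationSpace {d : ℕ} (g : 𝓢(Rd d, ℂ)) (p : ℝ≥0∞) (μ : TFPlane d → ℝ) : Type :=
  modulationSubmodule g p μ

namespace ModulationSpace

variable {d : ℕ} (g : 𝓢(Rd d, ℂ)) (p : ℝ≥0∞) (μ : TFPlane d → ℝ)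

instance instAddCommGroup : AddCommGroup (ModulationSpace g p μ) :=
  inferInstanceAs (AddCommGroup (modulationSubmodule g p μ))

instance instModule : Module ℂ (ModulationSpace g p μ) :=
  inferInstanceAs (Module ℂ (modulationSubmodule g p μ))

/-- An element of the modulation space, as a tempered distribution. -/
def toDistribution : ModulationSpace g p μ →ₗ[ℂ] 𝓢'(Rd d, ℂ) :=
  (modulationSubmodule g p μ).subtype

theorem memLp (f : ModulationSpace g p μ) :
    MemLp (fun z => (μ z : ℂ) * stft g (toDistribution g p μ f) z) p
      (volume : Measure (TFPlane d)) :=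
  f.2

/-- The weighted short-time Fourier transform `f ↦ μ · V_g f` as a map `M^p_μ → L^p(ℝ^{2d})`. -/
def toLp : ModulationSpace g p μ →ₗ[ℂ] Lp ℂ p (volume : Measure (TFPlane d)) where
  toFun f := (memLp g p μ f).toLp
  map_add' a b := by
    rw [← MemLp.toLp_add (memLp g p μ a) (memLp g p μ b), MemLp.toLp_eq_toLp_iff]
    refine Filter.Eventually.of_forall fun z => ?_
    simp [stft, mul_add]
  map_smul' c a := by
    rw [RingHom.id_apply, ← MemLp.toLp_const_smul c (memLp g p μ a), MemLp.toLp_eq_toLp_iff]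
    refine Filter.Eventually.of_forall fun z => ?_
    simp [stft, mul_left_comm]

/-- The norm of `M^p_μ` is `‖f‖ = ‖μ · V_g f‖_{L^p}`. -/
instance instSeminormedAddCommGroup [Fact (1 ≤ p)] :
    SeminormedAddCommGroup (ModulationSpace g p μ) :=
  SeminormedAddCommGroup.induced _ _ (toLp g p μ)

instance instNormedSpace [Fact (1 ≤ p)] : NormedSpace ℂ (ModulationSpace g p μ) :=
  NormedSpace.induced ℂ _ _ (toLp g p μ)

theorem norm_def [Fact (1 ≤ p)] (f : ModulationSpace g p μ) :
    ‖f‖ = (eLpNorm (fun z => (μ z : ℂ) * stft g (toDistribution g p μ f) z) p volume).toReal :=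
  Lp.norm_toLp _ (memLp g p μ f)

/-- The space `M̃^p_μ`: the closure in `M^p_μ` of the Schwartz functions. -/
def schwartzClosure [Fact (1 ≤ p)] : Submodule ℂ (ModulationSpace g p μ) :=
  ((LinearMap.range (SchwartzMap.toTemperedDistributionCLM (Rd d) ℂ volume).toLinearMap).comap
    (toDistribution g p μ)).topologicalClosure

end ModulationSpace

end

open MeasureTheory SchwartzMap
open scoped ENNReal LineDeriv FourierTransform

noncomputable section

/-! ### A global inverse function theorem -/

section GlobalInverse

open Set Metric Topology NNReal

variable {E : Type*} [NormedAddCommGroup E] [NormedSpace ℝ E]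

/-! Write π(w) = M_η T_y for w = (y, η). Inversion of the short-time Fourier transform expresses f̂
as a superposition, with coefficients V_g f(w), of the Fourier transforms of π(w)g. Inserting this
in T gives, up to a constant, V_g(Tf)(w') = ∫ K(w', w) V_g f(w) dw, where K(w', w) is ⟨Tπ(w)g,
π(w')g⟩. The theorem thereby becomes a statement about integral operators on L^p(ℝ^{2d}).

Decay of K. For w' = (x, ξ), K is an integral over ℝ^{2d} whose amplitude is concentrated near (x,
η). Taylor expansion of Φ at that point leaves a linear phase with frequency (∇_xΦ(x,η) - ξ,
∇_ηΦ(x,η) - y) and a remainder; the exponential of the remainder has derivatives of polynomial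
growth, which the Schwartz windows absorb. Integrating by parts 2N times, with the derivatives
shared between σ and the amplitude, gives decay of order 2N in the frequency
(`IsPhase.exists_fioKernel_bound`). By a global inverse function theorem of Hadamard type the
partial gradients of Φ are bi-Lipschitz bijections. Hence χ is bi-Lipschitz
(`IsPhase.exists_canonicalTransformation_bounds`) and |K(w', w)| ≲ (1 + |w' - χ(w)|)^{-2N}
(`IsPhase.exists_fioKernel_decay`).

Boundedness. Moderateness replaces μ(w') by (1 + |w' - χ(w)|)^s μ(χ(w)). The exponent that remains
is 2N - s > 2d, so the kernel is integrable in each variable, and Schur's test bounds the operator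
for every p (`eLpNorm_lintegral_mul_le`, `IsPhase.exists_eLpNorm_fioIntegrand_le`). The kernel
integral converges for every element of the modulation space, so it defines the extension directly,
without a density argument; Fubini identifies it with T on Schwartz functions
(`integral_fioIntegrand_stft_coe`).

Closure of the Schwartz functions. For Schwartz f, Tf is a bounded function, and it lies in M^1_μ by
the case p = 1. Truncating its reproducing formula to balls yields Schwartz functions, and the error
in M^∞_μ is controlled by the tail of the M^1_μ norm
(`ModulationSpace.mem_schwartzClosure_of_isGivenBy`). Continuity carries this over to the whole
closure. -/

/-- Quantitative injectivity on balls of a uniform radius. -/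
theorem exists_approximatesLinearOn_ball {f : E → E} {A : E → E ≃L[ℝ] E} {L : ℝ}
    (hf : ∀ x, HasFDerivAt f (A x : E →L[ℝ] E) x)
    (hL : ∀ x y, ‖(A x : E →L[ℝ] E) - A y‖ ≤ L * ‖x - y‖) {c : ℝ≥0} (hc : 0 < c) :
    ∃ r : ℝ, 0 < r ∧ ∀ x, ApproximatesLinearOn f (A x : E →L[ℝ] E) (ball x r) c := by
  -- On a ball of this radius the derivative stays within `c` of `A x`; the mean value inequality
  -- does the rest. `|L| + 1` is positive whatever the sign of `L`.
  refine ⟨c / (|L| + 1), by positivity, fun x a ha b hb => ?_⟩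
  refine (convex_ball x _).norm_image_sub_le_of_norm_hasFDerivWithin_le'
    (fun z _ => (hf z).hasFDerivWithinAt) (fun z hz => ?_) hb ha
  refine (hL z x).trans ?_
  rw [mem_ball, dist_eq_norm, lt_div_iff₀ (by positivity)] at hz
  have h1 : L ≤ |L| + 1 := by linarith [le_abs_self L]
  nlinarith [norm_nonneg (z - x), mul_le_mul_of_nonneg_right h1 (norm_nonneg (z - x))]

/-- Applying `B.symm` turns `f` into a perturbation of the identity with Lipschitz constant at most
`C * c < 1`. -/
theorem injOn_ball_of_approximatesLinearOn {f : E → E} {B : E ≃L[ℝ] E} {C : ℝ≥0} {s : Set E}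
    (hC : ∀ v, ‖B.symm v‖ ≤ C * ‖v‖) {c : ℝ≥0} (hc : C * c < 1)
    (h : ApproximatesLinearOn f (B : E →L[ℝ] E) s c) : InjOn f s := by
  intro a ha b hb hab
  have h1 := h a ha b hb
  rw [hab, sub_self, zero_sub, norm_neg] at h1
  have h2 := hC (B (a - b))
  rw [B.symm_apply_apply] at h2
  have h3 : ‖a - b‖ ≤ (C * c : ℝ≥0) * ‖a - b‖ := by
    push_cast
    rw [mul_assoc]
    exact h2.trans (mul_le_mul_of_nonneg_left h1 C.2)
  have h4 : ((C * c : ℝ≥0) : ℝ) < 1 := by exact_mod_cast hc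
  have h5 : ‖a - b‖ = 0 := by nlinarith [norm_nonneg (a - b)]
  exact sub_eq_zero.1 (norm_eq_zero.1 h5)

/-- A differentiable map with uniformly invertible Lipschitz derivative is a covering map. -/
theorem isCoveringMap_of_uniform_inverse [CompleteSpace E] {f : E → E} {A : E → E ≃L[ℝ] E}
    {C L : ℝ} (hf : ∀ x, HasFDerivAt f (A x : E →L[ℝ] E) x)
    (hC : ∀ x v, ‖(A x).symm v‖ ≤ C * ‖v‖)
    (hL : ∀ x y, ‖(A x : E →L[ℝ] E) - A y‖ ≤ L * ‖x - y‖) : IsCoveringMap f := by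
  set K : ℝ≥0 := C.toNNReal + 1 with hK
  have hKpos : 0 < K := by positivity
  have hCK : ∀ x v, ‖(A x).symm v‖ ≤ K * ‖v‖ := fun x v => (hC x v).trans <| by
    refine mul_le_mul_of_nonneg_right ?_ (norm_nonneg v)
    rw [hK, NNReal.coe_add]
    have := Real.le_coe_toNNReal C
    simp only [NNReal.coe_one]; linarith
  -- Half of the critical value: `K * c < 1` gives injectivity, and the surjectivity constant `K⁻¹ -
  -- c` equals `c` again. Both radii are thus independent of the point, which is what makes the
  -- covering even.
  set c : ℝ≥0 := K⁻¹ / 2 with hcdef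
  have hc : 0 < c := by positivity
  have hKc : K * c < 1 := by
    rw [hcdef, ← mul_div_assoc, mul_inv_cancel₀ hKpos.ne']
    exact NNReal.half_lt_self one_ne_zero
  obtain ⟨r, hr, hball⟩ := exists_approximatesLinearOn_ball hf hL hc
  have hinj : ∀ x, InjOn f (ball x r) := fun x =>
    injOn_ball_of_approximatesLinearOn (hCK x) hKc (hball x)
  have hsurj : ∀ x, ball (f x) (c * (r / 2)) ⊆ f '' ball x r := by
    intro x y hy
    let S : (A x : E →L[ℝ] E).NonlinearRightInverse :=
      { toFun := (A x).symm
        nnnorm := K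
        bound' := hCK x
        right_inv' := (A x).apply_symm_apply }
    have h := (hball x).surjOn_closedBall_of_nonlinearRightInverse S (b := x)
      (by positivity : (0 : ℝ) ≤ r / 2)
      ((closedBall_subset_ball (by linarith)))
    have h2 : ((S.nnnorm : ℝ)⁻¹ - c) * (r / 2) = c * (r / 2) := by
      have : (S.nnnorm : ℝ) = K := rfl
      rw [this, hcdef]; push_cast; ring
    rw [h2] at h
    obtain ⟨z, hz, rfl⟩ := h (ball_subset_closedBall hy)
    exact ⟨z, closedBall_subset_ball (by linarith) hz, rfl⟩
  have hcont : Continuous f := continuous_iff_continuousAt.2 fun x => (hf x).continuousAt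
  have hopen : IsOpenMap f := by
    rw [isOpenMap_iff_nhds_le]
    intro x
    have hs : HasStrictFDerivAt f (A x : E →L[ℝ] E) x := by
      refine hasStrictFDerivAt_of_hasFDerivAt_of_continuousAt (.of_forall hf) ?_
      have : LipschitzWith L.toNNReal fun x => (A x : E →L[ℝ] E) :=
        LipschitzWith.of_dist_le_mul fun x y => by
          rw [dist_eq_norm, dist_eq_norm]
          exact (hL x y).trans (mul_le_mul_of_nonneg_right (Real.le_coe_toNNReal L)
            (norm_nonneg _))
      exact this.continuous.continuousAt
    exact (hs.map_nhds_eq_of_equiv).ge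
  intro p
  set ρ : ℝ := c * (r / 2) with hρ
  have hρpos : 0 < ρ := by positivity
  -- Surjectivity is applied at `z`, not at a point of the fibre: since `p` is close to `f z`, the
  -- fibre has a point close to `z`. So the balls around the fibre exhaust the preimage.
  have hexh : ∀ z, f z ∈ ball p ρ → ∃ e, f e = p ∧ z ∈ ball e r := by
    intro z hz
    obtain ⟨e, he, hep⟩ := hsurj z (by rwa [mem_ball_comm] : p ∈ ball (f z) ρ)
    exact ⟨e, hep, by rwa [mem_ball_comm]⟩
  rcases isEmpty_or_nonempty (f ⁻¹' {p}) with hemp | hne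
  · refine IsEvenlyCovered.of_preimage_eq_empty _ (ball_mem_nhds p hρpos) ?_
    refine eq_empty_of_forall_notMem fun z hz => ?_
    obtain ⟨e, he, -⟩ := hexh z hz
    exact hemp.false ⟨e, he⟩
  · have hdisc : DiscreteTopology (f ⁻¹' {p}) := by
      refine discreteTopology_subtype_iff'.2 fun e he => ⟨ball e r, isOpen_ball, ?_⟩
      ext z
      simp only [mem_inter_iff, mem_singleton_iff]
      refine ⟨fun hz => hinj e hz.1 (mem_ball_self hr) ?_, ?_⟩
      · exact hz.2.trans (Eq.symm he)
      · rintro rfl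
        exact ⟨mem_ball_self hr, he⟩
    have : Nonempty (E → E) := ⟨id⟩
    refine IsEvenlyCovered.of_trivialization
      (t := IsOpen.trivializationDiscrete (f := f) (ι := f ⁻¹' {p})
        (fun e => ball (e : E) r) (ball p ρ) isOpen_ball (fun e W hW => ⟨fun hWo => ?_, fun hWo => ?_⟩)
        (fun e => hinj e) (fun e y hy => ?_) (fun e e' hee' => ?_) (fun z hz => ?_))
      (mem_ball_self hρpos)
    · exact (hWo.preimage hcont).inter isOpen_ball
    · have : f '' (f ⁻¹' W ∩ ball (e : E) r) = W := by
        ext y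
        constructor
        · rintro ⟨z, hz, rfl⟩
          exact hz.1
        · intro hy
          have hy' : y ∈ ball (f (e : E)) ρ := by
            rw [show f (e : E) = p from e.2]; exact hW hy
          obtain ⟨z, hz, rfl⟩ := hsurj e hy'
          exact ⟨z, ⟨hy, hz⟩, rfl⟩
      rw [← this]
      exact hopen _ hWo
    · apply hsurj e
      rwa [show f (e : E) = p from e.2]
    -- Both centres lie in `ball z r`, where `f` is injective, and both map to `p`.
    · refine Set.disjoint_left.2 fun z hz hz' => hee' (Subtype.ext ?_)
      exact hinj z ((mem_ball_comm.1 hz)) ((mem_ball_comm.1 hz'))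
        ((show f (e : E) = p from e.2).trans (show f (e' : E) = p from e'.2).symm)
    · obtain ⟨e, he, hze⟩ := hexh z hz
      exact mem_iUnion.2 ⟨⟨e, he⟩, hze⟩

/-- Hadamard's global inverse function theorem, with an explicit Lipschitz bound for the
inverse. -/
theorem bijective_and_antilipschitz_of_uniform_inverse [CompleteSpace E] {f : E → E}
    {A : E → E ≃L[ℝ] E} {C L : ℝ} (hf : ∀ x, HasFDerivAt f (A x : E →L[ℝ] E) x)
    (hC₀ : 0 ≤ C) (hC : ∀ x v, ‖(A x).symm v‖ ≤ C * ‖v‖)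
    (hL : ∀ x y, ‖(A x : E →L[ℝ] E) - A y‖ ≤ L * ‖x - y‖) :
    Function.Bijective f ∧ ∀ x y, ‖x - y‖ ≤ C * ‖f x - f y‖ := by
  have hcov := isCoveringMap_of_uniform_inverse hf hC hL
  -- As `E` is simply connected, the identity lifts through the covering to a right inverse `g`. It
  -- is also a left inverse, because `g ∘ f` and `id` are lifts of `f` that agree at `0`.
  obtain ⟨g, ⟨hg0, hg⟩, -⟩ := hcov.existsUnique_continuousMap_lifts (ContinuousMap.id E) (f 0) 0 rfl
  have hfg : ∀ y, f (g y) = y := fun y => congrFun hg y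
  have hgf : g ∘ f = id := by
    refine hcov.eq_of_comp_eq (g.continuous.comp hcov.continuous) continuous_id ?_ 0 hg0
    funext x
    simp [hfg]
  have hgf' : ∀ x, g (f x) = x := fun x => congrFun hgf x
  refine ⟨⟨Function.LeftInverse.injective hgf', Function.RightInverse.surjective hfg⟩,
    fun x y => ?_⟩
  -- The derivative of `g` is the inverse of that of `f`, hence bounded by `C`; the mean value
  -- inequality makes `g` Lipschitz.
  have hder : ∀ y, HasFDerivAt g ((A (g y)).symm : E →L[ℝ] E) y := fun y =>
    (hf (g y)).of_local_left_inverse g.continuous.continuousAt (.of_forall hfg)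
  have := convex_univ.norm_image_sub_le_of_norm_hasFDerivWithin_le (f := g) (C := C)
    (fun y _ => (hder y).hasFDerivWithinAt)
    (fun y _ => ContinuousLinearMap.opNorm_le_bound _ hC₀ (hC (g y)))
    (mem_univ (f y)) (mem_univ (f x))
  rwa [hgf', hgf'] at this

end GlobalInverse

/-! ### Matrices and maps of Euclidean space -/

theorem norm_le_sum_abs {d : ℕ} (x : Rd d) : ‖x‖ ≤ ∑ i, |x i| := by
  conv_lhs => rw [← (EuclideanSpace.basisFun (Fin d) ℝ).sum_repr x]
  refine (norm_sum_le _ _).trans (Finset.sum_le_sum fun i _ => ?_)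
  simp [norm_smul]

theorem abs_apply_le_norm {d : ℕ} (x : Rd d) (i : Fin d) : |x i| ≤ ‖x‖ := by
  simpa using PiLp.norm_apply_le x i

theorem norm_le_of_abs_apply_le {d : ℕ} {x : Rd d} {b : ℝ} (h : ∀ i, |x i| ≤ b) :
    ‖x‖ ≤ d * b := by
  refine (norm_le_sum_abs x).trans ((Finset.sum_le_sum fun i _ => h i).trans ?_)
  simp

theorem toEuclideanCLM_apply {d : ℕ} (M : Matrix (Fin d) (Fin d) ℝ) (v : Rd d) (i : Fin d) :
    Matrix.toEuclideanCLM (𝕜 := ℝ) M v i = ∑ j, M i j * v j := by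
  simp [Matrix.ofLp_toEuclideanCLM, Matrix.mulVec, dotProduct]

theorem norm_toEuclideanCLM_apply_le {d : ℕ} {M : Matrix (Fin d) (Fin d) ℝ} {b : ℝ}
    (h : ∀ i j, |M i j| ≤ b) (v : Rd d) :
    ‖Matrix.toEuclideanCLM (𝕜 := ℝ) M v‖ ≤ d * (d * b) * ‖v‖ := by
  rw [mul_assoc]
  refine norm_le_of_abs_apply_le fun i => ?_
  rw [toEuclideanCLM_apply]
  refine (Finset.abs_sum_le_sum_abs _ _).trans ?_
  have : ∀ j ∈ Finset.univ, |M i j * v j| ≤ b * ‖v‖ := fun j _ => by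
    rw [abs_mul]
    exact mul_le_mul (h i j) (abs_apply_le_norm v j) (abs_nonneg _) ((abs_nonneg _).trans (h i j))
  refine (Finset.sum_le_sum this).trans (le_of_eq ?_)
  simp; ring

/-- Cramer's rule: an entry of the adjugate is the determinant of `M` with one row replaced by a
unit vector, which is where `max b 1` comes from. -/
theorem abs_inv_apply_le {d : ℕ} {M : Matrix (Fin d) (Fin d) ℝ} {b δ : ℝ} (hδ : 0 < δ)
    (h : ∀ i j, |M i j| ≤ b) (hdet : δ ≤ |M.det|) (i j : Fin d) :
    |M⁻¹ i j| ≤ δ⁻¹ * (d.factorial * (max b 1) ^ d) := by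
  rw [Matrix.inv_def, Matrix.smul_apply, smul_eq_mul, abs_mul, Ring.inverse_eq_inv', abs_inv]
  refine mul_le_mul (inv_anti₀ hδ hdet) ?_ (abs_nonneg _) (by positivity)
  rw [Matrix.adjugate_apply]
  have := Matrix.det_le (A := M.updateRow j (Pi.single i 1)) (abv := AbsoluteValue.abs)
    (x := max b 1) (fun k l => ?_)
  · simpa using this
  · rcases eq_or_ne k j with rfl | hk
    · rw [Matrix.updateRow_self]
      rcases eq_or_ne l i with rfl | hl
      · simp
      · simp [hl]
    · rw [Matrix.updateRow_ne hk]
      exact (h k l).trans (le_max_left _ _)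

/-- A map of Euclidean space whose Jacobian matrix has bounded, Lipschitz entries and determinant
bounded away from zero is bijective with Lipschitz inverse. The Lipschitz constant depends only on
the bounds for the entries and for the determinant. -/
theorem exists_bijective_and_antilipschitz (d : ℕ) (b δ : ℝ) (hδ : 0 < δ) :
    ∃ C : ℝ, 0 ≤ C ∧ ∀ (f : Rd d → Rd d) (M : Rd d → Matrix (Fin d) (Fin d) ℝ) (L : ℝ),
      (∀ x, HasFDerivAt f (Matrix.toEuclideanCLM (𝕜 := ℝ) (M x)) x) →
      (∀ x i j, |M x i j| ≤ b) → (∀ x, δ ≤ |(M x).det|) →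
      (∀ x y i j, |M x i j - M y i j| ≤ L * ‖x - y‖) →
      Function.Bijective f ∧ ∀ x y, ‖x - y‖ ≤ C * ‖f x - f y‖ := by
  refine ⟨d * (d * (δ⁻¹ * (d.factorial * (max b 1) ^ d))), by positivity,
    fun f M L hf hM hdet hL => ?_⟩
  have hu : ∀ x, IsUnit (M x).det := fun x => by
    refine isUnit_iff_ne_zero.2 fun h => ?_
    have := hdet x
    rw [h, abs_zero] at this
    linarith
  let A : Rd d → Rd d ≃L[ℝ] Rd d := fun x =>
    ContinuousLinearEquiv.equivOfInverse (Matrix.toEuclideanCLM (𝕜 := ℝ) (M x))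
      (Matrix.toEuclideanCLM (𝕜 := ℝ) (M x)⁻¹)
      (fun v => by
        rw [← mul_apply_eq_comp, ← map_mul, Matrix.nonsing_inv_mul _ (hu x), map_one]
        rfl)
      (fun v => by
        rw [← mul_apply_eq_comp, ← map_mul, Matrix.mul_nonsing_inv _ (hu x), map_one]
        rfl)
  refine bijective_and_antilipschitz_of_uniform_inverse (A := A) (L := d * (d * |L|)) hf
    (by positivity) (fun x v => ?_) (fun x y => ?_)
  · exact norm_toEuclideanCLM_apply_le (abs_inv_apply_le hδ (hM x) (hdet x)) v
  · refine ContinuousLinearMap.opNorm_le_bound _ (by positivity) fun v => ?_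
    have : ((A x : Rd d →L[ℝ] Rd d) - (A y : Rd d →L[ℝ] Rd d)) =
        Matrix.toEuclideanCLM (𝕜 := ℝ) (M x - M y) := by
      rw [map_sub]; rfl
    rw [this]
    refine (norm_toEuclideanCLM_apply_le (b := |L| * ‖x - y‖) (fun i j => ?_) v).trans
      (le_of_eq (by ring))
    exact (hL x y i j).trans (mul_le_mul_of_nonneg_right (le_abs_self L) (norm_nonneg _))

/-! ### Geometry of a phase function -/

theorem norm_sub_le_of_norm_iteratedFDeriv_one_le {E F : Type*} [NormedAddCommGroup E]
    [NormedSpace ℝ E] [NormedAddCommGroup F] [NormedSpace ℝ F] {f : E → F} {C : ℝ}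
    (hf : Differentiable ℝ f) (h : ∀ x, ‖iteratedFDeriv ℝ 1 f x‖ ≤ C) (x y : E) :
    ‖f x - f y‖ ≤ C * ‖x - y‖ :=
  convex_univ.norm_image_sub_le_of_norm_fderiv_le (𝕜 := ℝ) (fun z _ => hf z)
    (fun z _ => by rw [← norm_iteratedFDeriv_one]; exact h z) (Set.mem_univ _) (Set.mem_univ _)

theorem abs_apply_apply_le_of_norm_le_one {E : Type*} [NormedAddCommGroup E] [NormedSpace ℝ E]
    (B : E →L[ℝ] E →L[ℝ] ℝ) {a b : E} (ha : ‖a‖ ≤ 1) (hb : ‖b‖ ≤ 1) : |B a b| ≤ ‖B‖ := by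
  rw [← Real.norm_eq_abs]
  calc _ ≤ _ := B.le_opNorm₂ a b
    _ ≤ ‖B‖ * 1 * 1 := by gcongr
    _ = ‖B‖ := by ring

theorem abs_apply_apply_sub_le_of_norm_le_one {E : Type*} [NormedAddCommGroup E]
    [NormedSpace ℝ E] (B B' : E →L[ℝ] E →L[ℝ] ℝ) {a b : E} (ha : ‖a‖ ≤ 1) (hb : ‖b‖ ≤ 1) :
    |B a b - B' a b| ≤ ‖B - B'‖ :=
  abs_apply_apply_le_of_norm_le_one (B - B') ha hb

theorem hasFDerivAt_fderiv_comp_apply {E F : Type*} [NormedAddCommGroup E] [NormedSpace ℝ E]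
    [NormedAddCommGroup F] [NormedSpace ℝ F] {f : F → ℝ} {g : E → F} {g' : E →L[ℝ] F} {x : E}
    (hf : Differentiable ℝ (fderiv ℝ f)) (hg : HasFDerivAt g g' x) (w : F) :
    HasFDerivAt (fun y => fderiv ℝ f (g y) w)
      (((fderiv ℝ (fderiv ℝ f) (g x)).flip w).comp g') x := by
  have h := (((hf (g x)).hasFDerivAt.comp x hg).clm_apply (hasFDerivAt_const w x))
  refine h.congr_fderiv ?_
  ext v
  simp

theorem abs_apply_le_of_norm_le_one {E : Type*} [NormedAddCommGroup E] [NormedSpace ℝ E]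
    (B : E →L[ℝ] ℝ) {a : E} (ha : ‖a‖ ≤ 1) : |B a| ≤ ‖B‖ := by
  rw [← Real.norm_eq_abs]
  calc _ ≤ _ := B.le_opNorm a
    _ ≤ ‖B‖ * 1 := by gcongr
    _ = ‖B‖ := by ring

section Phase

variable {d : ℕ} {Φ : TFPlane d → ℝ}

theorem norm_coordDir_le (m : Fin d ⊕ Fin d) : ‖coordDir m‖ ≤ 1 := by
  rcases m with i | i <;> simp [coordDir, Prod.norm_def]

theorem IsPhase.differentiable (h : IsPhase Φ) : Differentiable ℝ Φ :=
  h.smooth.differentiable (by simp)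

theorem IsPhase.differentiable_fderiv (h : IsPhase Φ) : Differentiable ℝ (fderiv ℝ Φ) :=
  (h.smooth.fderiv_right (m := 1) (by norm_cast)).differentiable (by simp)

theorem IsPhase.differentiable_fderiv_fderiv (h : IsPhase Φ) :
    Differentiable ℝ (fderiv ℝ (fderiv ℝ Φ)) :=
  ((h.smooth.fderiv_right (m := 2) (by norm_cast)).fderiv_right (m := 1)
    (by norm_num [one_add_one_eq_two])).differentiable (by simp)

theorem IsPhase.exists_norm_fderiv_sub_le (h : IsPhase Φ) :
    ∃ C : ℝ, 0 ≤ C ∧ ∀ z z', ‖fderiv ℝ Φ z - fderiv ℝ Φ z'‖ ≤ C * ‖z - z'‖ := by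
  obtain ⟨C, hC⟩ := h.bounded_deriv 2 le_rfl
  refine ⟨C, (norm_nonneg _).trans (hC 0), norm_sub_le_of_norm_iteratedFDeriv_one_le
    h.differentiable_fderiv fun x => ?_⟩
  rw [norm_iteratedFDeriv_fderiv]
  exact hC x

theorem IsPhase.exists_norm_fderiv_fderiv_sub_le (h : IsPhase Φ) :
    ∃ C : ℝ, 0 ≤ C ∧ ∀ z z',
      ‖fderiv ℝ (fderiv ℝ Φ) z - fderiv ℝ (fderiv ℝ Φ) z'‖ ≤ C * ‖z - z'‖ := by
  obtain ⟨C, hC⟩ := h.bounded_deriv 3 (by norm_num)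
  refine ⟨C, (norm_nonneg _).trans (hC 0), ?_⟩
  refine norm_sub_le_of_norm_iteratedFDeriv_one_le (E := TFPlane d)
    (F := TFPlane d →L[ℝ] TFPlane d →L[ℝ] ℝ) h.differentiable_fderiv_fderiv fun x => ?_
  rw [norm_iteratedFDeriv_fderiv, norm_iteratedFDeriv_fderiv]
  exact hC x

theorem toDual_symm_apply_coord (ℓ : StrongDual ℝ (Rd d)) (i : Fin d) :
    (InnerProductSpace.toDual ℝ (Rd d)).symm ℓ i = ℓ (EuclideanSpace.single i 1) := by
  rw [← InnerProductSpace.toDual_symm_apply (𝕜 := ℝ), EuclideanSpace.inner_single_right]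
  simp

theorem IsPhase.gradX_apply (h : IsPhase Φ) (x η : Rd d) (i : Fin d) :
    gradX Φ x η i = fderiv ℝ Φ (x, η) (coordDir (Sum.inl i)) := by
  have h1 : HasFDerivAt (fun x' => Φ (x', η))
      ((fderiv ℝ Φ (x, η)).comp (ContinuousLinearMap.inl ℝ (Rd d) (Rd d))) x :=
    (h.differentiable (x, η)).hasFDerivAt.comp x (hasFDerivAt_prodMk_left x η)
  rw [gradX, gradient, h1.fderiv, toDual_symm_apply_coord]
  simp [coordDir]

theorem IsPhase.gradEta_apply (h : IsPhase Φ) (x η : Rd d) (i : Fin d) :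
    gradEta Φ x η i = fderiv ℝ Φ (x, η) (coordDir (Sum.inr i)) := by
  have h1 : HasFDerivAt (fun η' => Φ (x, η'))
      ((fderiv ℝ Φ (x, η)).comp (ContinuousLinearMap.inr ℝ (Rd d) (Rd d))) η :=
    (h.differentiable (x, η)).hasFDerivAt.comp η (hasFDerivAt_prodMk_right x η)
  rw [gradEta, gradient, h1.fderiv, toDual_symm_apply_coord]
  simp [coordDir]

theorem mixedHessian_apply (z : TFPlane d) (i j : Fin d) :
    mixedHessian Φ z i j =
      fderiv ℝ (fderiv ℝ Φ) z (coordDir (Sum.inl i)) (coordDir (Sum.inr j)) := by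
  rw [mixedHessian, Matrix.of_apply, iteratedFDeriv_two_apply]
  simp

theorem sum_smul_coordDir_inl (v : Rd d) :
    ∑ j, v j • coordDir (Sum.inl j) = ((v, 0) : TFPlane d) := by
  simp only [coordDir, Prod.smul_mk, smul_zero]
  rw [show ((v, 0) : TFPlane d) = ContinuousLinearMap.inl ℝ (Rd d) (Rd d) v from rfl]
  conv_rhs => rw [← (EuclideanSpace.basisFun (Fin d) ℝ).sum_repr v, map_sum]
  simp

theorem sum_smul_coordDir_inr (v : Rd d) :
    ∑ j, v j • coordDir (Sum.inr j) = ((0, v) : TFPlane d) := by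
  simp only [coordDir, Prod.smul_mk, smul_zero]
  rw [show ((0, v) : TFPlane d) = ContinuousLinearMap.inr ℝ (Rd d) (Rd d) v from rfl]
  conv_rhs => rw [← (EuclideanSpace.basisFun (Fin d) ℝ).sum_repr v, map_sum]
  simp

theorem IsPhase.hasFDerivAt_gradEta (h : IsPhase Φ) (x η : Rd d) :
    HasFDerivAt (fun x => gradEta Φ x η)
      (Matrix.toEuclideanCLM (𝕜 := ℝ) (mixedHessian Φ (x, η)).transpose) x := by
  rw [← hasFDerivWithinAt_univ, hasFDerivWithinAt_euclidean]
  intro i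
  rw [hasFDerivWithinAt_univ]
  simp only [h.gradEta_apply]
  have h1 := hasFDerivAt_fderiv_comp_apply h.differentiable_fderiv
    (hasFDerivAt_prodMk_left x η) (coordDir (d := d) (Sum.inr i))
  refine h1.congr_fderiv ?_
  ext v
  have h2 : Matrix.toEuclideanCLM (𝕜 := ℝ) (mixedHessian Φ (x, η)).transpose v i =
      ∑ j, mixedHessian Φ (x, η) j i * v j := by
    simp [toEuclideanCLM_apply]
  rw [ContinuousLinearMap.comp_apply, ContinuousLinearMap.comp_apply, EuclideanSpace.coe_proj]
  beta_reduce
  rw [h2,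
    ContinuousLinearMap.flip_apply, ContinuousLinearMap.inl_apply, ← sum_smul_coordDir_inl, map_sum]
  simp [mixedHessian_apply, mul_comm]

theorem IsPhase.hasFDerivAt_gradX (h : IsPhase Φ) (x η : Rd d) :
    HasFDerivAt (fun η => gradX Φ x η)
      (Matrix.toEuclideanCLM (𝕜 := ℝ) (mixedHessian Φ (x, η))) η := by
  rw [← hasFDerivWithinAt_univ, hasFDerivWithinAt_euclidean]
  intro i
  rw [hasFDerivWithinAt_univ]
  simp only [h.gradX_apply]
  have h1 := hasFDerivAt_fderiv_comp_apply h.differentiable_fderiv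
    (hasFDerivAt_prodMk_right x η) (coordDir (d := d) (Sum.inl i))
  -- `mixedHessian` has the `x`-direction in its first slot, whereas differentiating `∇_xΦ` in `η`
  -- puts the `η`-direction there.
  have hsymm : IsSymmSndFDerivAt ℝ Φ (x, η) :=
    h.smooth.contDiffAt.isSymmSndFDerivAt (by simp; norm_cast)
  refine h1.congr_fderiv ?_
  ext v
  have h2 : Matrix.toEuclideanCLM (𝕜 := ℝ) (mixedHessian Φ (x, η)) v i =
      ∑ j, mixedHessian Φ (x, η) i j * v j := toEuclideanCLM_apply _ _ _
  rw [ContinuousLinearMap.comp_apply, ContinuousLinearMap.comp_apply, EuclideanSpace.coe_proj]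
  beta_reduce
  rw [h2,
    ContinuousLinearMap.flip_apply, ContinuousLinearMap.inr_apply, hsymm.eq,
    ← sum_smul_coordDir_inr, map_sum]
  simp [mixedHessian_apply, mul_comm]

theorem IsPhase.exists_abs_mixedHessian_le (h : IsPhase Φ) :
    ∃ b : ℝ, ∀ z i j, |mixedHessian Φ z i j| ≤ b := by
  obtain ⟨b, hb⟩ := h.bounded_deriv 2 le_rfl
  refine ⟨b, fun z i j => ?_⟩
  rw [mixedHessian_apply]
  refine (abs_apply_apply_le_of_norm_le_one _ (norm_coordDir_le _) (norm_coordDir_le _)).trans ?_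
  have := hb z
  rwa [← norm_iteratedFDeriv_fderiv, norm_iteratedFDeriv_one] at this

theorem IsPhase.exists_abs_mixedHessian_sub_le (h : IsPhase Φ) :
    ∃ L : ℝ, ∀ z z' i j, |mixedHessian Φ z i j - mixedHessian Φ z' i j| ≤ L * ‖z - z'‖ := by
  obtain ⟨L, -, hL⟩ := h.exists_norm_fderiv_fderiv_sub_le
  refine ⟨L, fun z z' i j => ?_⟩
  rw [mixedHessian_apply, mixedHessian_apply]
  exact (abs_apply_apply_sub_le_of_norm_le_one _ _ (norm_coordDir_le _) (norm_coordDir_le _)).trans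
    (hL z z')

theorem IsPhase.exists_abs_fderiv_coordDir_sub_le (h : IsPhase Φ) :
    ∃ L : ℝ, 0 ≤ L ∧ ∀ (m : Fin d ⊕ Fin d) (x x' η η' : Rd d),
      |fderiv ℝ Φ (x, η) (coordDir m) - fderiv ℝ Φ (x', η') (coordDir m)| ≤
        L * (‖x - x'‖ + ‖η - η'‖) := by
  obtain ⟨L, hL₀, hL⟩ := h.exists_norm_fderiv_sub_le
  refine ⟨L, hL₀, fun m x x' η η' => ?_⟩
  rw [← sub_apply]
  refine (abs_apply_le_of_norm_le_one _ (norm_coordDir_le m)).trans ((hL _ _).trans ?_)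
  refine mul_le_mul_of_nonneg_left ?_ hL₀
  rw [Prod.mk_sub_mk, Prod.norm_def]
  exact max_le_add_of_nonneg (norm_nonneg _) (norm_nonneg _)

/-- Bi-Lipschitz properties of the partial gradients of a phase function. -/
theorem IsPhase.exists_gradient_bounds (h : IsPhase Φ) :
    ∃ C : ℝ, 1 ≤ C ∧
      (∀ η, Function.Bijective fun x => gradEta Φ x η) ∧
      (∀ x, Function.Bijective fun η => gradX Φ x η) ∧
      (∀ x x' η, ‖x - x'‖ ≤ C * ‖gradEta Φ x η - gradEta Φ x' η‖) ∧
      (∀ x η η', ‖η - η'‖ ≤ C * ‖gradX Φ x η - gradX Φ x η'‖) ∧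
      (∀ x x' η η', ‖gradEta Φ x η - gradEta Φ x' η'‖ ≤ C * (‖x - x'‖ + ‖η - η'‖)) ∧
      (∀ x x' η η', ‖gradX Φ x η - gradX Φ x' η'‖ ≤ C * (‖x - x'‖ + ‖η - η'‖)) := by
  obtain ⟨b, hentry⟩ := h.exists_abs_mixedHessian_le
  obtain ⟨δ, hδ, hdet⟩ := h.nondegenerate
  obtain ⟨L₁, hL₁, hcoord⟩ := h.exists_abs_fderiv_coordDir_sub_le
  obtain ⟨L₂, hentry'⟩ := h.exists_abs_mixedHessian_sub_le
  -- `C₀` depends only on the entry bound and on `δ`, so it is uniform in the frozen variable.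
  obtain ⟨C₀, hC₀, hC⟩ := exists_bijective_and_antilipschitz d b δ hδ
  have hx := fun η => hC (fun x => gradEta Φ x η) (fun x => (mixedHessian Φ (x, η)).transpose) L₂
    (fun x => h.hasFDerivAt_gradEta x η) (fun x i j => hentry _ _ _)
    (fun x => by rw [Matrix.det_transpose]; exact hdet _)
    (fun x y i j => by
      refine (hentry' (x, η) (y, η) j i).trans (le_of_eq ?_)
      simp [Prod.norm_def])
  have hη := fun x => hC (fun η => gradX Φ x η) (fun η => mixedHessian Φ (x, η)) L₂
    (fun η => h.hasFDerivAt_gradX x η) (fun η i j => hentry _ _ _) (fun η => hdet _)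
    (fun η η' i j => by
      refine (hentry' (x, η) (x, η') i j).trans (le_of_eq ?_)
      simp [Prod.norm_def])
  have hCle : C₀ ≤ 1 + C₀ + d * L₁ := by nlinarith [show (0 : ℝ) ≤ d * L₁ by positivity]
  have hdle : d * L₁ ≤ 1 + C₀ + d * L₁ := by linarith
  refine ⟨1 + C₀ + d * L₁, by nlinarith [show (0 : ℝ) ≤ d * L₁ by positivity],
    fun η => (hx η).1, fun x => (hη x).1, fun x x' η => ?_, fun x η η' => ?_, ?_, ?_⟩
  · exact ((hx η).2 x x').trans (mul_le_mul_of_nonneg_right hCle (norm_nonneg _))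
  · exact ((hη x).2 η η').trans (mul_le_mul_of_nonneg_right hCle (norm_nonneg _))
  · intro x x' η η'
    refine (norm_le_of_abs_apply_le (b := L₁ * (‖x - x'‖ + ‖η - η'‖)) fun i => ?_).trans ?_
    · rw [PiLp.sub_apply, h.gradEta_apply, h.gradEta_apply]
      exact hcoord _ _ _ _ _
    · rw [← mul_assoc]
      gcongr
  · intro x x' η η'
    refine (norm_le_of_abs_apply_le (b := L₁ * (‖x - x'‖ + ‖η - η'‖)) fun i => ?_).trans ?_
    · rw [PiLp.sub_apply, h.gradX_apply, h.gradX_apply]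
      exact hcoord _ _ _ _ _
    · rw [← mul_assoc]
      gcongr

/-- Properties of the canonical transformation: it is a bi-Lipschitz bijection, and the distance of
a point to its image is controlled by the gradient of the phase. -/
theorem IsPhase.exists_canonicalTransformation_bounds (h : IsPhase Φ) :
    ∃ C : ℝ, 1 ≤ C ∧
      Function.Surjective (canonicalTransformation Φ) ∧
      (∀ w w', ‖canonicalTransformation Φ w - canonicalTransformation Φ w'‖ ≤ C * ‖w - w'‖) ∧
      (∀ w w', ‖w - w'‖ ≤ C * ‖canonicalTransformation Φ w - canonicalTransformation Φ w'‖) ∧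
      (∀ x ξ y η, ‖((x, ξ) : TFPlane d) - canonicalTransformation Φ (y, η)‖ ≤
        C * (‖ξ - gradX Φ x η‖ + ‖y - gradEta Φ x η‖)) := by
  obtain ⟨C, hC, b1, b2, a1, a2, l1, l2⟩ := h.exists_gradient_bounds
  have hspec : ∀ y η, gradEta Φ (canonicalTransformation Φ (y, η)).1 η = y ∧
      gradX Φ (canonicalTransformation Φ (y, η)).1 η = (canonicalTransformation Φ (y, η)).2 := by
    intro y η
    have := (canonicalTransformation_eq_iff (b1 η) (canonicalTransformation Φ (y, η)).1 y
      (canonicalTransformation Φ (y, η)).2).1 rfl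
    exact ⟨this.1.symm, this.2.symm⟩
  have hfst : ∀ w : TFPlane d, ‖w.1‖ ≤ ‖w‖ := fun w => norm_fst_le w
  have hsnd : ∀ w : TFPlane d, ‖w.2‖ ≤ ‖w‖ := fun w => norm_snd_le w
  have hbig : ∀ K : ℝ, K ≤ 8 * C ^ 3 → ∀ t, 0 ≤ t → K * t ≤ 8 * C ^ 3 * t := fun K hK t ht =>
    mul_le_mul_of_nonneg_right hK ht
  have hC2 : C ≤ C ^ 2 := by nlinarith
  have hC3 : C ^ 2 ≤ C ^ 3 := by nlinarith [sq_nonneg C]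
  -- A crude common bound for the constants of the four estimates below.
  refine ⟨8 * C ^ 3, by nlinarith, ?_, ?_, ?_, ?_⟩
  · rintro ⟨x, ξ⟩
    obtain ⟨η, hη⟩ := (b2 x).surjective ξ
    exact ⟨(gradEta Φ x η, η), (canonicalTransformation_eq_iff (b1 η) _ _ _).2 ⟨rfl, hη.symm⟩⟩
  · rintro ⟨y, η⟩ ⟨y', η'⟩
    obtain ⟨e1, e2⟩ := hspec y η
    obtain ⟨e1', e2'⟩ := hspec y' η'
    set X := canonicalTransformation Φ (y, η)
    set X' := canonicalTransformation Φ (y', η')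
    have f1 : ‖y - y'‖ ≤ ‖((y, η) : TFPlane d) - (y', η')‖ := hfst ((y, η) - (y', η'))
    have f2 : ‖η - η'‖ ≤ ‖((y, η) : TFPlane d) - (y', η')‖ := hsnd ((y, η) - (y', η'))
    set R := ‖((y, η) : TFPlane d) - (y', η')‖
    have hR : 0 ≤ R := norm_nonneg _
    -- The `x`-components are compared at the same `η`; replacing `η'` by `η` in `y' = ∇_ηΦ(x', η')`
    -- costs at most `C ‖η - η'‖`.
    have g1 := a1 X.1 X'.1 η
    have g2 := l1 X'.1 X'.1 η η'
    have g3 : ‖gradEta Φ X.1 η - gradEta Φ X'.1 η‖ ≤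
        ‖gradEta Φ X.1 η - gradEta Φ X'.1 η'‖ + ‖gradEta Φ X'.1 η - gradEta Φ X'.1 η'‖ := by
      rw [norm_sub_rev (gradEta Φ X'.1 η)]
      exact norm_sub_le_norm_sub_add_norm_sub _ _ _
    rw [e1, e1'] at g3
    rw [e1'] at g2
    rw [e1] at g1
    rw [sub_self, norm_zero, zero_add] at g2
    have g4 : ‖X.1 - X'.1‖ ≤ 2 * C ^ 2 * R := by
      calc _ ≤ _ := g1
        _ ≤ C * (R + C * R) := by gcongr; exact g3.trans (add_le_add f1 (g2.trans (by gcongr)))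
        _ ≤ 2 * C ^ 2 * R := by nlinarith
    have g5 := l2 X.1 X'.1 η η'
    rw [e2, e2'] at g5
    have g6 : ‖X.2 - X'.2‖ ≤ 8 * C ^ 3 * R :=
      calc _ ≤ _ := g5
        _ ≤ C * (2 * C ^ 2 * R + R) := by gcongr
        _ = (2 * C ^ 3 + C) * R := by ring
        _ ≤ _ := hbig _ (by nlinarith) _ hR
    rw [Prod.norm_def]
    exact max_le (g4.trans (hbig _ (by nlinarith) _ hR)) g6
  · rintro ⟨y, η⟩ ⟨y', η'⟩
    obtain ⟨e1, e2⟩ := hspec y η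
    obtain ⟨e1', e2'⟩ := hspec y' η'
    set X := canonicalTransformation Φ (y, η)
    set X' := canonicalTransformation Φ (y', η')
    have f1 : ‖X.1 - X'.1‖ ≤ ‖X - X'‖ := hfst (X - X')
    have f2 : ‖X.2 - X'.2‖ ≤ ‖X - X'‖ := hsnd (X - X')
    set R := ‖X - X'‖
    have hR : 0 ≤ R := norm_nonneg _
    -- The mirror image of the previous bound: now `η` is recovered from `ξ = ∇_xΦ(x, η)` with `x`
    -- frozen, and then `y` from both.
    have g1 := a2 X.1 η η'
    have g2 := l2 X.1 X'.1 η' η'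
    have g3 : ‖gradX Φ X.1 η - gradX Φ X.1 η'‖ ≤
        ‖gradX Φ X.1 η - gradX Φ X'.1 η'‖ + ‖gradX Φ X.1 η' - gradX Φ X'.1 η'‖ := by
      rw [norm_sub_rev (gradX Φ X.1 η')]
      exact norm_sub_le_norm_sub_add_norm_sub _ _ _
    rw [sub_self, norm_zero, add_zero] at g2
    have g4 : ‖η - η'‖ ≤ 2 * C ^ 2 * R := by
      rw [e2, e2'] at g3
      rw [e2] at g1
      rw [e2'] at g2
      calc _ ≤ _ := g1
        _ ≤ C * (R + C * R) := by gcongr; exact g3.trans (add_le_add f2 (g2.trans (by gcongr)))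
        _ ≤ 2 * C ^ 2 * R := by nlinarith
    have g5 := l1 X.1 X'.1 η η'
    rw [e1, e1'] at g5
    have g6 : ‖y - y'‖ ≤ 8 * C ^ 3 * R :=
      calc _ ≤ _ := g5
        _ ≤ C * (R + 2 * C ^ 2 * R) := by gcongr
        _ = (2 * C ^ 3 + C) * R := by ring
        _ ≤ _ := hbig _ (by nlinarith) _ hR
    rw [Prod.norm_def]
    exact max_le g6 (g4.trans (hbig _ (by nlinarith) _ hR))
  · intro x ξ y η
    obtain ⟨e1, e2⟩ := hspec y η
    set X := canonicalTransformation Φ (y, η)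
    -- As `y = ∇_ηΦ(X.1, η)`, the residual `y - ∇_ηΦ(x, η)` measures `x - X.1`; the `ξ`-component is
    -- then compared through `∇_xΦ(x, η)`.
    have g1 := a1 x X.1 η
    rw [e1, norm_sub_rev (gradEta Φ x η)] at g1
    have g2 := l2 x X.1 η η
    rw [e2, sub_self, norm_zero, add_zero] at g2
    have g3 : ‖ξ - X.2‖ ≤ ‖ξ - gradX Φ x η‖ + ‖gradX Φ x η - X.2‖ :=
      norm_sub_le_norm_sub_add_norm_sub _ _ _
    set R := ‖ξ - gradX Φ x η‖ + ‖y - gradEta Φ x η‖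
    have hR : 0 ≤ R := by positivity
    have r1 : ‖ξ - gradX Φ x η‖ ≤ R := le_add_of_nonneg_right (norm_nonneg _)
    have r2 : ‖y - gradEta Φ x η‖ ≤ R := le_add_of_nonneg_left (norm_nonneg _)
    have g4 : ‖x - X.1‖ ≤ C * R := g1.trans (by gcongr)
    have g5 : ‖ξ - X.2‖ ≤ 8 * C ^ 3 * R :=
      calc _ ≤ _ := g3
        _ ≤ R + C * (C * R) := add_le_add r1 (g2.trans (by gcongr))
        _ = (1 + C ^ 2) * R := by ring
        _ ≤ _ := hbig _ (by nlinarith) _ hR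
    rw [Prod.norm_def]
    exact max_le (g4.trans (hbig _ (by nlinarith) _ hR)) g5

end Phase

/-! ### The oscillation `e^{2πi y}` -/

/-- `y ↦ e^{2πi y}`. -/
def expI (y : ℝ) : ℂ := Complex.exp (2 * Real.pi * Complex.I * (y : ℂ))

theorem norm_expI (y : ℝ) : ‖expI y‖ = 1 := by
  rw [expI, Complex.norm_exp]
  simp

theorem expI_add (x y : ℝ) : expI (x + y) = expI x * expI y := by
  rw [expI, expI, expI, ← Complex.exp_add]
  push_cast
  ring_nf

theorem conj_expI (y : ℝ) : (starRingEnd ℂ) (expI y) = expI (-y) := by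
  rw [expI, ← Complex.exp_conj, expI]
  simp [Complex.conj_ofNat]

theorem hasDerivAt_expI (y : ℝ) : HasDerivAt expI (2 * Real.pi * Complex.I * expI y) y := by
  have h1 : HasDerivAt (fun y : ℝ => 2 * Real.pi * Complex.I * (y : ℂ))
      (2 * Real.pi * Complex.I * 1) y :=
    (Complex.ofRealCLM.hasDerivAt (x := y)).const_mul (2 * Real.pi * Complex.I)
  refine h1.cexp.congr_deriv ?_
  rw [expI]
  ring

theorem contDiff_expI : ContDiff ℝ (⊤ : ℕ∞) expI := by
  have hc : ContDiff ℝ (⊤ : ℕ∞) (fun y : ℝ => (y : ℂ)) := Complex.ofRealCLM.contDiff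
  exact (contDiff_const.mul hc).cexp

@[fun_prop]
theorem continuous_expI : Continuous expI := contDiff_expI.continuous

theorem iteratedDeriv_expI (n : ℕ) :
    iteratedDeriv n expI = fun y => (2 * Real.pi * Complex.I) ^ n * expI y := by
  induction n with
  | zero => simp
  | succ n ih =>
    rw [iteratedDeriv_succ, ih]
    funext y
    rw [((hasDerivAt_expI y).const_mul _).deriv]
    ring

theorem norm_iteratedFDeriv_expI (n : ℕ) (y : ℝ) :
    ‖iteratedFDeriv ℝ n expI y‖ = (2 * Real.pi) ^ n := by
  rw [norm_iteratedFDeriv_eq_norm_iteratedDeriv, iteratedDeriv_expI]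
  simp [norm_expI, abs_of_pos Real.pi_pos]

theorem hasTemperateGrowth_expI : Function.HasTemperateGrowth expI :=
  ⟨contDiff_expI, fun n => ⟨0, (2 * Real.pi) ^ n, fun y => by
    simp [norm_iteratedFDeriv_expI]⟩⟩

/-! ### Integration by parts against an oscillation -/

section Oscillation

variable {E : Type*} [NormedAddCommGroup E] [NormedSpace ℝ E]

theorem hasTemperateGrowth_expI_comp (ℓ : E →L[ℝ] ℝ) :
    Function.HasTemperateGrowth fun z => expI (ℓ z) :=
  hasTemperateGrowth_expI.comp ℓ.hasTemperateGrowth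

theorem lineDerivOp_smulLeftCLM_expI (ℓ : E →L[ℝ] ℝ) (B : 𝓢(E, ℂ)) (v z : E) :
    ∂_{v} (smulLeftCLM ℂ (fun z => expI (ℓ z)) B) z =
      (2 * Real.pi * Complex.I * (ℓ v : ℝ)) * (expI (ℓ z) * B z) + expI (ℓ z) * ∂_{v} B z := by
  have h1 : HasFDerivAt (fun z => expI (ℓ z)) (ℓ.smulRight (2 * Real.pi * Complex.I * expI (ℓ z)))
      z := by
    have := (hasDerivAt_expI (ℓ z)).hasFDerivAt.comp z ℓ.hasFDerivAt
    refine this.congr_fderiv ?_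
    ext w
    simp
  have h2 := h1.mul (B.differentiableAt (x := z)).hasFDerivAt
  have h3 : (smulLeftCLM ℂ (fun z => expI (ℓ z)) B : E → ℂ) = (fun z => expI (ℓ z)) * ⇑B := by
    funext z
    simp [smulLeftCLM_apply_apply (hasTemperateGrowth_expI_comp ℓ)]
  rw [lineDerivOp_apply_eq_fderiv, h3, h2.fderiv, lineDerivOp_apply_eq_fderiv]
  simp
  ring

theorem norm_iterate_lineDerivOp_le {v : E} (hv : ‖v‖ ≤ 1) (B : 𝓢(E, ℂ)) (i : ℕ) (z : E) :
    ‖((∂_{v})^[i] B) z‖ ≤ ‖iteratedFDeriv ℝ i B z‖ := by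
  rw [← LineDeriv.iteratedLineDerivOp_const_eq_iter_lineDerivOp, iteratedLineDerivOp_eq_iteratedFDeriv]
  refine (ContinuousMultilinearMap.le_opNorm _ _).trans ?_
  refine mul_le_of_le_one_right (norm_nonneg _) ?_
  exact Finset.prod_le_one (fun _ _ => norm_nonneg _) fun _ _ => hv

variable [MeasurableSpace E] [BorelSpace E] [SecondCountableTopology E]
  {ν : Measure E} [ν.HasTemperateGrowth]

theorem integrable_mul_schwartz {τ : E → ℂ} {M : ℝ} (h : AEStronglyMeasurable τ ν)
    (hM : ∀ᵐ z ∂ν, ‖τ z‖ ≤ M) (A : 𝓢(E, ℂ)) : Integrable (fun z => τ z * A z) ν :=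
  A.integrable.bdd_mul h hM

/-- Nonstationary phase: decay of an oscillatory integral against a function with bounded weak
derivatives `τ k` of order `k ≤ m` in a fixed direction. -/
theorem pow_mul_norm_integral_le {m : ℕ} {τ : ℕ → E → ℂ} {M : ℝ} {v : E} (hM₀ : 0 ≤ M)
    (hτ : ∀ k ≤ m, AEStronglyMeasurable (τ k) ν) (hM : ∀ k ≤ m, ∀ᵐ z ∂ν, ‖τ k z‖ ≤ M)
    (hparts : ∀ k < m, ∀ A : 𝓢(E, ℂ), ∫ z, τ k z * ∂_{v} A z ∂ν = -∫ z, τ (k + 1) z * A z ∂ν)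
    (ℓ : E →L[ℝ] ℝ) (n : ℕ) : ∀ (k : ℕ), k + n ≤ m → ∀ (B : 𝓢(E, ℂ)) (R : ℝ),
      (∀ i ≤ n, ∫ z, ‖((∂_{v})^[i] B) z‖ ∂ν ≤ R) →
      |2 * Real.pi * ℓ v| ^ n * ‖∫ z, τ k z * (expI (ℓ z) * B z) ∂ν‖ ≤ 2 ^ n * (M * R) := by
  induction n with
  | zero =>
    intro k hk B R hR
    simp only [pow_zero, one_mul]
    have h1 := hR 0 le_rfl
    simp only [Function.iterate_zero, id_eq] at h1
    refine (norm_integral_le_of_norm_le (g := fun z => M * ‖B z‖)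
      (B.integrable.norm.const_mul M) ?_).trans ?_
    · filter_upwards [hM k hk] with z hz
      rw [norm_mul, norm_mul, norm_expI, one_mul]
      gcongr
    · rw [integral_const_mul]
      gcongr
  | succ n ih =>
    intro k hk B R hR
    have hSa : ∀ (B : 𝓢(E, ℂ)) z,
        smulLeftCLM ℂ (fun z => expI (ℓ z)) B z = expI (ℓ z) * B z := fun B z => by
      simp [smulLeftCLM_apply_apply (hasTemperateGrowth_expI_comp ℓ)]
    have hint : ∀ B : 𝓢(E, ℂ), Integrable (fun z => τ k z * (expI (ℓ z) * B z)) ν := fun B => by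
      simpa only [hSa] using integrable_mul_schwartz (hτ k (by omega)) (hM k (by omega))
        (smulLeftCLM ℂ (fun z => expI (ℓ z)) B)
    -- Differentiating `expI ∘ ℓ` produces the factor `2πi ℓ v`. Integration by parts trades it for
    -- two terms, with the derivative on `τ k` or on `B`. This is why `k` and `B` vary in the
    -- induction and why each step costs a factor 2.
    have h1 := hparts k (by omega) (smulLeftCLM ℂ (fun z => expI (ℓ z)) B)
    simp only [lineDerivOp_smulLeftCLM_expI, hSa, mul_add] at h1
    simp only [mul_left_comm (τ k _) (2 * Real.pi * Complex.I * ((ℓ v : ℝ) : ℂ))] at h1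
    rw [integral_add ((hint B).const_mul _) (hint (∂_{v} B)), integral_const_mul] at h1
    have h2 : ‖(2 * Real.pi * Complex.I * ((ℓ v : ℝ) : ℂ))‖ = |2 * Real.pi * ℓ v| := by
      simp [abs_mul, abs_of_pos Real.pi_pos]
    have h3 : |2 * Real.pi * ℓ v| * ‖∫ z, τ k z * (expI (ℓ z) * B z) ∂ν‖ ≤
        ‖∫ z, τ (k + 1) z * (expI (ℓ z) * B z) ∂ν‖ +
          ‖∫ z, τ k z * (expI (ℓ z) * ∂_{v} B z) ∂ν‖ := by
      rw [← h2, ← norm_mul, eq_sub_of_add_eq h1]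
      refine (norm_sub_le _ _).trans ?_
      rw [norm_neg]
    have h4 := ih (k + 1) (by omega) B R (fun i hi => hR i (by omega))
    have h5 := ih k (by omega) (∂_{v} B) R (fun i hi => by
      rw [← Function.iterate_succ_apply]
      exact hR (i + 1) (by omega))
    calc _ = |2 * Real.pi * ℓ v| ^ n *
          (|2 * Real.pi * ℓ v| * ‖∫ z, τ k z * (expI (ℓ z) * B z) ∂ν‖) := by ring
      _ ≤ |2 * Real.pi * ℓ v| ^ n * (‖∫ z, τ (k + 1) z * (expI (ℓ z) * B z) ∂ν‖ +
          ‖∫ z, τ k z * (expI (ℓ z) * ∂_{v} B z) ∂ν‖) := by gcongr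
      _ ≤ _ := by rw [mul_add, pow_succ]; linarith

end Oscillation

/-! ### Weak derivatives of a symbol -/

instance instIsAddHaarMeasureVolumeTFPlane {d : ℕ} :
    (volume : Measure (TFPlane d)).IsAddHaarMeasure :=
  inferInstanceAs (((volume : Measure (Rd d)).prod (volume : Measure (Rd d))).IsAddHaarMeasure)

theorem ae_norm_coe_le_norm_Lp_top {E : Type*} [MeasurableSpace E] {ν : Measure E}
    (f : Lp ℂ ∞ ν) : ∀ᵐ z ∂ν, ‖f z‖ ≤ ‖f‖ := by
  filter_upwards [ae_le_eLpNormEssSup (f := f) (μ := ν)] with z hz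
  rw [Lp.norm_def, eLpNorm_exponent_top, ← toReal_enorm]
  refine ENNReal.toReal_mono ?_ hz
  rw [← eLpNorm_exponent_top]
  exact Lp.eLpNorm_ne_top f

/-- Only pure derivatives in one coordinate direction are needed. Testing the distributional
derivatives against Schwartz functions turns them into an integration by parts rule for honest
bounded functions. -/
theorem IsSymbol.exists_weak_derivatives {d m : ℕ} {σ : TFPlane d → ℂ} (hσ : IsSymbol m σ) :
    ∃ M : ℝ, 0 ≤ M ∧ ∀ j : Fin d ⊕ Fin d, ∃ τ : ℕ → TFPlane d → ℂ,
      τ 0 =ᵐ[volume] σ ∧ (∀ k ≤ m, AEStronglyMeasurable (τ k) volume) ∧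
      (∀ k ≤ m, ∀ᵐ z, ‖τ k z‖ ≤ M) ∧
      ∀ k < m, ∀ A : 𝓢(TFPlane d, ℂ),
        ∫ z, τ k z * ∂_{coordDir j} A z = -∫ z, τ (k + 1) z * A z := by
  obtain ⟨hσ', h⟩ := hσ
  have h' : ∀ (j : Fin d ⊕ Fin d) (k : ℕ), ∃ τ : Lp ℂ ∞ (volume : Measure (TFPlane d)),
      (k = 0 → τ = hσ'.toLp σ) ∧
      (k ≤ m → ∂^{fun _ : Fin k => coordDir j} (Lp.toTemperedDistribution (hσ'.toLp σ)) =
        Lp.toTemperedDistribution τ) := by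
    -- The zeroth function is fixed to be the class of `σ` itself, so that no uniqueness of
    -- representing functions has to be invoked.
    intro j k
    rcases Nat.eq_zero_or_pos k with rfl | hk0
    · exact ⟨hσ'.toLp σ, fun _ => rfl, fun _ => rfl⟩
    by_cases hk : k ≤ m
    · obtain ⟨τ, hτ⟩ := h k hk (fun _ => j)
      exact ⟨τ, fun h0 => absurd h0 hk0.ne', fun _ => hτ⟩
    · exact ⟨0, fun h0 => absurd h0 hk0.ne', fun hk' => absurd hk' hk⟩
  choose τ hτ0 hτ using h'
  obtain ⟨M, hM0, hM⟩ : ∃ M : ℝ, 0 ≤ M ∧ ∀ j, ∀ k ∈ Finset.range (m + 1), ‖τ j k‖ ≤ M := by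
    refine ⟨∑ j, ∑ k ∈ Finset.range (m + 1), ‖τ j k‖, by positivity, fun j k hk => ?_⟩
    exact (Finset.single_le_sum (f := fun k => ‖τ j k‖) (fun _ _ => norm_nonneg _) hk).trans
      (Finset.single_le_sum (f := fun j => ∑ k ∈ Finset.range (m + 1), ‖τ j k‖)
        (fun _ _ => Finset.sum_nonneg fun _ _ => norm_nonneg _) (Finset.mem_univ j))
  refine ⟨M, hM0, fun j => ⟨fun k => τ j k, ?_, fun k _ => Lp.aestronglyMeasurable _,
    fun k hk => ?_, fun k hk A => ?_⟩⟩
  · simp only [hτ0 j 0 rfl]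
    exact hσ'.coeFn_toLp
  · filter_upwards [ae_norm_coe_le_norm_Lp_top (τ j k)] with z hz
    exact hz.trans (hM j k (Finset.mem_range.2 (by omega)))
  · have h1 := hτ j (k + 1) hk
    rw [LineDeriv.iteratedLineDerivOp_succ_left] at h1
    have h2 : ∂^{Fin.tail fun _ : Fin (k + 1) => coordDir j}
        (Lp.toTemperedDistribution (hσ'.toLp σ)) = Lp.toTemperedDistribution (τ j k) :=
      hτ j k hk.le
    rw [h2] at h1
    have h3 := DFunLike.congr_fun h1 A
    rw [TemperedDistribution.lineDerivOp_apply_apply, map_neg, Lp.toTemperedDistribution_apply,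
      Lp.toTemperedDistribution_apply] at h3
    simp only [smul_eq_mul, mul_comm (A _), mul_comm (∂_{coordDir j} A _)] at h3
    rw [← h3, neg_neg]

/-! ### Tensor products of Schwartz functions -/

/-- A weighted form of the Leibniz estimate for the derivatives of a product. -/
theorem mul_norm_iteratedFDeriv_mul_le {E : Type*} [NormedAddCommGroup E] [NormedSpace ℝ E]
    {A B : E → ℂ} (hA : ContDiff ℝ (⊤ : ℕ∞) A) (hB : ContDiff ℝ (⊤ : ℕ∞) B) {n i : ℕ} (hi : i ≤ n)
    {x : E} {w α β a b : ℝ} (hα : 0 ≤ α) (hβ : 0 ≤ β) (ha : 0 ≤ a) (hb : 0 ≤ b) (hw : w ≤ α * β)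
    (hAa : ∀ j ≤ n, α * ‖iteratedFDeriv ℝ j A x‖ ≤ a)
    (hBb : ∀ j ≤ n, β * ‖iteratedFDeriv ℝ j B x‖ ≤ b) :
    w * ‖iteratedFDeriv ℝ i (fun y => A y * B y) x‖ ≤ 2 ^ n * (a * b) := by
  have h := norm_iteratedFDeriv_mul_le (𝕜 := ℝ) (n := i) hA hB x (by exact_mod_cast le_top)
  have hterm : ∀ j ∈ Finset.range (i + 1), (α * β) * ((i.choose j : ℝ) *
      ‖iteratedFDeriv ℝ j A x‖ * ‖iteratedFDeriv ℝ (i - j) B x‖) ≤ (i.choose j : ℝ) * (a * b) := by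
    intro j hj
    have hj' : j ≤ n := by have := Finset.mem_range.1 hj; omega
    calc _ = (i.choose j : ℝ) * ((α * ‖iteratedFDeriv ℝ j A x‖) *
          (β * ‖iteratedFDeriv ℝ (i - j) B x‖)) := by ring
      _ ≤ _ := mul_le_mul_of_nonneg_left
        (mul_le_mul (hAa j hj') (hBb (i - j) (by omega)) (by positivity) ha) (by positivity)
  calc _ ≤ (α * β) * ‖iteratedFDeriv ℝ i (fun y => A y * B y) x‖ :=
        mul_le_mul_of_nonneg_right hw (norm_nonneg _)
    _ ≤ (α * β) * _ := mul_le_mul_of_nonneg_left h (by positivity)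
    _ ≤ ∑ j ∈ Finset.range (i + 1), (i.choose j : ℝ) * (a * b) := by
      rw [Finset.mul_sum]
      exact Finset.sum_le_sum hterm
    _ = 2 ^ i * (a * b) := by
      rw [← Finset.sum_mul]
      congr 1
      exact_mod_cast Nat.sum_range_choose i
    _ ≤ _ := mul_le_mul_of_nonneg_right (pow_le_pow_right₀ (by norm_num) hi) (by positivity)

section Tensor

variable {d : ℕ}

/-- The Schwartz norm `sup_{k' ≤ k, n' ≤ n} ‖x^{k'} ∂^{n'} q‖_∞`. -/
def schwartzNorm {E : Type*} [NormedAddCommGroup E] [NormedSpace ℝ E] (k n : ℕ) (q : 𝓢(E, ℂ)) :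
    ℝ :=
  (Finset.Iic (k, n)).sup (schwartzSeminormFamily ℂ E ℂ) q

theorem schwartzNorm_nonneg {E : Type*} [NormedAddCommGroup E] [NormedSpace ℝ E] (k n : ℕ)
    (q : 𝓢(E, ℂ)) : 0 ≤ schwartzNorm k n q :=
  apply_nonneg _ _

theorem one_add_norm_pow_mul_norm_iteratedFDeriv_le {E : Type*} [NormedAddCommGroup E]
    [NormedSpace ℝ E] (k : ℕ) {n i : ℕ} (hi : i ≤ n) (q : 𝓢(E, ℂ)) (x : E) :
    (1 + ‖x‖) ^ k * ‖iteratedFDeriv ℝ i q x‖ ≤ 2 ^ k * schwartzNorm k n q :=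
  one_add_le_sup_seminorm_apply (𝕜 := ℂ) (m := (k, n)) le_rfl hi q x

theorem one_add_norm_le_mul {E F : Type*} [NormedAddCommGroup E] [NormedAddCommGroup F]
    (z : E × F) : 1 + ‖z‖ ≤ (1 + ‖z.1‖) * (1 + ‖z.2‖) := by
  rw [Prod.norm_def]
  rcases max_cases ‖z.1‖ ‖z.2‖ with ⟨h, -⟩ | ⟨h, -⟩ <;> rw [h] <;>
    nlinarith [norm_nonneg z.1, norm_nonneg z.2, mul_nonneg (norm_nonneg z.1) (norm_nonneg z.2)]

theorem norm_iteratedFDeriv_comp_fst_le (q : 𝓢(Rd d, ℂ)) (i : ℕ) (z : TFPlane d) :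
    ‖iteratedFDeriv ℝ i (fun z : TFPlane d => q z.1) z‖ ≤ ‖iteratedFDeriv ℝ i q z.1‖ := by
  have h := (ContinuousLinearMap.fst ℝ (Rd d) (Rd d)).iteratedFDeriv_comp_right (q.smooth ⊤) z
    (i := i) (by exact_mod_cast le_top)
  change ‖iteratedFDeriv ℝ i (q ∘ ContinuousLinearMap.fst ℝ (Rd d) (Rd d)) z‖ ≤ _
  rw [h]
  refine (ContinuousMultilinearMap.norm_compContinuousLinearMap_le _ _).trans ?_
  exact mul_le_of_le_one_right (norm_nonneg _)
    (Finset.prod_le_one (fun _ _ => norm_nonneg _) fun _ _ => ContinuousLinearMap.norm_fst_le _ _ _)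

theorem norm_iteratedFDeriv_comp_snd_le (q : 𝓢(Rd d, ℂ)) (i : ℕ) (z : TFPlane d) :
    ‖iteratedFDeriv ℝ i (fun z : TFPlane d => q z.2) z‖ ≤ ‖iteratedFDeriv ℝ i q z.2‖ := by
  have h := (ContinuousLinearMap.snd ℝ (Rd d) (Rd d)).iteratedFDeriv_comp_right (q.smooth ⊤) z
    (i := i) (by exact_mod_cast le_top)
  change ‖iteratedFDeriv ℝ i (q ∘ ContinuousLinearMap.snd ℝ (Rd d) (Rd d)) z‖ ≤ _
  rw [h]
  refine (ContinuousMultilinearMap.norm_compContinuousLinearMap_le _ _).trans ?_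
  exact mul_le_of_le_one_right (norm_nonneg _)
    (Finset.prod_le_one (fun _ _ => norm_nonneg _) fun _ _ => ContinuousLinearMap.norm_snd_le _ _ _)

theorem contDiff_tensor (q γ : 𝓢(Rd d, ℂ)) :
    ContDiff ℝ (⊤ : ℕ∞) fun z : TFPlane d => q z.1 * γ z.2 :=
  ((q.smooth ⊤).comp contDiff_fst).mul ((γ.smooth ⊤).comp contDiff_snd)

theorem one_add_norm_pow_mul_norm_iteratedFDeriv_tensor_le (q γ : 𝓢(Rd d, ℂ)) (k : ℕ) {n i : ℕ}
    (hi : i ≤ n) (z : TFPlane d) :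
    (1 + ‖z‖) ^ k * ‖iteratedFDeriv ℝ i (fun z : TFPlane d => q z.1 * γ z.2) z‖ ≤
      2 ^ n * (2 ^ k * schwartzNorm k n q * (2 ^ k * schwartzNorm k n γ)) := by
  refine mul_norm_iteratedFDeriv_mul_le ((q.smooth ⊤).comp contDiff_fst)
    ((γ.smooth ⊤).comp contDiff_snd) hi (α := (1 + ‖z.1‖) ^ k) (β := (1 + ‖z.2‖) ^ k)
    (by positivity) (by positivity)
    (mul_nonneg (by positivity) (schwartzNorm_nonneg _ _ _))
    (mul_nonneg (by positivity) (schwartzNorm_nonneg _ _ _)) ?_ (fun j hj => ?_) (fun j hj => ?_)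
  · rw [← mul_pow]
    exact pow_le_pow_left₀ (by positivity) (one_add_norm_le_mul z) k
  · exact (mul_le_mul_of_nonneg_left (norm_iteratedFDeriv_comp_fst_le q j z)
      (by positivity)).trans (one_add_norm_pow_mul_norm_iteratedFDeriv_le k hj q z.1)
  · exact (mul_le_mul_of_nonneg_left (norm_iteratedFDeriv_comp_snd_le γ j z)
      (by positivity)).trans (one_add_norm_pow_mul_norm_iteratedFDeriv_le k hj γ z.2)

/-- The tensor product `(x, η) ↦ q(x) γ(η)`. -/
def tensor (q γ : 𝓢(Rd d, ℂ)) : 𝓢(TFPlane d, ℂ) where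
  toFun z := q z.1 * γ z.2
  smooth' := contDiff_tensor q γ
  decay' k n := ⟨_, fun z => by
    refine le_trans ?_ (one_add_norm_pow_mul_norm_iteratedFDeriv_tensor_le q γ k (le_refl n) z)
    gcongr
    linarith [norm_nonneg z]⟩

theorem tensor_apply (q γ : 𝓢(Rd d, ℂ)) (z : TFPlane d) : tensor q γ z = q z.1 * γ z.2 := rfl

end Tensor

/-! ### The remainder of a phase function -/

section Remainder

variable {d : ℕ} {Φ : TFPlane d → ℝ}

/-- The first-order Taylor remainder of `Φ` at `z₀`. -/
def phaseRemainder (Φ : TFPlane d → ℝ) (z₀ z : TFPlane d) : ℝ :=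
  Φ z - Φ z₀ - fderiv ℝ Φ z₀ (z - z₀)

theorem IsPhase.contDiff_phaseRemainder (h : IsPhase Φ) (z₀ : TFPlane d) :
    ContDiff ℝ (⊤ : ℕ∞) (phaseRemainder Φ z₀) :=
  (h.smooth.sub contDiff_const).sub
    ((fderiv ℝ Φ z₀).contDiff.comp (contDiff_id.sub contDiff_const))

theorem IsPhase.fderiv_phaseRemainder (h : IsPhase Φ) (z₀ : TFPlane d) :
    fderiv ℝ (phaseRemainder Φ z₀) = fun z => fderiv ℝ Φ z - fderiv ℝ Φ z₀ := by
  funext z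
  have h1 : HasFDerivAt (fun z => fderiv ℝ Φ z₀ (z - z₀)) (fderiv ℝ Φ z₀) z :=
    (fderiv ℝ Φ z₀).hasFDerivAt.comp z ((hasFDerivAt_id z).sub_const z₀)
  exact (((h.differentiable z).hasFDerivAt.sub_const _).sub h1).fderiv

/-- The first derivative is `∇Φ(z) - ∇Φ(z₀)`, of linear growth; the higher ones are those of `Φ`,
hence bounded. Order 0 is left out: the remainder itself only enters through a unimodular
exponential. The power `i` is the form that the bound for derivatives of a composition requires, and
`1 ≤ C` makes it available. -/
theorem IsPhase.exists_norm_iteratedFDeriv_phaseRemainder_le (h : IsPhase Φ) (n : ℕ) :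
    ∃ C : ℝ, 0 ≤ C ∧ ∀ z₀ z i, 1 ≤ i → i ≤ n →
      ‖iteratedFDeriv ℝ i (phaseRemainder Φ z₀) z‖ ≤ (C * (1 + ‖z - z₀‖)) ^ i := by
  obtain ⟨C₁, hC₁, hlip⟩ := h.exists_norm_fderiv_sub_le
  have hb : ∀ k : ℕ, ∃ C : ℝ, 2 ≤ k → ∀ z, ‖iteratedFDeriv ℝ k Φ z‖ ≤ C := fun k => by
    by_cases hk : 2 ≤ k
    · obtain ⟨C, hC⟩ := h.bounded_deriv k hk
      exact ⟨C, fun _ => hC⟩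
    · exact ⟨0, fun h => absurd h hk⟩
  choose B hB using hb
  set C := 1 + C₁ + ∑ k ∈ Finset.range (n + 1), |B k| with hC
  have hC1 : 1 ≤ C := by
    have : 0 ≤ ∑ k ∈ Finset.range (n + 1), |B k| := Finset.sum_nonneg fun _ _ => abs_nonneg _
    linarith
  refine ⟨C, by linarith, fun z₀ z i hi hin => ?_⟩
  have hone : 1 ≤ 1 + ‖z - z₀‖ := by linarith [norm_nonneg (z - z₀)]
  obtain ⟨j, rfl⟩ : ∃ j, i = j + 1 := ⟨i - 1, by omega⟩
  rw [← norm_iteratedFDeriv_fderiv, h.fderiv_phaseRemainder]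
  rcases Nat.eq_zero_or_pos j with rfl | hj
  · rw [norm_iteratedFDeriv_zero, zero_add, pow_one]
    have : 0 ≤ ∑ k ∈ Finset.range (n + 1), |B k| := Finset.sum_nonneg fun _ _ => abs_nonneg _
    calc _ ≤ C₁ * ‖z - z₀‖ := hlip z z₀
      _ ≤ C * (1 + ‖z - z₀‖) := by
        gcongr
        · linarith
        · linarith
  · have h1 : iteratedFDeriv ℝ j (fun z => fderiv ℝ Φ z - fderiv ℝ Φ z₀) z =
        iteratedFDeriv ℝ j (fderiv ℝ Φ) z := by
      obtain ⟨l, rfl⟩ : ∃ l, j = l + 1 := ⟨j - 1, by omega⟩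
      rw [iteratedFDeriv_succ_eq_comp_right, iteratedFDeriv_succ_eq_comp_right]
      simp only [Function.comp_apply]
      congr 2
      funext w
      exact fderiv_sub_const _
    rw [h1, norm_iteratedFDeriv_fderiv]
    calc _ ≤ B (j + 1) := hB (j + 1) (by omega) z
      _ ≤ |B (j + 1)| := le_abs_self _
      _ ≤ ∑ k ∈ Finset.range (n + 1), |B k| :=
        Finset.single_le_sum (f := fun k => |B k|) (fun _ _ => abs_nonneg _)
          (Finset.mem_range.2 (by omega))
      _ ≤ C := by linarith
      _ ≤ C * (1 + ‖z - z₀‖) := le_mul_of_one_le_right (by linarith) hone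
      _ ≤ (C * (1 + ‖z - z₀‖)) ^ (j + 1) := by
        refine le_self_pow₀ ?_ (by omega)
        nlinarith

theorem IsPhase.exists_norm_iteratedFDeriv_expI_phaseRemainder_le (h : IsPhase Φ) (n : ℕ) :
    ∃ K : ℝ, 0 ≤ K ∧ ∀ z₀ z i, i ≤ n →
      ‖iteratedFDeriv ℝ i (fun z => expI (phaseRemainder Φ z₀ z)) z‖ ≤
        K * (1 + ‖z - z₀‖) ^ n := by
  obtain ⟨C, hC, hb⟩ := h.exists_norm_iteratedFDeriv_phaseRemainder_le n
  refine ⟨n.factorial * (2 * Real.pi) ^ n * (1 + C) ^ n, by positivity, fun z₀ z i hi => ?_⟩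
  have hpi : 1 ≤ 2 * Real.pi := by linarith [Real.pi_gt_three]
  have hone : 1 ≤ 1 + ‖z - z₀‖ := by linarith [norm_nonneg (z - z₀)]
  have h1 := norm_iteratedFDeriv_comp_le (𝕜 := ℝ) (n := i) contDiff_expI
    (h.contDiff_phaseRemainder z₀) (by exact_mod_cast le_top) z (C := (2 * Real.pi) ^ n)
    (D := C * (1 + ‖z - z₀‖)) (fun j hj => by
      rw [norm_iteratedFDeriv_expI]
      exact pow_le_pow_right₀ hpi (hj.trans hi))
    (fun j hj hj' => hb z₀ z j hj (hj'.trans hi))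
  refine h1.trans ?_
  calc _ ≤ (n.factorial : ℝ) * (2 * Real.pi) ^ n * ((1 + C) * (1 + ‖z - z₀‖)) ^ i := by
        gcongr
        linarith
    _ ≤ (n.factorial : ℝ) * (2 * Real.pi) ^ n * ((1 + C) * (1 + ‖z - z₀‖)) ^ n := by
        gcongr
        nlinarith
    _ = _ := by rw [mul_pow (1 + C)]; ring

theorem IsPhase.hasTemperateGrowth_expI_phaseRemainder (h : IsPhase Φ) (z₀ : TFPlane d) :
    Function.HasTemperateGrowth fun z => expI (phaseRemainder Φ z₀ z) := by
  refine ⟨contDiff_expI.comp (h.contDiff_phaseRemainder z₀), fun n => ?_⟩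
  obtain ⟨K, hK, hb⟩ := h.exists_norm_iteratedFDeriv_expI_phaseRemainder_le n
  refine ⟨n, K * (1 + ‖z₀‖) ^ n, fun z => (hb z₀ z n le_rfl).trans ?_⟩
  rw [mul_assoc, ← mul_pow]
  gcongr
  nlinarith [norm_sub_le z z₀, norm_nonneg z, norm_nonneg z₀,
    mul_nonneg (norm_nonneg z) (norm_nonneg z₀)]

/-- The Schwartz function `e^{2πi Φ₂(z)} (q ⊗ γ)(z - z₀)`, where `Φ₂` is the remainder of the
phase at `z₀`. -/
def localizedAmplitude (Φ : TFPlane d → ℝ) (q γ : 𝓢(Rd d, ℂ)) (z₀ : TFPlane d) :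
    𝓢(TFPlane d, ℂ) :=
  smulLeftCLM ℂ (fun z => expI (phaseRemainder Φ z₀ z)) (compSubConstCLM ℂ z₀ (tensor q γ))

theorem IsPhase.localizedAmplitude_apply (h : IsPhase Φ) (q γ : 𝓢(Rd d, ℂ)) (z₀ z : TFPlane d) :
    localizedAmplitude Φ q γ z₀ z =
      expI (phaseRemainder Φ z₀ z) * (q (z.1 - z₀.1) * γ (z.2 - z₀.2)) := by
  rw [localizedAmplitude, smulLeftCLM_apply_apply (h.hasTemperateGrowth_expI_phaseRemainder z₀),
    compSubConstCLM_apply, tensor_apply, smul_eq_mul, Prod.fst_sub, Prod.snd_sub]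

/-- Derivatives of the oscillating factor cost `(1 + ‖z - z₀‖) ^ n`. The windows decay to order `n +
r`, which pays for this and leaves order `r`, uniformly in `z₀`. -/
theorem IsPhase.exists_norm_iteratedFDeriv_localizedAmplitude_le (h : IsPhase Φ) (n r : ℕ) :
    ∃ K : ℝ, 0 ≤ K ∧ ∀ (q γ : 𝓢(Rd d, ℂ)) (z₀ z : TFPlane d) (i : ℕ), i ≤ n →
      (1 + ‖z - z₀‖) ^ r * ‖iteratedFDeriv ℝ i (localizedAmplitude Φ q γ z₀) z‖ ≤
        K * (schwartzNorm (n + r) n q * schwartzNorm (n + r) n γ) := by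
  obtain ⟨K, hK, hb⟩ := h.exists_norm_iteratedFDeriv_expI_phaseRemainder_le n
  refine ⟨2 ^ n * (K * (2 ^ n * (2 ^ (n + r) * 2 ^ (n + r)))), by positivity,
    fun q γ z₀ z i hi => ?_⟩
  set P := schwartzNorm (n + r) n q * schwartzNorm (n + r) n γ with hP
  have hP0 : 0 ≤ P := mul_nonneg (schwartzNorm_nonneg _ _ _) (schwartzNorm_nonneg _ _ _)
  set ρ := 1 + ‖z - z₀‖
  have hρ : 0 < ρ := by positivity
  have heq : ⇑(localizedAmplitude Φ q γ z₀) = fun z =>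
      expI (phaseRemainder Φ z₀ z) * (tensor q γ) (z - z₀) := by
    funext z
    rw [h.localizedAmplitude_apply, tensor_apply, Prod.fst_sub, Prod.snd_sub]
  rw [heq]
  refine (mul_norm_iteratedFDeriv_mul_le (h.hasTemperateGrowth_expI_phaseRemainder z₀).1
    (((tensor q γ).smooth ⊤).comp (contDiff_id.sub contDiff_const)) hi (α := (ρ ^ n)⁻¹)
    (β := ρ ^ (n + r)) (a := K) (b := 2 ^ n * (2 ^ (n + r) * 2 ^ (n + r)) * P)
    (by positivity) (by positivity) hK (by positivity) (le_of_eq ?_) (fun j hj => ?_)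
    (fun j hj => ?_)).trans (le_of_eq (by ring))
  · rw [pow_add]
    field_simp
  · rw [inv_mul_le_iff₀ (by positivity), mul_comm (ρ ^ n)]
    exact hb z₀ z j hj
  · simp only [Function.comp_def, id_eq]
    rw [iteratedFDeriv_comp_sub]
    refine (one_add_norm_pow_mul_norm_iteratedFDeriv_tensor_le q γ (n + r) hj (z - z₀)).trans
      (le_of_eq ?_)
    rw [hP]; ring

end Remainder

/-! ### Kernel estimate for Fourier integral operators -/

/-- Either all `a j ≤ 1` and the sum is at most the cardinality, or the largest `a j` dominates both
1 and the average. Decay in each coordinate separately therefore gives joint decay, and mixed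
derivatives are not needed. -/
theorem one_add_sum_pow_mul_le {ι : Type*} [Fintype ι] {a : ι → ℝ} (ha : ∀ j, 0 ≤ a j) {n : ℕ}
    {X D : ℝ} (hX : 0 ≤ X) (h0 : X ≤ D) (h : ∀ j, a j ^ n * X ≤ D) :
    (1 + ∑ j, a j) ^ n * X ≤ (1 + Fintype.card ι) ^ n * D := by
  have hs : 0 ≤ ∑ j, a j := Finset.sum_nonneg fun j _ => ha j
  by_cases h1 : ∀ j, a j ≤ 1
  · have h2 : ∑ j, a j ≤ Fintype.card ι := by
      refine (Finset.sum_le_sum fun j _ => h1 j).trans (le_of_eq ?_)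
      simp
    gcongr
  · push Not at h1
    obtain ⟨j₁, hj₁⟩ := h1
    obtain ⟨j₀, -, hj₀⟩ := Finset.exists_max_image Finset.univ a ⟨j₁, Finset.mem_univ _⟩
    have h2 : 1 ≤ a j₀ := hj₁.le.trans (hj₀ j₁ (Finset.mem_univ _))
    have h3 : ∑ j, a j ≤ Fintype.card ι * a j₀ := by
      refine (Finset.sum_le_sum fun j _ => hj₀ j (Finset.mem_univ _)).trans (le_of_eq ?_)
      simp
    calc _ ≤ ((1 + Fintype.card ι) * a j₀) ^ n * X := by
          gcongr
          linarith
      _ = (1 + Fintype.card ι) ^ n * (a j₀ ^ n * X) := by rw [mul_pow]; ring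
      _ ≤ _ := by gcongr; exact h j₀

section Kernel

variable {d : ℕ}

/-- The pairing `⟨T(M_η T_y g), M_ξ T_x q̄⟩`, up to a unimodular factor, where `w' = (x, ξ)`,
`w = (y, η)` and `γ = ĝ`. -/
def fioKernel (Φ : TFPlane d → ℝ) (σ : TFPlane d → ℂ) (q γ : 𝓢(Rd d, ℂ)) (w' w : TFPlane d) : ℂ :=
  ∫ z : TFPlane d, expI (Φ z - inner ℝ w'.2 z.1 - inner ℝ w.1 z.2) * σ z *
    (q (z.1 - w'.1) * γ (z.2 - w.2))

theorem finrank_TFPlane : Module.finrank ℝ (TFPlane d) = 2 * d := by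
  rw [Module.finrank_prod, finrank_euclideanSpace_fin]
  ring

theorem integrable_one_add_norm_pow_inv :
    Integrable (fun z : TFPlane d => ((1 + ‖z‖) ^ (2 * d + 1))⁻¹) := by
  have h := integrable_one_add_norm (E := TFPlane d) (μ := volume) (r := (2 * d + 1 : ℕ))
    (by rw [finrank_TFPlane]; push_cast; linarith)
  refine h.congr (.of_forall fun z => ?_)
  simp only
  rw [Real.rpow_neg (by positivity), Real.rpow_natCast]

/-- The `2 * d + 1` additional powers make the bound integrable on ℝ^{2d}; translation invariance
makes it independent of `z₀`. -/
theorem IsPhase.exists_integral_norm_iterate_lineDerivOp_le {Φ : TFPlane d → ℝ} (h : IsPhase Φ)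
    (n : ℕ) :
    ∃ K : ℝ, 0 ≤ K ∧ ∀ (q γ : 𝓢(Rd d, ℂ)) (z₀ v : TFPlane d) (i : ℕ), ‖v‖ ≤ 1 → i ≤ n →
      ∫ z, ‖((∂_{v})^[i] (localizedAmplitude Φ q γ z₀)) z‖ ≤
        K * (schwartzNorm (n + (2 * d + 1)) n q * schwartzNorm (n + (2 * d + 1)) n γ) := by
  obtain ⟨K, hK, hb⟩ := h.exists_norm_iteratedFDeriv_localizedAmplitude_le n (2 * d + 1)
  have hI : 0 ≤ ∫ z : TFPlane d, ((1 + ‖z‖) ^ (2 * d + 1))⁻¹ :=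
    integral_nonneg fun z => by positivity
  refine ⟨K * ∫ z : TFPlane d, ((1 + ‖z‖) ^ (2 * d + 1))⁻¹, by positivity,
    fun q γ z₀ v i hv hi => ?_⟩
  set P := schwartzNorm (n + (2 * d + 1)) n q * schwartzNorm (n + (2 * d + 1)) n γ
  have hint : Integrable fun z : TFPlane d => K * P * ((1 + ‖z - z₀‖) ^ (2 * d + 1))⁻¹ :=
    (integrable_one_add_norm_pow_inv.comp_sub_right z₀).const_mul _
  calc _ ≤ ∫ z : TFPlane d, K * P * ((1 + ‖z - z₀‖) ^ (2 * d + 1))⁻¹ := by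
        refine integral_mono_of_nonneg (.of_forall fun z => norm_nonneg _) hint
          (.of_forall fun z => ?_)
        refine (norm_iterate_lineDerivOp_le hv _ i z).trans ?_
        simp only
        rw [← div_eq_mul_inv, le_div_iff₀ (by positivity), mul_comm]
        exact hb q γ z₀ z i hi
    _ = _ := by
        rw [integral_const_mul, integral_sub_right_eq_self
          (fun z : TFPlane d => ((1 + ‖z‖) ^ (2 * d + 1))⁻¹)]
        ring

/-- The linear part of the phase in `fioKernel` at the base point. -/
def fioFrequency (Φ : TFPlane d → ℝ) (w' w : TFPlane d) : TFPlane d →L[ℝ] ℝ :=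
  fderiv ℝ Φ (w'.1, w.2) - (innerSL ℝ w'.2).comp (ContinuousLinearMap.fst ℝ (Rd d) (Rd d)) -
    (innerSL ℝ w.1).comp (ContinuousLinearMap.snd ℝ (Rd d) (Rd d))

theorem fioFrequency_apply (Φ : TFPlane d → ℝ) (w' w z : TFPlane d) :
    fioFrequency Φ w' w z =
      fderiv ℝ Φ (w'.1, w.2) z - inner ℝ w'.2 z.1 - inner ℝ w.1 z.2 := rfl

theorem IsPhase.fioFrequency_inl {Φ : TFPlane d → ℝ} (h : IsPhase Φ) (w' w : TFPlane d)
    (i : Fin d) :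
    fioFrequency Φ w' w (coordDir (Sum.inl i)) = -(w'.2 - gradX Φ w'.1 w.2) i := by
  rw [fioFrequency_apply, PiLp.sub_apply, h.gradX_apply]
  simp [coordDir, EuclideanSpace.inner_single_right]

theorem IsPhase.fioFrequency_inr {Φ : TFPlane d → ℝ} (h : IsPhase Φ) (w' w : TFPlane d)
    (i : Fin d) :
    fioFrequency Φ w' w (coordDir (Sum.inr i)) = -(w.1 - gradEta Φ w'.1 w.2) i := by
  rw [fioFrequency_apply, PiLp.sub_apply, h.gradEta_apply]
  simp [coordDir, EuclideanSpace.inner_single_right]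

/-- The windows localize `z` near `(w'.1, w.2)`, so the phase is expanded there: a unimodular
constant, a linear phase, and the remainder, which goes into the amplitude. -/
theorem IsPhase.fioKernel_eq {Φ : TFPlane d → ℝ} (h : IsPhase Φ) (σ : TFPlane d → ℂ)
    (q γ : 𝓢(Rd d, ℂ)) (w' w : TFPlane d) :
    fioKernel Φ σ q γ w' w =
      expI (Φ (w'.1, w.2) - fderiv ℝ Φ (w'.1, w.2) (w'.1, w.2)) *
        ∫ z, σ z * (expI (fioFrequency Φ w' w z) * localizedAmplitude Φ q γ (w'.1, w.2) z) := by
  rw [fioKernel, ← integral_const_mul]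
  refine integral_congr_ae (.of_forall fun z => ?_)
  simp only
  rw [h.localizedAmplitude_apply]
  have : Φ z - inner ℝ w'.2 z.1 - inner ℝ w.1 z.2 =
      (Φ (w'.1, w.2) - fderiv ℝ Φ (w'.1, w.2) (w'.1, w.2)) +
        (fioFrequency Φ w' w z + phaseRemainder Φ (w'.1, w.2) z) := by
    rw [fioFrequency_apply, phaseRemainder, map_sub]
    ring
  rw [this, expI_add, expI_add]
  ring

/-- Decay of the matrix of a Fourier integral operator with respect to time-frequency shifts. -/
theorem IsPhase.exists_fioKernel_bound {Φ : TFPlane d → ℝ} (h : IsPhase Φ) {m : ℕ}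
    {σ : TFPlane d → ℂ} (hσ : IsSymbol m σ) :
    ∃ C : ℝ, 0 ≤ C ∧ ∀ (q γ : 𝓢(Rd d, ℂ)) (w' w : TFPlane d),
      (1 + (‖w'.2 - gradX Φ w'.1 w.2‖ + ‖w.1 - gradEta Φ w'.1 w.2‖)) ^ m *
        ‖fioKernel Φ σ q γ w' w‖ ≤
      C * (schwartzNorm (m + (2 * d + 1)) m q * schwartzNorm (m + (2 * d + 1)) m γ) := by
  obtain ⟨K, hK, hL1⟩ := h.exists_integral_norm_iterate_lineDerivOp_le m
  obtain ⟨M, hM, hσ'⟩ := hσ.exists_weak_derivatives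
  -- For `d = 0` there is no coordinate direction from which a bound on `σ` could be read off, so it
  -- is recorded separately.
  have hMess : ∀ᵐ z, ‖σ z‖ ≤ max M (eLpNorm σ ∞ volume).toReal := by
    filter_upwards [ae_le_eLpNormEssSup (f := σ) (μ := volume)] with z hz
    refine le_max_of_le_right ?_
    rw [← toReal_enorm]
    exact ENNReal.toReal_mono hσ.1.eLpNorm_ne_top (by rwa [eLpNorm_exponent_top])
  set M' := max M (eLpNorm σ ∞ volume).toReal
  have hMM' : M ≤ M' := le_max_left _ _
  have hM' : 0 ≤ M' := hM.trans hMM'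
  refine ⟨(1 + Fintype.card (Fin d ⊕ Fin d)) ^ m * (2 ^ m * (M' * K)), by positivity,
    fun q γ w' w => ?_⟩
  set P := schwartzNorm (m + (2 * d + 1)) m q * schwartzNorm (m + (2 * d + 1)) m γ
  have hP : 0 ≤ P := mul_nonneg (schwartzNorm_nonneg _ _ _) (schwartzNorm_nonneg _ _ _)
  set B := localizedAmplitude Φ q γ (w'.1, w.2) with hB
  set ℓ := fioFrequency Φ w' w with hℓ
  have hnorm : ‖fioKernel Φ σ q γ w' w‖ = ‖∫ z, σ z * (expI (ℓ z) * B z)‖ := by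
    rw [h.fioKernel_eq, norm_mul, norm_expI, one_mul]
  rw [hnorm]
  have hpi : 1 ≤ 2 * Real.pi := by linarith [Real.pi_gt_three]
  have h1 : ∀ j : Fin d ⊕ Fin d, |ℓ (coordDir j)| ^ m * ‖∫ z, σ z * (expI (ℓ z) * B z)‖ ≤
      2 ^ m * (M' * (K * P)) := by
    intro j
    obtain ⟨τ, hτ0, hτm, hτM, hparts⟩ := hσ' j
    have h2 := pow_mul_norm_integral_le hM hτm hτM hparts ℓ m 0 (by simp) B (K * P)
      (fun i hi => hL1 q γ (w'.1, w.2) _ i (norm_coordDir_le j) hi)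
    have h3 : ∫ z, τ 0 z * (expI (ℓ z) * B z) = ∫ z, σ z * (expI (ℓ z) * B z) := by
      refine integral_congr_ae ?_
      filter_upwards [hτ0] with z hz
      rw [hz]
    rw [h3] at h2
    refine le_trans ?_ (h2.trans ?_)
    · refine mul_le_mul_of_nonneg_right (pow_le_pow_left₀ (abs_nonneg _) ?_ m) (norm_nonneg _)
      rw [abs_mul, abs_of_pos (by linarith : 0 < 2 * Real.pi)]
      exact le_mul_of_one_le_left (abs_nonneg _) hpi
    · gcongr
  -- The case of no integration by parts, which accounts for the 1 in `1 + ∑ j, |ℓ (coordDir j)|`.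
  have h0 : ‖∫ z, σ z * (expI (ℓ z) * B z)‖ ≤ 2 ^ m * (M' * (K * P)) := by
    have h2 := pow_mul_norm_integral_le (m := 0) (τ := fun _ => σ) (v := 0) hM'
      (fun _ _ => hσ.1.aestronglyMeasurable) (fun _ _ => hMess) (by simp) ℓ 0 0 le_rfl B (K * P)
      (fun i hi => hL1 q γ (w'.1, w.2) 0 i (by simp) (by omega))
    rw [pow_zero, one_mul, pow_zero, one_mul] at h2
    exact h2.trans (le_mul_of_one_le_left (by positivity) (one_le_pow₀ (by norm_num)))
  have h2 := one_add_sum_pow_mul_le (fun j => abs_nonneg (ℓ (coordDir j))) (norm_nonneg _) h0 h1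
  have h3 : ‖w'.2 - gradX Φ w'.1 w.2‖ + ‖w.1 - gradEta Φ w'.1 w.2‖ ≤
      ∑ j : Fin d ⊕ Fin d, |ℓ (coordDir j)| := by
    rw [Fintype.sum_sum_type]
    refine add_le_add ((norm_le_sum_abs _).trans (le_of_eq ?_))
      ((norm_le_sum_abs _).trans (le_of_eq ?_))
    · exact Finset.sum_congr rfl fun i _ => by rw [hℓ, h.fioFrequency_inl, abs_neg]
    · exact Finset.sum_congr rfl fun i _ => by rw [hℓ, h.fioFrequency_inr, abs_neg]
  calc _ ≤ (1 + ∑ j : Fin d ⊕ Fin d, |ℓ (coordDir j)|) ^ m *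
        ‖∫ z, σ z * (expI (ℓ z) * B z)‖ := by gcongr
    _ ≤ _ := h2
    _ = _ := by ring

end Kernel

/-! ### Schwartz norms -/

section SchwartzNorm

variable {E : Type*} [NormedAddCommGroup E] [NormedSpace ℝ E]

theorem schwartzNorm_le {k n : ℕ} {q : 𝓢(E, ℂ)} {B : ℝ} (hB : 0 ≤ B)
    (h : ∀ i ≤ n, ∀ x, (1 + ‖x‖) ^ k * ‖iteratedFDeriv ℝ i q x‖ ≤ B) : schwartzNorm k n q ≤ B := by
  refine Seminorm.finset_sup_apply_le hB fun i hi => ?_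
  obtain ⟨h1, h2⟩ := Prod.mk_le_mk.1 (Finset.mem_Iic.1 hi)
  refine seminorm_le_bound ℂ _ _ q hB fun x => le_trans ?_ (h i.2 h2 x)
  refine mul_le_mul_of_nonneg_right ?_ (norm_nonneg _)
  calc ‖x‖ ^ i.1 ≤ (1 + ‖x‖) ^ i.1 := by gcongr; linarith [norm_nonneg x]
    _ ≤ (1 + ‖x‖) ^ k := pow_le_pow_right₀ (by linarith [norm_nonneg x]) h1

theorem exists_seminorm_le_schwartzNorm {p : Seminorm ℂ 𝓢(E, ℂ)} (hp : Continuous p) :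
    ∃ k n : ℕ, ∃ C : ℝ, 0 ≤ C ∧ ∀ q : 𝓢(E, ℂ), p q ≤ C * schwartzNorm k n q := by
  obtain ⟨s, C, -, hC⟩ := Seminorm.bound_of_continuous (schwartz_withSeminorms ℂ E ℂ) p hp
  refine ⟨s.sup Prod.fst, s.sup Prod.snd, C, C.2, fun q => ?_⟩
  refine (hC q).trans ?_
  change (C : ℝ) * _ ≤ _
  refine mul_le_mul_of_nonneg_left ?_ C.2
  refine (Finset.sup_mono (f := schwartzSeminormFamily ℂ E ℂ) fun i hi => ?_ :
    s.sup (schwartzSeminormFamily ℂ E ℂ) ≤ _) q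
  exact Finset.mem_Iic.2 (Prod.mk_le_mk.2 ⟨Finset.le_sup (f := Prod.fst) hi,
    Finset.le_sup (f := Prod.snd) hi⟩)

/-- Continuity of the Fourier transform on Schwartz space, made quantitative. Uniformity in `h`
matters because it is applied to the slices `stftSlice g f x` with `x` varying. -/
theorem exists_fourier_decay {d : ℕ} (k : ℕ) : ∃ K M : ℕ, ∃ C : ℝ, 0 ≤ C ∧ ∀ (h : 𝓢(Rd d, ℂ)) η,
    (1 + ‖η‖) ^ k * ‖𝓕 h η‖ ≤ C * schwartzNorm K M h := by
  set p : Seminorm ℂ 𝓢(Rd d, ℂ) := ((Finset.Iic (k, 0)).sup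
    (schwartzSeminormFamily ℂ (Rd d) ℂ)).comp
      (FourierTransform.fourierCLM ℂ 𝓢(Rd d, ℂ)).toLinearMap with hpdef
  have hp : Continuous p := by
    have h1 : Continuous (schwartzNorm k 0 : 𝓢(Rd d, ℂ) → ℝ) :=
      Seminorm.continuous_finsetSup fun i _ =>
        (schwartz_withSeminorms ℂ (Rd d) ℂ).continuous_seminorm i
    exact h1.comp (FourierTransform.fourierCLM ℂ 𝓢(Rd d, ℂ)).continuous
  obtain ⟨K, M, C, hC, h⟩ := exists_seminorm_le_schwartzNorm hp
  refine ⟨K, M, 2 ^ k * C, by positivity, fun q η => ?_⟩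
  have h1 := one_add_norm_pow_mul_norm_iteratedFDeriv_le k (le_refl 0) (𝓕 q) η
  rw [norm_iteratedFDeriv_zero] at h1
  refine h1.trans ?_
  rw [mul_assoc]
  exact mul_le_mul_of_nonneg_left (h q) (by positivity)

end SchwartzNorm

/-! ### Time-frequency shifts -/

section Shift

variable {d : ℕ}

theorem modChar_eq (η t : Rd d) : modChar η t = expI (-inner ℝ η t) := by
  rw [modChar, expI]
  push_cast
  ring_nf

/-- The complex conjugate of a Schwartz function. -/
def schwartzConj (g : 𝓢(Rd d, ℂ)) : 𝓢(Rd d, ℂ) :=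
  postcompCLM (𝕜 := ℝ) (Complex.conjCLE : ℂ →L[ℝ] ℂ) g

theorem schwartzConj_apply (g : 𝓢(Rd d, ℂ)) (t : Rd d) :
    schwartzConj g t = (starRingEnd ℂ) (g t) := by
  simp [schwartzConj]

/-- The time-frequency shift `M_η T_x g`. -/
def tfShift (g : 𝓢(Rd d, ℂ)) (z : TFPlane d) : 𝓢(Rd d, ℂ) :=
  smulLeftCLM ℂ (modChar (-z.2)) (compSubConstCLM ℂ z.1 g)

theorem tfShift_apply (g : 𝓢(Rd d, ℂ)) (z : TFPlane d) (t : Rd d) :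
    tfShift g z t = expI (inner ℝ z.2 t) * g (t - z.1) := by
  simp [tfShift, smulLeftCLM_apply_apply (modChar_hasTemperateGrowth _), modChar_eq]

theorem conjShift_eq (g : 𝓢(Rd d, ℂ)) (z : TFPlane d) (t : Rd d) :
    conjShift g z t = expI (-inner ℝ z.2 t) * (starRingEnd ℂ) (g (t - z.1)) := by
  simp [conjShift, smulLeftCLM_apply_apply (modChar_hasTemperateGrowth _), modChar_eq]

theorem conj_tfShift (g : 𝓢(Rd d, ℂ)) (z : TFPlane d) (t : Rd d) :
    (starRingEnd ℂ) (tfShift g z t) = conjShift g z t := by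
  rw [tfShift_apply, conjShift_eq, map_mul, conj_expI]

theorem norm_conjShift (g : 𝓢(Rd d, ℂ)) (z : TFPlane d) (t : Rd d) :
    ‖conjShift g z t‖ = ‖g (t - z.1)‖ := by
  rw [conjShift_eq, norm_mul, norm_expI, one_mul, RCLike.norm_conj]

theorem norm_tfShift (g : 𝓢(Rd d, ℂ)) (z : TFPlane d) (t : Rd d) :
    ‖tfShift g z t‖ = ‖g (t - z.1)‖ := by
  rw [tfShift_apply, norm_mul, norm_expI, one_mul]

theorem stft_coe_eq_integral (g f : 𝓢(Rd d, ℂ)) (z : TFPlane d) :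
    stft g (f : 𝓢'(Rd d, ℂ)) z = ∫ t, f t * conjShift g z t := by
  rw [stft, SchwartzMap.coe_apply]
  exact integral_congr_ae (.of_forall fun t => by simp only [smul_eq_mul]; ring)

/-- The product `t ↦ f(t) conj (g(t - x))`. -/
def stftSlice (g f : 𝓢(Rd d, ℂ)) (x : Rd d) : 𝓢(Rd d, ℂ) :=
  smulLeftCLM ℂ f (compSubConstCLM ℂ x (schwartzConj g))

theorem stftSlice_apply (g f : 𝓢(Rd d, ℂ)) (x t : Rd d) :
    stftSlice g f x t = f t * (starRingEnd ℂ) (g (t - x)) := by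
  simp [stftSlice, smulLeftCLM_apply_apply f.hasTemperateGrowth, schwartzConj_apply]

theorem fourier_apply_eq_integral (f : 𝓢(Rd d, ℂ)) (η : Rd d) :
    𝓕 f η = ∫ t, expI (-inner ℝ η t) * f t := by
  rw [fourier_coe, Real.fourier_eq']
  refine integral_congr_ae (.of_forall fun t => ?_)
  simp only [smul_eq_mul, expI, real_inner_comm]
  push_cast
  ring_nf

theorem stft_eq_fourier (g f : 𝓢(Rd d, ℂ)) (z : TFPlane d) :
    stft g (f : 𝓢'(Rd d, ℂ)) z = 𝓕 (stftSlice g f z.1) z.2 := by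
  rw [stft_coe_eq_integral, fourier_apply_eq_integral]
  refine integral_congr_ae (.of_forall fun t => ?_)
  simp only [conjShift_eq, stftSlice_apply]
  ring

theorem one_add_norm_le_mul_one_add_norm_sub {E : Type*} [NormedAddCommGroup E] (x t : E) :
    1 + ‖x‖ ≤ (1 + ‖t‖) * (1 + ‖t - x‖) := by
  have h1 : ‖x‖ ≤ ‖t‖ + ‖t - x‖ := by
    have := norm_sub_le t (t - x)
    rwa [sub_sub_cancel] at this
  nlinarith [norm_nonneg t, norm_nonneg (t - x), mul_nonneg (norm_nonneg t) (norm_nonneg (t - x))]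

/-- Powers of `1 + ‖x‖` are split by `1 + ‖x‖ ≤ (1 + ‖t‖) * (1 + ‖t - x‖)`: `f` pays for the first
factor, besides the weight of order `K`, and the window for the second. -/
theorem exists_schwartzNorm_stftSlice_le (g f : 𝓢(Rd d, ℂ)) (k K M : ℕ) : ∃ C : ℝ, 0 ≤ C ∧
    ∀ x, (1 + ‖x‖) ^ k * schwartzNorm K M (stftSlice g f x) ≤ C := by
  set h := schwartzConj g
  set C : ℝ := 2 ^ M * ((2 ^ (K + k) * schwartzNorm (K + k) M f) * (2 ^ k * schwartzNorm k M h))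
    with hC
  have hC0 : 0 ≤ C := by
    have := schwartzNorm_nonneg (K + k) M f
    have := schwartzNorm_nonneg k M h
    positivity
  refine ⟨C, hC0, fun x => ?_⟩
  have hx : 0 < (1 + ‖x‖) ^ k := by positivity
  rw [← le_div_iff₀' hx]
  refine schwartzNorm_le (by positivity) fun i hi t => ?_
  rw [le_div_iff₀' hx, ← mul_assoc]
  have hs : (stftSlice g f x : Rd d → ℂ) = fun t => f t * h (t - x) := by
    funext t
    rw [stftSlice_apply, ← schwartzConj_apply]
  rw [hs]
  refine mul_norm_iteratedFDeriv_mul_le (f.smooth ⊤)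
    ((h.smooth ⊤).comp (contDiff_id.sub contDiff_const)) hi (α := (1 + ‖t‖) ^ (K + k))
    (β := (1 + ‖t - x‖) ^ k) (by positivity) (by positivity)
    (mul_nonneg (by positivity) (schwartzNorm_nonneg _ _ _))
    (mul_nonneg (by positivity) (schwartzNorm_nonneg _ _ _)) ?_ (fun j hj => ?_) (fun j hj => ?_)
  · have h1 := pow_le_pow_left₀ (by positivity) (one_add_norm_le_mul_one_add_norm_sub x t) k
    rw [mul_pow] at h1
    rw [pow_add]
    nlinarith [pow_pos (show 0 < 1 + ‖t‖ by positivity) K]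
  · exact one_add_norm_pow_mul_norm_iteratedFDeriv_le _ hj f t
  · have h2 : iteratedFDeriv ℝ j (fun t => h (t - x)) t = iteratedFDeriv ℝ j h (t - x) := by
      rw [iteratedFDeriv_comp_sub]
    change _ * ‖iteratedFDeriv ℝ j (fun t => h (t - x)) t‖ ≤ _
    rw [h2]
    exact one_add_norm_pow_mul_norm_iteratedFDeriv_le _ hj h (t - x)

/-- The short-time Fourier transform of a Schwartz function decays rapidly. -/
theorem exists_stft_decay (g f : 𝓢(Rd d, ℂ)) (k : ℕ) : ∃ C : ℝ, 0 ≤ C ∧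
    ∀ z, (1 + ‖z‖) ^ k * ‖stft g (f : 𝓢'(Rd d, ℂ)) z‖ ≤ C := by
  obtain ⟨K, M, C₁, hC₁, h₁⟩ := exists_fourier_decay (d := d) k
  obtain ⟨C₂, hC₂, h₂⟩ := exists_schwartzNorm_stftSlice_le g f k K M
  refine ⟨C₁ * C₂, by positivity, fun z => ?_⟩
  rw [stft_eq_fourier]
  calc _ ≤ ((1 + ‖z.1‖) * (1 + ‖z.2‖)) ^ k * ‖𝓕 (stftSlice g f z.1) z.2‖ := by
        gcongr
        exact one_add_norm_le_mul z
    _ = (1 + ‖z.1‖) ^ k * ((1 + ‖z.2‖) ^ k * ‖𝓕 (stftSlice g f z.1) z.2‖) := by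
        rw [mul_pow]; ring
    _ ≤ (1 + ‖z.1‖) ^ k * (C₁ * schwartzNorm K M (stftSlice g f z.1)) := by
        exact mul_le_mul_of_nonneg_left (h₁ _ _) (by positivity)
    _ = C₁ * ((1 + ‖z.1‖) ^ k * schwartzNorm K M (stftSlice g f z.1)) := by ring
    _ ≤ _ := by
        gcongr
        exact h₂ _

theorem continuous_conjShift (g : 𝓢(Rd d, ℂ)) :
    Continuous fun p : TFPlane d × Rd d => conjShift g p.1 p.2 := by
  simp only [conjShift_eq]
  fun_prop

theorem continuous_tfShift (g : 𝓢(Rd d, ℂ)) :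
    Continuous fun p : TFPlane d × Rd d => tfShift g p.1 p.2 := by
  simp only [tfShift_apply]
  fun_prop

theorem continuous_stft_coe (g f : 𝓢(Rd d, ℂ)) : Continuous (stft g (f : 𝓢'(Rd d, ℂ))) := by
  have h1 : stft g (f : 𝓢'(Rd d, ℂ)) = fun z => ∫ t, f t * conjShift g z t :=
    funext fun z => stft_coe_eq_integral g f z
  rw [h1]
  obtain ⟨C, hC⟩ := g.decay 0 0
  refine continuous_of_dominated (bound := fun t => ‖f t‖ * C) (fun z => ?_) (fun z => ?_)
    (f.integrable.norm.mul_const C) (.of_forall fun t => ?_)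
  · exact (f.continuous.mul (conjShift g z).continuous).aestronglyMeasurable
  · refine .of_forall fun t => ?_
    rw [norm_mul, norm_conjShift]
    gcongr
    simpa using hC.2 (t - z.1)
  · simp only [conjShift_eq]
    fun_prop

theorem integrable_stft_coe (g f : 𝓢(Rd d, ℂ)) : Integrable (stft g (f : 𝓢'(Rd d, ℂ))) := by
  obtain ⟨C, hC, h⟩ := exists_stft_decay g f (2 * d + 1)
  refine Integrable.mono' ((integrable_one_add_norm_pow_inv (d := d)).const_mul C)
    (continuous_stft_coe g f).aestronglyMeasurable (.of_forall fun z => ?_)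
  have h1 := h z
  rwa [← le_div_iff₀' (by positivity), div_eq_mul_inv] at h1

end Shift

/-! ### Inversion formulas for the short-time Fourier transform -/

section Inversion

variable {d : ℕ}

theorem stft_tfShift (g : 𝓢(Rd d, ℂ)) (z w : TFPlane d) :
    stft g (tfShift g z : 𝓢'(Rd d, ℂ)) w =
      expI (inner ℝ (z.2 - w.2) z.1) * stft g (g : 𝓢'(Rd d, ℂ)) (w - z) := by
  rw [stft_coe_eq_integral, stft_coe_eq_integral, ← integral_const_mul,
    ← integral_add_right_eq_self _ z.1]
  refine integral_congr_ae (.of_forall fun t => ?_)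
  simp only [tfShift_apply, conjShift_eq, add_sub_cancel_right, Prod.fst_sub, Prod.snd_sub]
  have h1 : expI (inner ℝ z.2 (t + z.1)) * expI (-inner ℝ w.2 (t + z.1)) =
      expI (inner ℝ (z.2 - w.2) z.1) * expI (-inner ℝ (w.2 - z.2) t) := by
    rw [← expI_add, ← expI_add]
    congr 1
    simp only [inner_add_right, inner_sub_left]
    ring
  have h2 : t + z.1 - w.1 = t - (w.1 - z.1) := by abel
  rw [h2]
  linear_combination (g t * (starRingEnd ℂ) (g (t - (w.1 - z.1)))) * h1

theorem norm_stft_tfShift (g : 𝓢(Rd d, ℂ)) (z w : TFPlane d) :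
    ‖stft g (tfShift g z : 𝓢'(Rd d, ℂ)) w‖ = ‖stft g (g : 𝓢'(Rd d, ℂ)) (w - z)‖ := by
  rw [stft_tfShift, norm_mul, norm_expI, one_mul]

theorem integrable_mul_comp_sub (f h : 𝓢(Rd d, ℂ)) :
    Integrable (fun p : Rd d × Rd d => f p.2 * h (p.2 - p.1)) (volume.prod volume) := by
  have h1 : Integrable (fun t => h (-t)) := h.integrable.comp_neg
  have h2 := f.integrable.convolution_integrand (ContinuousLinearMap.mul ℝ ℂ) h1
    (μ := volume) (ν := volume)
  simpa using h2

/-- For fixed `t` the `y`-integral of the shifted window is a conjugated Fourier transform, after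
the substitution `r = t - y`. This is the inner integral of the inversion formula on the Fourier
side. -/
theorem integral_stft_mul_expI (g f : 𝓢(Rd d, ℂ)) (η ζ : Rd d) :
    ∫ y, stft g (f : 𝓢'(Rd d, ℂ)) (y, η) * expI (-inner ℝ y (ζ - η)) =
      (starRingEnd ℂ) (𝓕 g (ζ - η)) * 𝓕 f ζ := by
  have hint : Integrable (fun p : Rd d × Rd d => f p.2 * conjShift g (p.1, η) p.2 *
      expI (-inner ℝ p.1 (ζ - η))) (volume.prod volume) := by
    refine (integrable_mul_comp_sub f (schwartzConj g)).mono ?_ (.of_forall fun p => ?_)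
    · simp only [conjShift_eq]
      exact Continuous.aestronglyMeasurable (by fun_prop)
    · rw [norm_mul, norm_mul, norm_mul, norm_expI, mul_one, norm_conjShift, schwartzConj_apply,
        RCLike.norm_conj]
  simp only [stft_coe_eq_integral, ← integral_mul_const]
  rw [integral_integral_swap hint, fourier_apply_eq_integral f, ← integral_const_mul]
  refine integral_congr_ae (.of_forall fun t => ?_)
  simp only
  rw [← integral_sub_left_eq_self _ volume t, fourier_apply_eq_integral g, ← integral_conj,
    ← integral_mul_const]
  refine integral_congr_ae (.of_forall fun r => ?_)
  simp only [conjShift_eq, map_mul, conj_expI, sub_sub_cancel, neg_neg]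
  have h1 : expI (-inner ℝ η t) * expI (-inner ℝ (t - r) (ζ - η)) =
      expI (inner ℝ (ζ - η) r) * expI (-inner ℝ ζ t) := by
    rw [← expI_add, ← expI_add]
    congr 1
    simp only [inner_sub_left, inner_sub_right, real_inner_comm]
    ring
  linear_combination (f t * (starRingEnd ℂ) (g r)) * h1

/-- The Fourier transform of `f` as a superposition of the Fourier transforms of the
time-frequency shifts of the window. -/
theorem integral_stft_mul_fourier_window (g f : 𝓢(Rd d, ℂ)) (ζ : Rd d) :
    ∫ w : TFPlane d, stft g (f : 𝓢'(Rd d, ℂ)) w *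
        (expI (-inner ℝ w.1 (ζ - w.2)) * 𝓕 g (ζ - w.2)) =
      ((∫ η, ‖𝓕 g η‖ ^ 2 : ℝ) : ℂ) * 𝓕 f ζ := by
  obtain ⟨C, -, hC⟩ := (𝓕 g).decay 0 0
  have hint : Integrable (fun w : TFPlane d => stft g (f : 𝓢'(Rd d, ℂ)) w *
      (expI (-inner ℝ w.1 (ζ - w.2)) * 𝓕 g (ζ - w.2))) (volume.prod volume) := by
    refine (integrable_stft_coe g f).mul_bdd (c := C)
      (Continuous.aestronglyMeasurable (by fun_prop)) (.of_forall fun w => ?_)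
    rw [norm_mul, norm_expI, one_mul]
    simpa using hC (ζ - w.2)
  change ∫ w, _ ∂(volume.prod volume) = _
  rw [integral_prod_symm _ hint]
  simp only [← mul_assoc, integral_mul_const, integral_stft_mul_expI]
  rw [← integral_complex_ofReal, ← integral_mul_const, ← integral_sub_left_eq_self _ volume ζ]
  refine integral_congr_ae (.of_forall fun η => ?_)
  simp only [sub_sub_cancel]
  have h1 := Complex.conj_mul' (𝓕 g η)
  push_cast
  linear_combination (𝓕 f ζ) * h1

/-- Fourier inversion in `η` recovers the slice `f(t) conj(g(t - x))`; multiplying by `g(t - x)` and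
integrating in `x` leaves the squared norm of the window. -/
theorem integral_stft_mul_tfShift (g f : 𝓢(Rd d, ℂ)) (t : Rd d) :
    ∫ z : TFPlane d, stft g (f : 𝓢'(Rd d, ℂ)) z * tfShift g z t =
      ((∫ x, ‖g x‖ ^ 2 : ℝ) : ℂ) * f t := by
  obtain ⟨C, -, hC⟩ := g.decay 0 0
  have hint : Integrable (fun z : TFPlane d => stft g (f : 𝓢'(Rd d, ℂ)) z * tfShift g z t)
      (volume.prod volume) := by
    refine (integrable_stft_coe g f).mul_bdd (c := C) ?_ (.of_forall fun w => ?_)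
    · simp only [tfShift_apply]
      exact Continuous.aestronglyMeasurable (by fun_prop)
    · rw [norm_tfShift]
      simpa using hC (t - w.1)
  change ∫ w, _ ∂(volume.prod volume) = _
  rw [integral_prod _ hint]
  have hin : ∀ x, ∫ η, stft g (f : 𝓢'(Rd d, ℂ)) (x, η) * tfShift g (x, η) t =
      ((‖g (t - x)‖ ^ 2 : ℝ) : ℂ) * f t := by
    intro x
    have h1 : 𝓕⁻ (𝓕 (stftSlice g f x)) t = stftSlice g f x t := by
      rw [FourierTransform.fourierInv_fourier_eq]
    rw [fourierInv_coe, Real.fourierInv_eq'] at h1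
    have h2 : ∀ η, stft g (f : 𝓢'(Rd d, ℂ)) (x, η) * tfShift g (x, η) t =
        (Complex.exp (↑(2 * Real.pi * inner ℝ η t) * Complex.I) • 𝓕 (stftSlice g f x) η) *
          g (t - x) := by
      intro η
      rw [stft_eq_fourier, tfShift_apply, expI, smul_eq_mul]
      push_cast
      ring_nf
    simp only [h2, integral_mul_const]
    rw [h1, stftSlice_apply]
    have h3 := Complex.conj_mul' (g (t - x))
    push_cast
    linear_combination (f t) * h3
  simp only [hin]
  rw [integral_mul_const, integral_complex_ofReal, integral_sub_left_eq_self (fun x => ‖g x‖ ^ 2) volume t]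

theorem integral_norm_sq_pos {g : 𝓢(Rd d, ℂ)} (hg : g ≠ 0) : 0 < ∫ x, ‖g x‖ ^ 2 := by
  obtain ⟨x, hx⟩ : ∃ x, g x ≠ 0 := by
    by_contra! h
    exact hg (DFunLike.ext _ _ h)
  obtain ⟨C, -, hC⟩ := g.decay 0 0
  have hint : Integrable fun x => ‖g x‖ ^ 2 := by
    simp only [sq]
    refine g.integrable.norm.mul_bdd (c := C) g.continuous.norm.aestronglyMeasurable
      (.of_forall fun x => ?_)
    rw [norm_norm]
    simpa using hC x
  exact integral_pos_of_integrable_nonneg_nonzero (x := x) (by fun_prop) hint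
    (fun _ => by positivity) (by simpa using hx)

theorem fourier_ne_zero {g : 𝓢(Rd d, ℂ)} (hg : g ≠ 0) : 𝓕 g ≠ 0 := by
  intro h
  have h1 : 𝓕⁻ (𝓕 g) = g := FourierTransform.fourierInv_fourier_eq g
  rw [h, FourierTransform.fourierInv_zero] at h1
  exact hg h1.symm

end Inversion

/-! ### Schur's test -/

section Schur

variable {X : Type*} [MeasurableSpace X] {ν : Measure X}

/-- Hölder's inequality for the factorization `h φ = h^{1 - 1/q} (h φ^q)^{1/q}`. -/
theorem lintegral_mul_le_rpow_mul_rpow {h φ : X → ℝ≥0∞} (hh : AEMeasurable h ν)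
    (hφ : AEMeasurable φ ν) {q : ℝ} (hq : 1 ≤ q) :
    ∫⁻ x, h x * φ x ∂ν ≤ (∫⁻ x, h x ∂ν) ^ (1 - 1 / q) * (∫⁻ x, h x * φ x ^ q ∂ν) ^ (1 / q) := by
  have hq0 : 0 < q := by linarith
  have h1 : 0 ≤ 1 - 1 / q := by
    rw [sub_nonneg, div_le_one hq0]
    exact hq
  have h2 : 0 ≤ 1 / q := by positivity
  refine le_trans (le_of_eq ?_) (ENNReal.lintegral_mul_norm_pow_le hh (hh.mul (hφ.pow_const q))
    h1 h2 (by ring))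
  refine lintegral_congr fun x => ?_
  rw [Pi.mul_apply, ENNReal.mul_rpow_of_nonneg _ _ h2, ← mul_assoc,
    ← ENNReal.rpow_add_of_nonneg _ _ h1 h2, sub_add_cancel, ENNReal.rpow_one, ← ENNReal.rpow_mul,
    mul_one_div_cancel hq0.ne', ENNReal.rpow_one]

/-- Schur's test gives finiteness only almost everywhere. A bounded integrable `h` gives finiteness
for each individual row of the kernel, which is needed to pair with every test function. -/
theorem lintegral_mul_lt_top {h φ : X → ℝ≥0∞} (hh : AEMeasurable h ν) (hφ : AEMeasurable φ ν)
    (h1 : ∀ x, h x ≤ 1) (hint : ∫⁻ x, h x ∂ν < ∞) {p : ℝ≥0∞} (hp : 1 ≤ p)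
    (hφp : eLpNorm φ p ν < ∞) : ∫⁻ x, h x * φ x ∂ν < ∞ := by
  rcases eq_or_ne p ∞ with rfl | hp'
  · have h2 : ∫⁻ x, h x * φ x ∂ν ≤ ∫⁻ x, h x * eLpNorm φ ∞ ν ∂ν := by
      refine lintegral_mono_ae ?_
      filter_upwards [ae_le_eLpNormEssSup (f := φ) (μ := ν)] with x hx
      rw [eLpNorm_exponent_top]
      gcongr
      exact hx
    refine h2.trans_lt ?_
    rw [lintegral_mul_const'' _ hh]
    exact ENNReal.mul_lt_top hint hφp
  · have hq : 1 ≤ p.toReal := by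
      rw [← ENNReal.toReal_one]
      exact ENNReal.toReal_mono hp' hp
    have hp0 : p ≠ 0 := (zero_lt_one.trans_le hp).ne'
    refine (lintegral_mul_le_rpow_mul_rpow hh hφ hq).trans_lt (ENNReal.mul_lt_top ?_ ?_)
    · refine ENNReal.rpow_lt_top_of_nonneg ?_ hint.ne
      rw [sub_nonneg, div_le_one (by linarith)]
      exact hq
    · rw [eLpNorm_eq_lintegral_rpow_enorm_toReal hp0 hp'] at hφp
      refine lt_of_le_of_lt (ENNReal.rpow_le_rpow (lintegral_mono fun x => ?_) (by positivity)) hφp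
      exact mul_le_of_le_one_left' (h1 x)

/-- Schur's test. Hölder in each row contributes `A ^ (q - 1)`, and Tonelli followed by the column
bound contributes the last factor `A`. -/
theorem eLpNorm_lintegral_mul_le [SFinite ν] {H : X → X → ℝ≥0∞}
    (hH : Measurable (Function.uncurry H)) {φ : X → ℝ≥0∞} (hφ : AEMeasurable φ ν) {A : ℝ≥0∞}
    (h1 : ∀ x, ∫⁻ y, H x y ∂ν ≤ A) (h2 : ∀ y, ∫⁻ x, H x y ∂ν ≤ A) {p : ℝ≥0∞} (hp : 1 ≤ p) :
    eLpNorm (fun x => ∫⁻ y, H x y * φ y ∂ν) p ν ≤ A * eLpNorm φ p ν := by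
  have hHx : ∀ x, Measurable (H x) := fun x => hH.comp measurable_prodMk_left
  have hHy : ∀ y, Measurable fun x => H x y := fun y => hH.comp measurable_prodMk_right
  rcases eq_or_ne p ∞ with rfl | hp'
  · rw [eLpNorm_exponent_top]
    refine essSup_le_of_ae_le _ (.of_forall fun x => ?_)
    simp only [enorm_eq_self]
    have h3 : ∫⁻ y, H x y * φ y ∂ν ≤ ∫⁻ y, H x y * eLpNorm φ ∞ ν ∂ν := by
      refine lintegral_mono_ae ?_
      filter_upwards [ae_le_eLpNormEssSup (f := φ) (μ := ν)] with y hy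
      rw [eLpNorm_exponent_top]
      gcongr
      exact hy
    refine h3.trans ?_
    rw [lintegral_mul_const'' _ (hHx x).aemeasurable]
    gcongr
    exact h1 x
  · have hq : 1 ≤ p.toReal := by
      rw [← ENNReal.toReal_one]
      exact ENNReal.toReal_mono hp' hp
    have hp0 : p ≠ 0 := (zero_lt_one.trans_le hp).ne'
    set q := p.toReal with hqdef
    have hq0 : 0 < q := by linarith
    have hq1 : 0 ≤ 1 - 1 / q := by
      rw [sub_nonneg, div_le_one hq0]
      exact hq
    rw [eLpNorm_eq_lintegral_rpow_enorm_toReal hp0 hp', eLpNorm_eq_lintegral_rpow_enorm_toReal hp0 hp',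
      ← hqdef, one_div, ENNReal.rpow_inv_le_iff hq0, ← one_div, ENNReal.mul_rpow_of_nonneg _ _ hq0.le,
      ← ENNReal.rpow_mul, one_div_mul_cancel hq0.ne', ENNReal.rpow_one]
    simp only [enorm_eq_self]
    have h3 : ∀ x, (∫⁻ y, H x y * φ y ∂ν) ^ q ≤ A ^ (q - 1) * ∫⁻ y, H x y * φ y ^ q ∂ν := by
      intro x
      have h4 := ENNReal.rpow_le_rpow
        (lintegral_mul_le_rpow_mul_rpow (hHx x).aemeasurable hφ hq) hq0.le
      rw [ENNReal.mul_rpow_of_nonneg _ _ hq0.le, ← ENNReal.rpow_mul, ← ENNReal.rpow_mul,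
        one_div_mul_cancel hq0.ne', ENNReal.rpow_one, sub_mul, one_div_mul_cancel hq0.ne',
        one_mul] at h4
      exact h4.trans (mul_le_mul' (ENNReal.rpow_le_rpow (h1 x) (by linarith)) le_rfl)
    have hm : AEMeasurable (Function.uncurry fun x y => H x y * φ y ^ q) (ν.prod ν) :=
      hH.aemeasurable.mul ((hφ.pow_const q).comp_quasiMeasurePreserving
        Measure.quasiMeasurePreserving_snd)
    calc _ ≤ ∫⁻ x, A ^ (q - 1) * ∫⁻ y, H x y * φ y ^ q ∂ν ∂ν := lintegral_mono h3
      _ = A ^ (q - 1) * ∫⁻ x, ∫⁻ y, H x y * φ y ^ q ∂ν ∂ν :=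
        lintegral_const_mul'' _ hm.lintegral_prod_right'
      _ = A ^ (q - 1) * ∫⁻ y, ∫⁻ x, H x y * φ y ^ q ∂ν ∂ν := by
        rw [lintegral_lintegral_swap hm]
      _ ≤ A ^ (q - 1) * ∫⁻ y, A * φ y ^ q ∂ν := by
        gcongr with y
        rw [lintegral_mul_const _ (hHy y)]
        gcongr
        exact h2 y
      _ = A ^ (q - 1) * A * ∫⁻ y, φ y ^ q ∂ν := by
        rw [lintegral_const_mul'' _ (hφ.pow_const q), mul_assoc]
      _ = _ := by
        congr 1
        nth_rw 2 [← ENNReal.rpow_one A]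
        rw [← ENNReal.rpow_add_of_nonneg _ _ (by linarith) zero_le_one, sub_add_cancel]

end Schur

/-! ### Weights -/

section Weights

variable {d : ℕ}

theorem polyWeight_nonneg (s : ℝ) (z : TFPlane d) : 0 ≤ polyWeight s z := by
  rw [polyWeight]
  positivity

theorem polyWeight_le {s : ℝ} (hs : 0 ≤ s) (z : TFPlane d) :
    polyWeight s z ≤ 2 ^ s * (1 + ‖z‖) ^ s := by
  have h1 : 1 + ‖z.1‖ ^ 2 + ‖z.2‖ ^ 2 ≤ (2 * (1 + ‖z‖)) ^ (2 : ℝ) := by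
    rw [Real.rpow_two]
    nlinarith [norm_fst_le z, norm_snd_le z, norm_nonneg z.1, norm_nonneg z.2, norm_nonneg z]
  calc polyWeight s z ≤ ((2 * (1 + ‖z‖)) ^ (2 : ℝ)) ^ (s / 2) :=
        Real.rpow_le_rpow (by positivity) h1 (by positivity)
    _ = (2 * (1 + ‖z‖)) ^ s := by
        rw [← Real.rpow_mul (by positivity)]
        congr 1
        ring
    _ = _ := Real.mul_rpow (by norm_num) (by positivity)

theorem IsModerate.exists_le {s : ℝ} (hs : 0 ≤ s) {μ : TFPlane d → ℝ}
    (hμ : IsModerate (polyWeight s) μ) :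
    ∃ C : ℝ, 0 ≤ C ∧ ∀ z w, μ z ≤ C * (1 + ‖z - w‖) ^ s * μ w := by
  obtain ⟨C, hC⟩ := hμ.moderate
  refine ⟨|C| * 2 ^ s, by positivity, fun z w => ?_⟩
  have h1 := hC (z - w) w
  rw [sub_add_cancel] at h1
  refine h1.trans ?_
  rw [mul_assoc |C|]
  refine mul_le_mul_of_nonneg_right ?_ (hμ.pos w).le
  exact mul_le_mul (le_abs_self C) (polyWeight_le hs _) (polyWeight_nonneg _ _) (abs_nonneg C)

/-- The convolution-type kernel that dominates a Fourier integral operator. -/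
def decayKernel (Φ : TFPlane d → ℝ) (r : ℝ) (w' w : TFPlane d) : ℝ :=
  (1 + ‖w' - canonicalTransformation Φ w‖) ^ (-r)

theorem decayKernel_nonneg (Φ : TFPlane d → ℝ) (r : ℝ) (w' w : TFPlane d) :
    0 ≤ decayKernel Φ r w' w := by
  rw [decayKernel]
  positivity

theorem decayKernel_le_one (Φ : TFPlane d → ℝ) {r : ℝ} (hr : 0 ≤ r) (w' w : TFPlane d) :
    decayKernel Φ r w' w ≤ 1 :=
  Real.rpow_le_one_of_one_le_of_nonpos (by linarith [norm_nonneg (w' - canonicalTransformation Φ w)])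
    (by linarith)

theorem IsPhase.continuous_canonicalTransformation {Φ : TFPlane d → ℝ} (h : IsPhase Φ) :
    Continuous (canonicalTransformation Φ) := by
  obtain ⟨C, hC, -, hlip, -⟩ := h.exists_canonicalTransformation_bounds
  exact (LipschitzWith.of_dist_le_mul (K := ⟨C, by linarith⟩) fun w w' => by
    rw [dist_eq_norm, dist_eq_norm]
    exact hlip w w').continuous

theorem IsPhase.continuous_decayKernel {Φ : TFPlane d → ℝ} (h : IsPhase Φ) (r : ℝ) :
    Continuous (Function.uncurry (decayKernel Φ r)) := by
  have h1 := h.continuous_canonicalTransformation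
  refine Continuous.rpow_const (by fun_prop) fun p => Or.inl ?_
  positivity

/-- In `w'` this is a translate of an integrable function. In `w`, write `w' = χ(w₀)`: the lower
Lipschitz bound compares with a translate centred at `w₀` at the cost `C ^ r`, so no change of
variables by χ is required. -/
theorem IsPhase.exists_lintegral_decayKernel_le {Φ : TFPlane d → ℝ} (h : IsPhase Φ) {r : ℝ}
    (hr : 2 * (d : ℝ) < r) : ∃ A : ℝ≥0∞, A ≠ ∞ ∧
      (∀ w', ∫⁻ w, ENNReal.ofReal (decayKernel Φ r w' w) ≤ A) ∧
      ∀ w, ∫⁻ w', ENNReal.ofReal (decayKernel Φ r w' w) ≤ A := by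
  obtain ⟨C, hC, hsurj, -, hanti, -⟩ := h.exists_canonicalTransformation_bounds
  have hr0 : 0 ≤ r := le_trans (by positivity) hr.le
  set I : ℝ≥0∞ := ∫⁻ u : TFPlane d, ENNReal.ofReal ((1 + ‖u‖) ^ (-r)) with hI
  have hIfin : I < ∞ := finite_integral_one_add_norm (by rw [finrank_TFPlane]; push_cast; exact hr)
  have hC1 : 1 ≤ C ^ r := Real.one_le_rpow hC hr0
  refine ⟨ENNReal.ofReal (C ^ r) * I, ENNReal.mul_ne_top ENNReal.ofReal_ne_top hIfin.ne,
    fun w' => ?_, fun w => ?_⟩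
  · obtain ⟨w₀, rfl⟩ := hsurj w'
    have h1 : ∀ w, ENNReal.ofReal (decayKernel Φ r (canonicalTransformation Φ w₀) w) ≤
        ENNReal.ofReal (C ^ r) * ENNReal.ofReal ((1 + ‖w - w₀‖) ^ (-r)) := by
      intro w
      rw [← ENNReal.ofReal_mul (by positivity)]
      refine ENNReal.ofReal_le_ofReal ?_
      have h2 : (1 + ‖w - w₀‖) / C ≤
          1 + ‖canonicalTransformation Φ w₀ - canonicalTransformation Φ w‖ := by
        rw [div_le_iff₀ (by linarith), norm_sub_rev w w₀]
        nlinarith [hanti w₀ w]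
      refine (Real.rpow_le_rpow_of_nonpos (by positivity) h2 (by linarith)).trans (le_of_eq ?_)
      rw [Real.div_rpow (by positivity) (by linarith), Real.rpow_neg (by linarith : 0 ≤ C),
        div_inv_eq_mul, mul_comm]
    refine (lintegral_mono h1).trans ?_
    rw [lintegral_const_mul' _ _ ENNReal.ofReal_ne_top,
      lintegral_sub_right_eq_self (fun u : TFPlane d => ENNReal.ofReal ((1 + ‖u‖) ^ (-r))) w₀]
  · have h1 : ∫⁻ w', ENNReal.ofReal (decayKernel Φ r w' w) = I :=
      lintegral_sub_right_eq_self (fun u : TFPlane d => ENNReal.ofReal ((1 + ‖u‖) ^ (-r)))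
        (canonicalTransformation Φ w)
    rw [h1]
    exact le_mul_of_one_le_left' (by simpa using ENNReal.ofReal_le_ofReal hC1)

theorem IsPhase.exists_fioKernel_decay {Φ : TFPlane d → ℝ} (h : IsPhase Φ) {m : ℕ}
    {σ : TFPlane d → ℂ} (hσ : IsSymbol m σ) : ∃ C : ℝ, 0 ≤ C ∧ ∀ q γ w' w,
      ‖fioKernel Φ σ q γ w' w‖ ≤ C * (schwartzNorm (m + (2 * d + 1)) m q *
        schwartzNorm (m + (2 * d + 1)) m γ) * decayKernel Φ m w' w := by
  obtain ⟨C₁, hC₁, h₁⟩ := h.exists_fioKernel_bound hσ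
  obtain ⟨C₂, hC₂, -, -, -, h₂⟩ := h.exists_canonicalTransformation_bounds
  refine ⟨C₂ ^ m * C₁, by positivity, fun q γ w' w => ?_⟩
  have h3 := h₁ q γ w' w
  have h4 := h₂ w'.1 w'.2 w.1 w.2
  simp only [Prod.mk.eta] at h4
  set a := ‖w' - canonicalTransformation Φ w‖
  set b := ‖w'.2 - gradX Φ w'.1 w.2‖ + ‖w.1 - gradEta Φ w'.1 w.2‖ with hb
  have hb0 : 0 ≤ b := by positivity
  have ha0 : 0 ≤ a := norm_nonneg _
  have h5 : 1 + a ≤ C₂ * (1 + b) := by nlinarith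
  have h6 : (1 + a) ^ m * ‖fioKernel Φ σ q γ w' w‖ ≤ C₂ ^ m * (C₁ *
      (schwartzNorm (m + (2 * d + 1)) m q * schwartzNorm (m + (2 * d + 1)) m γ)) := by
    calc _ ≤ (C₂ * (1 + b)) ^ m * ‖fioKernel Φ σ q γ w' w‖ := by gcongr
      _ = C₂ ^ m * ((1 + b) ^ m * ‖fioKernel Φ σ q γ w' w‖) := by rw [mul_pow]; ring
      _ ≤ _ := by gcongr
  rw [decayKernel, Real.rpow_neg (by positivity), Real.rpow_natCast, ← div_eq_mul_inv,
    le_div_iff₀' (by positivity)]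
  exact h6.trans (le_of_eq (by ring))

end Weights

/-! ### The kernel of a Fourier integral operator -/

section Kernel

variable {d : ℕ}

theorem integrable_fioKernel {Φ : TFPlane d → ℝ} (h : IsPhase Φ) {σ : TFPlane d → ℂ}
    (hσ : MemLp σ ∞ volume) (q γ : 𝓢(Rd d, ℂ)) (w' w : TFPlane d) :
    Integrable fun z : TFPlane d => expI (Φ z - inner ℝ w'.2 z.1 - inner ℝ w.1 z.2) * σ z *
      (q (z.1 - w'.1) * γ (z.2 - w.2)) := by
  have hΦ := h.smooth.continuous
  have h1 : Integrable (fun z : TFPlane d => q (z.1 - w'.1) * γ (z.2 - w.2)) volume :=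
    (tensor (compSubConstCLM ℂ w'.1 q) (compSubConstCLM ℂ w.2 γ)).integrable
  refine h1.bdd_mul (c := (eLpNormEssSup σ volume).toReal) ?_ ?_
  · exact (Continuous.aestronglyMeasurable (by fun_prop)).mul hσ.1
  · filter_upwards [ae_le_eLpNormEssSup (f := σ) (μ := volume)] with z hz
    rw [norm_mul, norm_expI, one_mul, ← toReal_enorm]
    refine ENNReal.toReal_mono ?_ hz
    rw [← eLpNorm_exponent_top]
    exact hσ.2.ne

theorem fioKernel_add {Φ : TFPlane d → ℝ} (h : IsPhase Φ) {σ : TFPlane d → ℂ}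
    (hσ : MemLp σ ∞ volume) (q₁ q₂ γ : 𝓢(Rd d, ℂ)) (w' w : TFPlane d) :
    fioKernel Φ σ (q₁ + q₂) γ w' w = fioKernel Φ σ q₁ γ w' w + fioKernel Φ σ q₂ γ w' w := by
  rw [fioKernel, fioKernel, fioKernel, ← integral_add (integrable_fioKernel h hσ q₁ γ w' w)
    (integrable_fioKernel h hσ q₂ γ w' w)]
  refine integral_congr_ae (.of_forall fun z => ?_)
  simp only [add_apply]
  ring

theorem fioKernel_smul (Φ : TFPlane d → ℝ) (σ : TFPlane d → ℂ) (a : ℂ) (q γ : 𝓢(Rd d, ℂ))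
    (w' w : TFPlane d) : fioKernel Φ σ (a • q) γ w' w = a * fioKernel Φ σ q γ w' w := by
  rw [fioKernel, fioKernel, ← integral_const_mul]
  refine integral_congr_ae (.of_forall fun z => ?_)
  simp only [smul_apply, smul_eq_mul]
  ring

/-- Moving the test function by a time-frequency shift moves the base point of the kernel. This
turns pairings at base point `0` into values of a short-time Fourier transform. -/
theorem fioKernel_conjShift (Φ : TFPlane d → ℝ) (σ : TFPlane d → ℂ) (g γ : 𝓢(Rd d, ℂ))
    (w' w : TFPlane d) :
    fioKernel Φ σ (conjShift g w') γ 0 w = fioKernel Φ σ (schwartzConj g) γ w' w := by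
  rw [fioKernel, fioKernel]
  refine integral_congr_ae (.of_forall fun z => ?_)
  simp only [conjShift_eq, schwartzConj_apply, Prod.fst_zero, Prod.snd_zero, inner_zero_left,
    sub_zero]
  have h1 : expI (Φ z - inner ℝ w'.2 z.1 - inner ℝ w.1 z.2) =
      expI (Φ z - inner ℝ w.1 z.2) * expI (-inner ℝ w'.2 z.1) := by
    rw [← expI_add]
    congr 1
    ring
  rw [h1]
  ring

/-- The base points are functions on a parameter space `Y`, so that both the kernel with `w'` frozen
and the kernel on the product are covered. -/
theorem aestronglyMeasurable_fioKernel {Y : Type*} [TopologicalSpace Y] [MeasurableSpace Y]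
    [OpensMeasurableSpace Y] [SecondCountableTopology Y] {ρ : Measure Y} [SFinite ρ]
    {Φ : TFPlane d → ℝ} (h : IsPhase Φ) {σ : TFPlane d → ℂ} (hσ : MemLp σ ∞ volume)
    (q γ : 𝓢(Rd d, ℂ)) {a b : Y → TFPlane d} (ha : Continuous a) (hb : Continuous b) :
    AEStronglyMeasurable (fun y => fioKernel Φ σ q γ (a y) (b y)) ρ := by
  have hΦ := h.smooth.continuous
  refine AEStronglyMeasurable.integral_prod_right' (f := fun p : Y × TFPlane d =>
    expI (Φ p.2 - inner ℝ (a p.1).2 p.2.1 - inner ℝ (b p.1).1 p.2.2) * σ p.2 *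
      (q (p.2.1 - (a p.1).1) * γ (p.2.2 - (b p.1).2))) ?_
  refine AEStronglyMeasurable.mul (AEStronglyMeasurable.mul ?_ ?_) ?_
  · exact Continuous.aestronglyMeasurable (by fun_prop)
  · exact hσ.1.comp_snd
  · exact Continuous.aestronglyMeasurable (by fun_prop)

theorem IsModerate.exists_mul_decayKernel_le {s : ℝ} (hs : 0 ≤ s) {μ : TFPlane d → ℝ}
    (hμ : IsModerate (polyWeight s) μ) (Φ : TFPlane d → ℝ) (r : ℝ) :
    ∃ C : ℝ, 0 ≤ C ∧ ∀ w' w, μ w' * decayKernel Φ r w' w ≤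
      C * (decayKernel Φ (r - s) w' w * μ (canonicalTransformation Φ w)) := by
  obtain ⟨C, hC, h⟩ := hμ.exists_le hs
  refine ⟨C, hC, fun w' w => ?_⟩
  calc _ ≤ C * (1 + ‖w' - canonicalTransformation Φ w‖) ^ s * μ (canonicalTransformation Φ w) *
        decayKernel Φ r w' w :=
        mul_le_mul_of_nonneg_right (h _ _) (decayKernel_nonneg _ _ _ _)
    _ = C * (((1 + ‖w' - canonicalTransformation Φ w‖) ^ s * decayKernel Φ r w' w) *
        μ (canonicalTransformation Φ w)) := by ring
    _ = _ := by
      rw [decayKernel, ← Real.rpow_add (by positivity), decayKernel]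
      congr 4
      ring

end Kernel

/-! ### The operator on modulation spaces -/

section Operator

variable {d m : ℕ} {Φ : TFPlane d → ℝ} {σ : TFPlane d → ℂ} {s : ℝ} {μ : TFPlane d → ℝ}

/-- The integrand of the superposition of the images of the time-frequency shifts under a
Fourier integral operator. -/
def fioIntegrand (Φ : TFPlane d → ℝ) (σ : TFPlane d → ℂ) (γ : 𝓢(Rd d, ℂ)) (V : TFPlane d → ℂ)
    (q : 𝓢(Rd d, ℂ)) (w' w : TFPlane d) : ℂ :=
  V w * (expI (inner ℝ w.1 w.2) * fioKernel Φ σ q γ w' w)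

/-- The weight costs `s` powers of decay. The bound yields integrability, continuity in the test
function `q` (through its Schwartz norm) and the L^p estimate; being stated with `∫⁻`, it
presupposes no integrability. -/
theorem IsPhase.exists_lintegral_fioIntegrand_le (h : IsPhase Φ) (hσ : IsSymbol m σ) (hs : 0 ≤ s)
    (hμ : IsModerate (polyWeight s) μ) (γ : 𝓢(Rd d, ℂ)) : ∃ C : ℝ, 0 ≤ C ∧
      ∀ (V : TFPlane d → ℂ) (q : 𝓢(Rd d, ℂ)) (w' : TFPlane d),
        ENNReal.ofReal (μ w') * ∫⁻ w, ‖fioIntegrand Φ σ γ V q w' w‖ₑ ≤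
          ENNReal.ofReal (C * schwartzNorm (m + (2 * d + 1)) m q) *
            ∫⁻ w, ENNReal.ofReal (decayKernel Φ (m - s) w' w) *
              ‖(μ (canonicalTransformation Φ w) : ℂ) * V w‖ₑ := by
  obtain ⟨C₁, hC₁, h₁⟩ := h.exists_fioKernel_decay hσ
  obtain ⟨C₂, hC₂, h₂⟩ := hμ.exists_mul_decayKernel_le hs Φ m
  have hγ := schwartzNorm_nonneg (m + (2 * d + 1)) m γ
  refine ⟨C₁ * schwartzNorm (m + (2 * d + 1)) m γ * C₂, by positivity, fun V q w' => ?_⟩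
  have hq := schwartzNorm_nonneg (m + (2 * d + 1)) m q
  rw [← lintegral_const_mul' _ _ ENNReal.ofReal_ne_top,
    ← lintegral_const_mul' _ _ ENNReal.ofReal_ne_top]
  refine lintegral_mono fun w => ?_
  have h0 := decayKernel_nonneg Φ (m - s) w' w
  rw [← ofReal_norm, ← ofReal_norm, ← ENNReal.ofReal_mul (hμ.pos w').le, ← ENNReal.ofReal_mul h0,
    ← ENNReal.ofReal_mul (by positivity)]
  refine ENNReal.ofReal_le_ofReal ?_
  rw [fioIntegrand, norm_mul, norm_mul, norm_expI, one_mul, norm_mul, Complex.norm_real,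
    Real.norm_of_nonneg (hμ.pos _).le]
  set P := schwartzNorm (m + (2 * d + 1)) m γ
  set Q := schwartzNorm (m + (2 * d + 1)) m q
  calc _ = ‖V w‖ * (μ w' * ‖fioKernel Φ σ q γ w' w‖) := by ring
    _ ≤ ‖V w‖ * (μ w' * (C₁ * (Q * P) * decayKernel Φ m w' w)) := by
      have := (hμ.pos w').le
      gcongr
      exact h₁ q γ w' w
    _ = ‖V w‖ * (C₁ * (Q * P)) * (μ w' * decayKernel Φ m w' w) := by ring
    _ ≤ ‖V w‖ * (C₁ * (Q * P)) *
        (C₂ * (decayKernel Φ (m - s) w' w * μ (canonicalTransformation Φ w))) :=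
      mul_le_mul_of_nonneg_left (h₂ w' w) (by positivity)
    _ = _ := by ring

theorem IsPhase.measurable_weight_comp (h : IsPhase Φ) (hμ : IsModerate (polyWeight s) μ) :
    Measurable (μ ∘ canonicalTransformation Φ) :=
  hμ.measurable.comp h.continuous_canonicalTransformation.measurable

theorem IsPhase.measurable_ofReal_decayKernel (h : IsPhase Φ) (r : ℝ) :
    Measurable (Function.uncurry fun w' w => ENNReal.ofReal (decayKernel Φ r w' w)) :=
  (h.continuous_decayKernel r).measurable.ennreal_ofReal

theorem IsPhase.lintegral_decayKernel_mul_lt_top (h : IsPhase Φ) {r : ℝ} (hr : 2 * (d : ℝ) < r)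
    {φ : TFPlane d → ℝ≥0∞} (hφ : AEMeasurable φ volume) {p : ℝ≥0∞} (hp : 1 ≤ p)
    (hφp : eLpNorm φ p volume < ∞) (w' : TFPlane d) :
    ∫⁻ w, ENNReal.ofReal (decayKernel Φ r w' w) * φ w < ∞ := by
  obtain ⟨A, hA, hA1, -⟩ := h.exists_lintegral_decayKernel_le hr
  have hr0 : 0 ≤ r := le_trans (by positivity) hr.le
  refine lintegral_mul_lt_top
    ((h.measurable_ofReal_decayKernel r).comp measurable_prodMk_left).aemeasurable hφ (fun w => ?_)
    ((hA1 w').trans_lt hA.lt_top) hp hφp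
  simpa using ENNReal.ofReal_le_ofReal (decayKernel_le_one Φ hr0 w' w)

theorem aestronglyMeasurable_of_weight_mul {ν : TFPlane d → ℝ} (hν : Measurable ν)
    (hpos : ∀ z, 0 < ν z) {V : TFPlane d → ℂ}
    (hV : AEStronglyMeasurable (fun z => (ν z : ℂ) * V z) volume) :
    AEStronglyMeasurable V volume := by
  have h1 : AEStronglyMeasurable (fun z => ((ν z)⁻¹ : ℂ)) volume :=
    (Complex.measurable_ofReal.comp hν).inv.aestronglyMeasurable
  refine (h1.mul hV).congr (.of_forall fun z => ?_)
  have h2 : (ν z : ℂ) ≠ 0 := by exact_mod_cast (hpos z).ne'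
  simp only [Pi.mul_apply]
  rw [← mul_assoc, inv_mul_cancel₀ h2, one_mul]

theorem IsPhase.integrable_fioIntegrand (h : IsPhase Φ) (hσ : IsSymbol m σ) (hs : 0 ≤ s)
    (hsm : 2 * (d : ℝ) < m - s) (hμ : IsModerate (polyWeight s) μ) {p : ℝ≥0∞} (hp : 1 ≤ p)
    {V : TFPlane d → ℂ}
    (hV : MemLp (fun w => ((μ ∘ canonicalTransformation Φ) w : ℂ) * V w) p volume)
    (γ q : 𝓢(Rd d, ℂ)) (w' : TFPlane d) :
    Integrable (fioIntegrand Φ σ γ V q w') := by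
  obtain ⟨C, hC, hb⟩ := h.exists_lintegral_fioIntegrand_le hσ hs hμ γ
  have hVm := aestronglyMeasurable_of_weight_mul (h.measurable_weight_comp hμ)
    (fun z => hμ.pos _) hV.1
  refine ⟨hVm.mul (AEStronglyMeasurable.mul (Continuous.aestronglyMeasurable (by fun_prop)) ?_), ?_⟩
  · exact aestronglyMeasurable_fioKernel h hσ.1 q γ continuous_const continuous_id
  · rw [HasFiniteIntegral]
    have h1 := h.lintegral_decayKernel_mul_lt_top hsm hV.1.enorm hp (by rw [eLpNorm_enorm]; exact hV.2) w'
    have h2 := (hb V q w').trans_lt (ENNReal.mul_lt_top ENNReal.ofReal_lt_top h1)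
    by_contra h3
    rw [not_lt, top_le_iff] at h3
    rw [h3, ENNReal.mul_top (by simpa using hμ.pos w')] at h2
    exact lt_irrefl _ h2

/-- The image is defined by duality. Base point `0` suffices because `q` is an arbitrary test
function, and linearity in the Schwartz norm of `q` gives continuity. -/
theorem IsPhase.exists_fio_distribution (h : IsPhase Φ) (hσ : IsSymbol m σ) (hs : 0 ≤ s)
    (hsm : 2 * (d : ℝ) < m - s) (hμ : IsModerate (polyWeight s) μ) {p : ℝ≥0∞} (hp : 1 ≤ p)
    {V : TFPlane d → ℂ}
    (hV : MemLp (fun w => ((μ ∘ canonicalTransformation Φ) w : ℂ) * V w) p volume)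
    (γ : 𝓢(Rd d, ℂ)) :
    ∃ u : 𝓢'(Rd d, ℂ), ∀ q, u q = ∫ w, fioIntegrand Φ σ γ V q 0 w := by
  have hint := h.integrable_fioIntegrand hσ hs hsm hμ hp hV γ
  obtain ⟨C, hC, hb⟩ := h.exists_lintegral_fioIntegrand_le hσ hs hμ γ
  set B := ∫⁻ w, ENNReal.ofReal (decayKernel Φ (m - s) 0 w) *
    ‖((μ ∘ canonicalTransformation Φ) w : ℂ) * V w‖ₑ with hBdef
  have hB : B < ∞ := h.lintegral_decayKernel_mul_lt_top hsm hV.1.enorm hp (by rw [eLpNorm_enorm]; exact hV.2) 0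
  have hμ0 := hμ.pos 0
  refine ⟨(mkCLMtoNormedSpace (𝕜 := ℂ) (σ := RingHom.id ℂ)
    (fun q => ∫ w, fioIntegrand Φ σ γ V q 0 w) (fun q₁ q₂ => ?_) (fun a q => ?_)
    ⟨Finset.Iic (m + (2 * d + 1), m), (μ 0)⁻¹ * C * B.toReal, by positivity, fun q => ?_⟩ :
      𝓢(Rd d, ℂ) →L[ℂ] ℂ).toPointwiseConvergenceCLM _ _ _ _, fun q => rfl⟩
  · rw [← integral_add (hint q₁ 0) (hint q₂ 0)]
    refine integral_congr_ae (.of_forall fun w => ?_)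
    simp only [fioIntegrand, fioKernel_add h hσ.1]
    ring
  · rw [RingHom.id_apply, smul_eq_mul, ← integral_const_mul]
    refine integral_congr_ae (.of_forall fun w => ?_)
    simp only [fioIntegrand, fioKernel_smul]
    ring
  · change _ ≤ _ * schwartzNorm (m + (2 * d + 1)) m q
    have hq := schwartzNorm_nonneg (m + (2 * d + 1)) m q
    have h1 := hb V q 0
    have h2 : ‖∫ w, fioIntegrand Φ σ γ V q 0 w‖ ≤
        (∫⁻ w, ‖fioIntegrand Φ σ γ V q 0 w‖ₑ).toReal := by
      rw [← integral_norm_eq_lintegral_enorm (hint q 0).1]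
      exact norm_integral_le_integral_norm _
    have h3 := ENNReal.toReal_mono (ENNReal.mul_ne_top ENNReal.ofReal_ne_top hB.ne) h1
    rw [ENNReal.toReal_mul, ENNReal.toReal_mul, ENNReal.toReal_ofReal hμ0.le,
      ENNReal.toReal_ofReal (by positivity), ← le_div_iff₀' hμ0] at h3
    refine (h2.trans h3).trans (le_of_eq ?_)
    field_simp

theorem IsPhase.exists_eLpNorm_fioIntegrand_le (h : IsPhase Φ) (hσ : IsSymbol m σ) (hs : 0 ≤ s)
    (hsm : 2 * (d : ℝ) < m - s) (hμ : IsModerate (polyWeight s) μ) (γ q : 𝓢(Rd d, ℂ)) :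
    ∃ A : ℝ≥0∞, A ≠ ∞ ∧ ∀ (p : ℝ≥0∞) (V : TFPlane d → ℂ), 1 ≤ p →
      MemLp (fun w => ((μ ∘ canonicalTransformation Φ) w : ℂ) * V w) p volume →
      AEStronglyMeasurable (fun w' => (μ w' : ℂ) * ∫ w, fioIntegrand Φ σ γ V q w' w) volume ∧
      eLpNorm (fun w' => (μ w' : ℂ) * ∫ w, fioIntegrand Φ σ γ V q w' w) p volume ≤
        A * eLpNorm (fun w => ((μ ∘ canonicalTransformation Φ) w : ℂ) * V w) p volume := by
  obtain ⟨C, hC, hb⟩ := h.exists_lintegral_fioIntegrand_le hσ hs hμ γ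
  obtain ⟨A, hA, hA1, hA2⟩ := h.exists_lintegral_decayKernel_le hsm
  set K := ENNReal.ofReal (C * schwartzNorm (m + (2 * d + 1)) m q) with hK
  have hKt : K ≠ ∞ := ENNReal.ofReal_ne_top
  refine ⟨K * A, ENNReal.mul_ne_top hKt hA, fun p V hp hV => ⟨?_, ?_⟩⟩
  · have hVm := aestronglyMeasurable_of_weight_mul (h.measurable_weight_comp hμ)
      (fun z => hμ.pos _) hV.1
    refine (Complex.measurable_ofReal.comp hμ.measurable).aestronglyMeasurable.mul ?_
    refine AEStronglyMeasurable.integral_prod_right' (f := fun P : TFPlane d × TFPlane d =>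
      fioIntegrand Φ σ γ V q P.1 P.2) ?_
    refine hVm.comp_snd.mul (AEStronglyMeasurable.mul
      (Continuous.aestronglyMeasurable (by fun_prop)) ?_)
    exact aestronglyMeasurable_fioKernel h hσ.1 q γ continuous_fst continuous_snd
  · have hm := (h.measurable_ofReal_decayKernel (m - s)).const_mul K
    have h1 := eLpNorm_lintegral_mul_le (ν := volume) (A := K * A)
      (H := fun w' w => K * ENNReal.ofReal (decayKernel Φ (m - s) w' w)) hm hV.1.enorm
      (fun w' => ?_) (fun w => ?_) hp
    · rw [eLpNorm_enorm] at h1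
      refine le_trans (eLpNorm_mono_enorm fun w' => ?_) h1
      rw [enorm_eq_self, enorm_mul]
      simp only [mul_assoc]
      rw [lintegral_const_mul' _ _ hKt]
      refine le_trans ?_ (hb V q w')
      rw [← ofReal_norm, Complex.norm_real, Real.norm_of_nonneg (hμ.pos _).le]
      gcongr
      exact enorm_integral_le_lintegral_enorm _
    · rw [lintegral_const_mul' _ _ hKt]
      gcongr
      exact hA1 w'
    · rw [lintegral_const_mul' _ _ hKt]
      gcongr
      exact hA2 w

theorem fioIntegrand_add (γ q : 𝓢(Rd d, ℂ)) (V₁ V₂ : TFPlane d → ℂ) (w' w : TFPlane d) :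
    fioIntegrand Φ σ γ (V₁ + V₂) q w' w =
      fioIntegrand Φ σ γ V₁ q w' w + fioIntegrand Φ σ γ V₂ q w' w :=
  add_mul _ _ _

theorem fioIntegrand_smul (γ q : 𝓢(Rd d, ℂ)) (a : ℂ) (V : TFPlane d → ℂ) (w' w : TFPlane d) :
    fioIntegrand Φ σ γ (a • V) q w' w = a * fioIntegrand Φ σ γ V q w' w :=
  mul_assoc _ _ _

theorem stft_add (g : 𝓢(Rd d, ℂ)) (f₁ f₂ : 𝓢'(Rd d, ℂ)) :
    stft g (f₁ + f₂) = stft g f₁ + stft g f₂ := rfl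

theorem stft_smul (g : 𝓢(Rd d, ℂ)) (a : ℂ) (f : 𝓢'(Rd d, ℂ)) : stft g (a • f) = a • stft g f := rfl

theorem distribution_smul_apply (a : ℂ) (f : 𝓢'(Rd d, ℂ)) (q : 𝓢(Rd d, ℂ)) :
    (a • f) q = a * f q := rfl

/-- A bounded operator between modulation spaces from a linear family of distributions. -/
theorem ModulationSpace.exists_continuousLinearMap {g : 𝓢(Rd d, ℂ)} {p : ℝ≥0∞} [Fact (1 ≤ p)]
    {ν₁ ν₂ : TFPlane d → ℝ} (u : ModulationSpace g p ν₁ → 𝓢'(Rd d, ℂ))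
    (hadd : ∀ F G, u (F + G) = u F + u G) (hsmul : ∀ (a : ℂ) F, u (a • F) = a • u F) {A : ℝ≥0∞}
    (hA : A ≠ ∞) (hmeas : ∀ F, AEStronglyMeasurable (fun z => (ν₂ z : ℂ) * stft g (u F) z) volume)
    (hle : ∀ F, eLpNorm (fun z => (ν₂ z : ℂ) * stft g (u F) z) p volume ≤
      A * eLpNorm (fun z => (ν₁ z : ℂ) * stft g (toDistribution g p ν₁ F) z) p volume) :
    ∃ T : ModulationSpace g p ν₁ →L[ℂ] ModulationSpace g p ν₂,
      ∀ F, toDistribution g p ν₂ (T F) = u F := by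
  have hmem : ∀ F, u F ∈ modulationSubmodule g p ν₂ := fun F =>
    ⟨hmeas F, (hle F).trans_lt (ENNReal.mul_lt_top hA.lt_top (memLp g p ν₁ F).2)⟩
  let T : ModulationSpace g p ν₁ →ₗ[ℂ] ModulationSpace g p ν₂ :=
    { toFun := fun F => (⟨u F, hmem F⟩ : modulationSubmodule g p ν₂)
      map_add' := fun F G => Subtype.ext (hadd F G)
      map_smul' := fun a F => Subtype.ext (hsmul a F) }
  refine ⟨T.mkContinuous A.toReal fun F => ?_, fun F => rfl⟩
  rw [norm_def, norm_def, ← ENNReal.toReal_mul]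
  exact ENNReal.toReal_mono (ENNReal.mul_ne_top hA (memLp g p ν₁ F).2.ne) (hle F)

/-- A Fourier integral operator on modulation spaces, as a superposition of the images of
time-frequency shifts. -/
theorem IsPhase.exists_fio_continuousLinearMap (h : IsPhase Φ) (hσ : IsSymbol m σ) (hs : 0 ≤ s)
    (hsm : 2 * (d : ℝ) < m - s) (hμ : IsModerate (polyWeight s) μ) (g γ : 𝓢(Rd d, ℂ)) (c : ℂ)
    (p : ℝ≥0∞) [Fact (1 ≤ p)] :
    ∃ T : ModulationSpace g p (μ ∘ canonicalTransformation Φ) →L[ℂ] ModulationSpace g p μ,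
      ∀ F q, ModulationSpace.toDistribution _ _ _ (T F) q =
        c * ∫ w, fioIntegrand Φ σ γ (stft g (ModulationSpace.toDistribution _ _ _ F)) q 0 w := by
  have hp : 1 ≤ p := Fact.out
  have hmem := ModulationSpace.memLp g p (μ ∘ canonicalTransformation Φ)
  choose u hu using fun F => h.exists_fio_distribution hσ hs hsm hμ hp (hmem F) γ
  obtain ⟨A, hA, hAb⟩ := h.exists_eLpNorm_fioIntegrand_le hσ hs hsm hμ γ (schwartzConj g)
  have hint := fun F q => h.integrable_fioIntegrand hσ hs hsm hμ hp (hmem F) γ q 0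
  -- Testing against `conjShift g z` is the kernel with window `schwartzConj g` at base point `z`,
  -- so the L^p estimate for that window applies.
  have heq : ∀ F, (fun z => (μ z : ℂ) * stft g (c • u F) z) = c • fun z => (μ z : ℂ) *
      ∫ w, fioIntegrand Φ σ γ (stft g (ModulationSpace.toDistribution _ _ _ F))
        (schwartzConj g) z w := by
    intro F
    funext z
    have h1 : stft g (c • u F) z = c * u F (conjShift g z) := rfl
    rw [h1, hu]
    simp only [fioIntegrand, fioKernel_conjShift, Pi.smul_apply, smul_eq_mul]
    ring
  suffices hT : ∃ T : ModulationSpace g p (μ ∘ canonicalTransformation Φ) →L[ℂ]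
      ModulationSpace g p μ, ∀ F, ModulationSpace.toDistribution _ _ _ (T F) = c • u F by
    obtain ⟨T, hT⟩ := hT
    exact ⟨T, fun F q => by rw [hT, distribution_smul_apply, hu]⟩
  refine ModulationSpace.exists_continuousLinearMap (A := ‖c‖ₑ * A)
    (fun F => c • u F) (fun F G => ?_) (fun a F => ?_) (ENNReal.mul_ne_top enorm_ne_top hA)
    (fun F => ?_) (fun F => ?_)
  · refine (congrArg (c • ·) (DFunLike.ext _ _ fun q => ?_)).trans (smul_add c (u F) (u G))
    change _ = u F q + u G q
    rw [hu, hu, hu, map_add, stft_add]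
    simp only [fioIntegrand_add]
    exact integral_add (hint F q) (hint G q)
  · refine (congrArg (c • ·) (DFunLike.ext _ _ fun q => ?_)).trans (smul_comm c a (u F))
    rw [distribution_smul_apply, hu, hu, map_smul, stft_smul]
    simp only [fioIntegrand_smul]
    exact integral_const_mul _ _
  · rw [heq]
    exact (hAb p _ hp (hmem F)).1.const_smul c
  · rw [heq, mul_assoc]
    refine eLpNorm_const_smul_le.trans ?_
    gcongr
    exact (hAb p _ hp (hmem F)).2

end Operator

/-! ### Fourier integral operators on Schwartz functions -/

section SchwartzExtension

variable {d : ℕ}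

theorem memLp_weight_mul_stft_coe {s C : ℝ} {ν : TFPlane d → ℝ} (hν : Measurable ν)
    (hpos : ∀ z, 0 < ν z) (hle : ∀ z, ν z ≤ C * (1 + ‖z‖) ^ s) (p : ℝ≥0∞) (g f : 𝓢(Rd d, ℂ)) :
    MemLp (fun z => (ν z : ℂ) * stft g (f : 𝓢'(Rd d, ℂ)) z) p volume := by
  obtain ⟨k, hk⟩ := (instHasTemperateGrowthVolume (d := d)).exists_eLpNorm_lt_top p
  have hC : 0 ≤ C := by
    have h1 := (hpos 0).trans_le (hle 0)
    simpa using h1.le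
  -- `⌈s⌉₊` powers of decay beat the weight, and the other `k` give a function in L^p.
  obtain ⟨D, hD, h⟩ := exists_stft_decay g f (⌈s⌉₊ + k)
  refine ⟨((Complex.measurable_ofReal.comp hν).aestronglyMeasurable).mul
    (continuous_stft_coe g f).aestronglyMeasurable, ?_⟩
  refine (eLpNorm_le_mul_eLpNorm_of_ae_le_mul (c := C * D)
    (g := fun z : TFPlane d => (1 + ‖z‖) ^ (-k : ℝ)) (.of_forall fun z => ?_) p).trans_lt
    (ENNReal.mul_lt_top ENNReal.ofReal_lt_top hk)
  have h0 : 0 < 1 + ‖z‖ := by positivity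
  rw [norm_mul, Complex.norm_real, Real.norm_of_nonneg (hpos z).le,
    Real.norm_of_nonneg (by positivity), Real.rpow_neg h0.le, Real.rpow_natCast, ← div_eq_mul_inv,
    le_div_iff₀ (by positivity)]
  have h1 : (1 + ‖z‖) ^ s ≤ (1 + ‖z‖) ^ ⌈s⌉₊ := by
    rw [← Real.rpow_natCast]
    exact Real.rpow_le_rpow_of_exponent_le (by linarith [norm_nonneg z]) (Nat.le_ceil s)
  calc _ ≤ C * (1 + ‖z‖) ^ ⌈s⌉₊ * ‖stft g (f : 𝓢'(Rd d, ℂ)) z‖ * (1 + ‖z‖) ^ k := by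
        gcongr
        exact (hle z).trans (by gcongr)
    _ = C * ((1 + ‖z‖) ^ (⌈s⌉₊ + k) * ‖stft g (f : 𝓢'(Rd d, ℂ)) z‖) := by rw [pow_add]; ring
    _ ≤ C * D := by
        gcongr
        exact h z

theorem IsModerate.exists_le_one_add_norm {s : ℝ} (hs : 0 ≤ s) {μ : TFPlane d → ℝ}
    (hμ : IsModerate (polyWeight s) μ) : ∃ C : ℝ, ∀ z, μ z ≤ C * (1 + ‖z‖) ^ s := by
  obtain ⟨C, hC, h⟩ := hμ.exists_le hs
  refine ⟨C * μ 0, fun z => (h z 0).trans (le_of_eq ?_)⟩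
  rw [sub_zero]
  ring

/-- χ is Lipschitz, so `μ ∘ χ` grows at most polynomially. This suffices to place the Schwartz
functions in the source space. -/
theorem IsPhase.exists_weight_comp_le {Φ : TFPlane d → ℝ} (h : IsPhase Φ) {s : ℝ} (hs : 0 ≤ s)
    {μ : TFPlane d → ℝ} (hμ : IsModerate (polyWeight s) μ) :
    ∃ C : ℝ, ∀ z, (μ ∘ canonicalTransformation Φ) z ≤ C * (1 + ‖z‖) ^ s := by
  obtain ⟨C, hC, h1⟩ := hμ.exists_le hs
  obtain ⟨L, hL, -, hlip, -⟩ := h.exists_canonicalTransformation_bounds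
  refine ⟨C * L ^ s * μ (canonicalTransformation Φ 0), fun z =>
    (h1 _ (canonicalTransformation Φ 0)).trans ?_⟩
  have h2 : (1 + ‖canonicalTransformation Φ z - canonicalTransformation Φ 0‖) ^ s ≤
      L ^ s * (1 + ‖z‖) ^ s := by
    rw [← Real.mul_rpow (by linarith) (by positivity)]
    refine Real.rpow_le_rpow (by positivity) ?_ hs
    have h3 := hlip z 0
    rw [sub_zero] at h3
    linarith
  calc _ ≤ C * (L ^ s * (1 + ‖z‖) ^ s) * μ (canonicalTransformation Φ 0) := by
        have := (hμ.pos (canonicalTransformation Φ 0)).le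
        gcongr
    _ = _ := by ring

theorem ae_norm_le_of_memLp_top {σ : TFPlane d → ℂ} (hσ : MemLp σ ∞ volume) :
    ∃ M : ℝ, 0 ≤ M ∧ ∀ᵐ z, ‖σ z‖ ≤ M := by
  refine ⟨(eLpNorm σ ∞ volume).toReal, ENNReal.toReal_nonneg, ?_⟩
  filter_upwards [ae_le_eLpNormEssSup (f := σ) (μ := volume)] with z hz
  rw [← toReal_enorm, eLpNorm_exponent_top]
  refine ENNReal.toReal_mono ?_ hz
  rw [← eLpNorm_exponent_top]
  exact hσ.2.ne

/-- Justifies Fubini: the inner integral in `z` is bounded, uniformly in `w`, by the sup norm of `σ`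
times the L^1 norms of `q` and `γ`, and `V` is integrable. -/
theorem integrable_fioIntegrand_prod {Φ : TFPlane d → ℝ} (h : IsPhase Φ) {σ : TFPlane d → ℂ}
    (hσ : MemLp σ ∞ volume) (q γ : 𝓢(Rd d, ℂ)) {V : TFPlane d → ℂ} (hV : Integrable V) :
    Integrable (fun P : TFPlane d × TFPlane d => V P.1 * (expI (inner ℝ P.1.1 P.1.2) *
      (expI (Φ P.2 - inner ℝ P.1.1 P.2.2) * σ P.2 * (q P.2.1 * γ (P.2.2 - P.1.2)))))
      (volume.prod volume) := by
  have hΦ := h.smooth.continuous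
  obtain ⟨M, hM0, hM⟩ := ae_norm_le_of_memLp_top hσ
  have hslice : ∀ w : TFPlane d, Integrable (fun z : TFPlane d =>
      expI (Φ z - inner ℝ w.1 z.2) * σ z * (q z.1 * γ (z.2 - w.2))) := by
    intro w
    simpa using integrable_fioKernel h hσ q γ 0 w
  rw [integrable_prod_iff]
  · refine ⟨.of_forall fun w =>
      ((hslice w).const_mul (expI (inner ℝ w.1 w.2))).const_mul (V w), ?_⟩
    refine Integrable.mono' (hV.norm.mul_const (M * ((∫ x, ‖q x‖) * ∫ η, ‖γ η‖))) ?_ ?_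
    · refine AEStronglyMeasurable.integral_prod_right' (f := fun P : TFPlane d × TFPlane d =>
        ‖V P.1 * (expI (inner ℝ P.1.1 P.1.2) *
          (expI (Φ P.2 - inner ℝ P.1.1 P.2.2) * σ P.2 * (q P.2.1 * γ (P.2.2 - P.1.2))))‖) ?_
      refine (hV.1.comp_fst.mul (AEStronglyMeasurable.mul ?_
        (AEStronglyMeasurable.mul (AEStronglyMeasurable.mul ?_ hσ.1.comp_snd) ?_))).norm <;>
      exact Continuous.aestronglyMeasurable (by fun_prop)
    · refine .of_forall fun w => ?_
      simp only [norm_mul, norm_expI, one_mul]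
      rw [integral_const_mul, Real.norm_of_nonneg (by positivity)]
      gcongr
      have h1 : Integrable (fun z : TFPlane d => ‖q z.1‖ * ‖γ (z.2 - w.2)‖)
          (volume.prod volume) :=
        q.integrable.norm.mul_prod (γ.integrable.comp_sub_right w.2).norm
      calc _ ≤ ∫ z : TFPlane d, M * (‖q z.1‖ * ‖γ (z.2 - w.2)‖) := by
            refine integral_mono_of_nonneg (.of_forall fun z => by positivity) (h1.const_mul M) ?_
            filter_upwards [hM] with z hz
            gcongr
        _ = _ := by
            rw [integral_const_mul]
            congr 1
            change ∫ z : Rd d × Rd d, _ ∂(volume.prod volume) = _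
            rw [integral_prod_mul (fun x => ‖q x‖) (fun η => ‖γ (η - w.2)‖),
              integral_sub_right_eq_self (fun η => ‖γ η‖)]
  · refine hV.1.comp_fst.mul (AEStronglyMeasurable.mul ?_
        (AEStronglyMeasurable.mul (AEStronglyMeasurable.mul ?_ hσ.1.comp_snd) ?_)) <;>
      exact Continuous.aestronglyMeasurable (by fun_prop)

/-- With `γ = ĝ`, the factor `expI ⟪y, η⟫` completes `γ(ζ - η)` to the Fourier transform of `M_η T_y
g`. After exchanging the integrals, the `w`-integral is therefore the inversion formula for `f̂`. -/
theorem integral_fioIntegrand_stft_coe {Φ : TFPlane d → ℝ} (h : IsPhase Φ) {σ : TFPlane d → ℂ}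
    (hσ : MemLp σ ∞ volume) (g f q : 𝓢(Rd d, ℂ)) :
    ∫ w, fioIntegrand Φ σ (𝓕 g) (stft g (f : 𝓢'(Rd d, ℂ))) q 0 w =
      ((∫ η, ‖𝓕 g η‖ ^ 2 : ℝ) : ℂ) * ∫ x, fio Φ σ f x * q x := by
  have hint := integrable_fioIntegrand_prod h hσ q (𝓕 g) (integrable_stft_coe g f)
  have h1 : ∀ w, fioIntegrand Φ σ (𝓕 g) (stft g (f : 𝓢'(Rd d, ℂ))) q 0 w = ∫ z : TFPlane d,
      stft g (f : 𝓢'(Rd d, ℂ)) w * (expI (inner ℝ w.1 w.2) *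
      (expI (Φ z - inner ℝ w.1 z.2) * σ z * (q z.1 * 𝓕 g (z.2 - w.2)))) := by
    intro w
    rw [fioIntegrand, fioKernel, ← integral_const_mul, ← integral_const_mul]
    simp
  simp only [h1]
  rw [integral_integral_swap hint]
  have h2 : ∀ z : TFPlane d, ∫ w : TFPlane d, stft g (f : 𝓢'(Rd d, ℂ)) w *
      (expI (inner ℝ w.1 w.2) *
        (expI (Φ z - inner ℝ w.1 z.2) * σ z * (q z.1 * 𝓕 g (z.2 - w.2)))) =
      ((∫ η, ‖𝓕 g η‖ ^ 2 : ℝ) : ℂ) * (expI (Φ z) * σ z * 𝓕 f z.2 * q z.1) := by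
    intro z
    have h3 := integral_stft_mul_fourier_window g f z.2
    have h4 : ∀ w : TFPlane d, stft g (f : 𝓢'(Rd d, ℂ)) w * (expI (inner ℝ w.1 w.2) *
        (expI (Φ z - inner ℝ w.1 z.2) * σ z * (q z.1 * 𝓕 g (z.2 - w.2)))) =
        (expI (Φ z) * σ z * q z.1) * (stft g (f : 𝓢'(Rd d, ℂ)) w *
          (expI (-inner ℝ w.1 (z.2 - w.2)) * 𝓕 g (z.2 - w.2))) := by
      intro w
      have h5 : expI (inner ℝ w.1 w.2) * expI (Φ z - inner ℝ w.1 z.2) =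
          expI (Φ z) * expI (-inner ℝ w.1 (z.2 - w.2)) := by
        rw [← expI_add, ← expI_add, inner_sub_right]
        congr 1
        ring
      linear_combination
        (stft g (f : 𝓢'(Rd d, ℂ)) w * σ z * q z.1 * 𝓕 g (z.2 - w.2)) * h5
    simp only [h4]
    rw [integral_const_mul, h3]
    ring
  simp only [h2]
  rw [integral_const_mul]
  congr 1
  have h6 : Integrable (fun z : Rd d × Rd d => expI (Φ z) * σ z * 𝓕 f z.2 * q z.1)
      (volume.prod volume) := by
    refine (integrable_fioKernel h hσ q (𝓕 f) 0 0).congr (.of_forall fun z => ?_)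
    simp
    ring
  change ∫ z : Rd d × Rd d, _ ∂(volume.prod volume) = _
  rw [integral_prod _ h6]
  simp only [integral_mul_const]
  rfl

/-- The bound holds for almost every `x` only, since the essential bound on `σ` passes to almost
every slice `σ(x, ·)`. -/
theorem exists_fio_bound {Φ : TFPlane d → ℝ} (h : IsPhase Φ) {σ : TFPlane d → ℂ}
    (hσ : MemLp σ ∞ volume) (f : 𝓢(Rd d, ℂ)) :
    AEStronglyMeasurable (fio Φ σ f) volume ∧ ∃ M : ℝ, 0 ≤ M ∧ ∀ᵐ x, ‖fio Φ σ f x‖ ≤ M := by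
  have hΦ := h.smooth.continuous
  obtain ⟨M, hM0, hM⟩ := ae_norm_le_of_memLp_top hσ
  constructor
  · refine AEStronglyMeasurable.integral_prod_right' (ν := (volume : Measure (Rd d)))
      (f := fun z : Rd d × Rd d => expI (Φ z) * σ z * (𝓕 f) z.2) ?_
    refine AEStronglyMeasurable.mul (AEStronglyMeasurable.mul ?_ hσ.1) ?_ <;>
      exact Continuous.aestronglyMeasurable (by fun_prop)
  · refine ⟨M * ∫ η, ‖𝓕 f η‖, by positivity, ?_⟩
    have hM' : ∀ᵐ z ∂((volume : Measure (Rd d)).prod (volume : Measure (Rd d))), ‖σ z‖ ≤ M := hM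
    filter_upwards [Measure.ae_ae_of_ae_prod hM'] with x hx
    rw [← integral_const_mul]
    refine norm_integral_le_of_norm_le ((𝓕 f).integrable.norm.const_mul M) ?_
    filter_upwards [hx] with η hη
    change ‖expI (Φ (x, η)) * σ (x, η) * 𝓕 f η‖ ≤ _
    rw [norm_mul, norm_mul, norm_expI, one_mul]
    gcongr

end SchwartzExtension

/-! ### Integrals of families of Schwartz functions -/

section ParametricIntegral

variable {E Y : Type*} [NormedAddCommGroup E] [NormedSpace ℝ E] [MeasurableSpace Y] {ν : Measure Y}

/-- The integral of a family of Schwartz functions whose seminorms are integrable is a Schwartz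
function. -/
theorem exists_schwartz_integral (G : Y → 𝓢(E, ℂ))
    (hmeas : ∀ n t, AEStronglyMeasurable (fun y => iteratedFDeriv ℝ n (G y) t) ν)
    (hbound : ∀ k n, ∃ b : Y → ℝ, Integrable b ν ∧
      ∀ᵐ y ∂ν, ∀ t, ‖t‖ ^ k * ‖iteratedFDeriv ℝ n (G y) t‖ ≤ b y) :
    ∃ ψ : 𝓢(E, ℂ), ∀ t, ψ t = ∫ y, G y t ∂ν := by
  have hint : ∀ n t, Integrable (fun y => iteratedFDeriv ℝ n (G y) t) ν := by
    intro n t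
    obtain ⟨b, hb, hle⟩ := hbound 0 n
    refine hb.mono' (hmeas n t) ?_
    filter_upwards [hle] with y hy
    simpa using hy t
  -- Differentiation under the integral sign, dominated by the bound with `k = 0` for order `n + 1`.
  -- The integrated derivatives thus form a Taylor series, and this gives smoothness and the decay
  -- together.
  have hderiv : ∀ n t, HasFDerivAt (fun t => ∫ y, iteratedFDeriv ℝ n (G y) t ∂ν)
      (continuousMultilinearCurryLeftEquiv ℝ (fun _ : Fin (n + 1) => E) ℂ
        (∫ y, iteratedFDeriv ℝ (n + 1) (G y) t ∂ν)) t := by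
    intro n t
    obtain ⟨b, hb, hle⟩ := hbound 0 (n + 1)
    set L := continuousMultilinearCurryLeftEquiv ℝ (fun _ : Fin (n + 1) => E) ℂ
    have h1 := hasFDerivAt_integral_of_dominated_of_fderiv_le (𝕜 := ℝ) (μ := ν)
      (F := fun t y => iteratedFDeriv ℝ n (G y) t)
      (F' := fun t y => L (iteratedFDeriv ℝ (n + 1) (G y) t)) (x₀ := t) (bound := b)
      Filter.univ_mem (.of_forall fun t => hmeas n t) (hint n t)
      (L.continuous.comp_aestronglyMeasurable (hmeas (n + 1) t)) ?_ hb ?_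
    · refine h1.congr_fderiv ?_
      exact ContinuousLinearMap.integral_comp_comm (𝕜 := ℝ)
        (E := ContinuousMultilinearMap ℝ (fun _ : Fin (n + 1) => E) ℂ)
        (Fₗ := E →L[ℝ] ContinuousMultilinearMap ℝ (fun _ : Fin n => E) ℂ)
        L.toContinuousLinearEquiv.toContinuousLinearMap (hint (n + 1) t)
    · filter_upwards [hle] with y hy t _
      rw [L.norm_map]
      simpa using hy t
    · refine .of_forall fun y t _ => ?_
      have h2 : DifferentiableAt ℝ (iteratedFDeriv ℝ n (G y)) t :=
        (((G y).smooth ⊤).differentiable_iteratedFDeriv (m := n)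
          (by exact_mod_cast WithTop.coe_lt_top n)).differentiableAt
      exact h2.hasFDerivAt
  have hT : HasFTaylorSeriesUpTo (⊤ : ℕ∞) (fun t => ∫ y, G y t ∂ν)
      (fun t n => ∫ y, iteratedFDeriv ℝ n (G y) t ∂ν) := by
    refine ⟨fun t => ?_, fun n _ t => hderiv n t, fun n _ => ?_⟩
    · exact ((continuousMultilinearCurryFin0 ℝ E ℂ).toContinuousLinearEquiv.integral_comp_comm
        (fun y => iteratedFDeriv ℝ 0 (G y) t)).symm
    · exact continuous_iff_continuousAt.2 fun t => (hderiv n t).continuousAt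
  refine ⟨⟨fun t => ∫ y, G y t ∂ν, hT.contDiff, fun k n => ?_⟩, fun t => rfl⟩
  obtain ⟨b, hb, hle⟩ := hbound k n
  refine ⟨∫ y, b y ∂ν, fun t => ?_⟩
  rw [← hT.eq_iteratedFDeriv (by exact_mod_cast le_top) t]
  calc _ ≤ ‖t‖ ^ k * ∫ y, ‖iteratedFDeriv ℝ n (G y) t‖ ∂ν := by
        gcongr
        exact norm_integral_le_integral_norm _
    _ = ∫ y, ‖t‖ ^ k * ‖iteratedFDeriv ℝ n (G y) t‖ ∂ν := (integral_const_mul _ _).symm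
    _ ≤ _ := by
        refine integral_mono_of_nonneg (.of_forall fun y => by positivity) hb ?_
        filter_upwards [hle] with y hy
        exact hy t

end ParametricIntegral

/-! ### Superpositions of time-frequency shifts -/

section ShiftSuperposition

variable {d : ℕ}

/-- The shifts are the slices of one function that is smooth jointly in `z` and `t`, so their
derivatives in `t` are restrictions of its derivatives. -/
theorem continuous_iteratedFDeriv_tfShift (g : 𝓢(Rd d, ℂ)) (n : ℕ) (t : Rd d) :
    Continuous fun z : TFPlane d => iteratedFDeriv ℝ n (tfShift g z) t := by
  set G : TFPlane d × Rd d → ℂ := fun P => expI (inner ℝ P.1.2 P.2) * g (P.2 - P.1.1) with hG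
  have hGs : ContDiff ℝ (⊤ : ℕ∞) G := by
    refine (contDiff_expI.comp ?_).mul ((g.smooth ⊤).comp ?_)
    · exact (contDiff_snd.comp contDiff_fst).inner ℝ contDiff_snd
    · exact contDiff_snd.sub (contDiff_fst.comp contDiff_fst)
  have h1 : ∀ z : TFPlane d, iteratedFDeriv ℝ n (tfShift g z) t =
      (iteratedFDeriv ℝ n G (z, t)).compContinuousLinearMap
        fun _ => ContinuousLinearMap.inr ℝ (TFPlane d) (Rd d) := by
    intro z
    have h2 : (tfShift g z : Rd d → ℂ) = (fun P => G ((z, 0) + P)) ∘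
        ContinuousLinearMap.inr ℝ (TFPlane d) (Rd d) := by
      funext t
      simp [hG, tfShift_apply]
    have h3 : ContDiff ℝ (⊤ : ℕ∞) fun P => G ((z, 0) + P) :=
      hGs.comp (contDiff_const.add contDiff_id)
    rw [h2, ContinuousLinearMap.iteratedFDeriv_comp_right _ h3 _ (by exact_mod_cast le_top),
      iteratedFDeriv_comp_add_left]
    simp
  simp only [h1]
  have h4 : Continuous fun z : TFPlane d => iteratedFDeriv ℝ n G (z, t) :=
    (hGs.continuous_iteratedFDeriv (m := n) (by exact_mod_cast le_top)).comp
      (Continuous.prodMk_left t)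
  exact (ContinuousMultilinearMap.compContinuousLinearMapL _).continuous.comp h4

theorem exists_norm_iteratedFDeriv_tfShift_le (g : 𝓢(Rd d, ℂ)) (R : ℝ) (k n : ℕ) : ∃ C : ℝ,
    0 ≤ C ∧ ∀ z : TFPlane d, ‖z‖ ≤ R → ∀ t,
      ‖t‖ ^ k * ‖iteratedFDeriv ℝ n (tfShift g z) t‖ ≤ C := by
  set a : ℝ := (1 + 2 * Real.pi * |R|) ^ n
  set b : ℝ := 2 ^ k * schwartzNorm k n g
  have ha : 0 ≤ a := by positivity
  have hb : 0 ≤ b := mul_nonneg (by positivity) (schwartzNorm_nonneg _ _ _)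
  refine ⟨(1 + |R|) ^ k * (2 ^ n * (a * b)), by positivity, fun z hz t => ?_⟩
  have hR : 0 ≤ R := (norm_nonneg z).trans hz
  have h1 : (1 + ‖t - z.1‖) ^ k * ‖iteratedFDeriv ℝ n (tfShift g z) t‖ ≤ 2 ^ n * (a * b) := by
    have hs : (tfShift g z : Rd d → ℂ) = fun t => expI (innerSL ℝ z.2 t) * g (t - z.1) := by
      funext t
      rw [tfShift_apply]
      rfl
    rw [hs]
    refine mul_norm_iteratedFDeriv_mul_le (contDiff_expI.comp (innerSL ℝ z.2).contDiff)
      ((g.smooth ⊤).comp (contDiff_id.sub contDiff_const)) le_rfl (α := 1)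
      (β := (1 + ‖t - z.1‖) ^ k) zero_le_one (by positivity) ha hb (by rw [one_mul])
      (fun j hj => ?_) (fun j hj => ?_)
    · change 1 * ‖iteratedFDeriv ℝ j (expI ∘ innerSL ℝ z.2) t‖ ≤ _
      rw [one_mul, ContinuousLinearMap.iteratedFDeriv_comp_right _ contDiff_expI _
        (by exact_mod_cast le_top)]
      refine (ContinuousMultilinearMap.norm_compContinuousLinearMap_le _ _).trans ?_
      rw [norm_iteratedFDeriv_expI, Finset.prod_const, Finset.card_univ, Fintype.card_fin,
        innerSL_apply_norm, ← mul_pow]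
      have h2 : 2 * Real.pi * ‖z.2‖ ≤ 1 + 2 * Real.pi * |R| := by
        have h3 : ‖z.2‖ ≤ |R| := (norm_snd_le z).trans (hz.trans (le_abs_self R))
        nlinarith [Real.pi_pos]
      refine (pow_le_pow_left₀ (by positivity) h2 j).trans ?_
      exact pow_le_pow_right₀ 
        (by nlinarith [mul_nonneg Real.pi_pos.le (abs_nonneg R)]) hj
    · change (1 + ‖t - z.1‖) ^ k * ‖iteratedFDeriv ℝ j (fun t => g (t - z.1)) t‖ ≤ _
      rw [iteratedFDeriv_comp_sub]
      exact one_add_norm_pow_mul_norm_iteratedFDeriv_le _ hj g _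
  have h2 : ‖t‖ ≤ (1 + |R|) * (1 + ‖t - z.1‖) := by
    have h3 : ‖t‖ ≤ ‖t - z.1‖ + ‖z.1‖ := by
      have := norm_add_le (t - z.1) z.1
      rwa [sub_add_cancel] at this
    have h4 : ‖z.1‖ ≤ |R| := (norm_fst_le z).trans (hz.trans (le_abs_self R))
    nlinarith [norm_nonneg (t - z.1), abs_nonneg R]
  calc _ ≤ ((1 + |R|) * (1 + ‖t - z.1‖)) ^ k * ‖iteratedFDeriv ℝ n (tfShift g z) t‖ := by gcongr
    _ = (1 + |R|) ^ k * ((1 + ‖t - z.1‖) ^ k * ‖iteratedFDeriv ℝ n (tfShift g z) t‖) := by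
        rw [mul_pow]; ring
    _ ≤ _ := by gcongr

theorem iteratedFDeriv_schwartz_smul (a : ℂ) (q : 𝓢(Rd d, ℂ)) (n : ℕ) (t : Rd d) :
    iteratedFDeriv ℝ n (a • q : 𝓢(Rd d, ℂ)) t = a • iteratedFDeriv ℝ n q t :=
  iteratedFDeriv_const_smul_apply ((q.smooth n).contDiffAt)

/-- A superposition of time-frequency shifts over a bounded set is a Schwartz function. -/
theorem exists_schwartz_superposition (g : 𝓢(Rd d, ℂ)) {a : TFPlane d → ℂ} (R : ℝ)
    (ha : IntegrableOn a (Metric.closedBall 0 R)) : ∃ ψ : 𝓢(Rd d, ℂ), ∀ t,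
      ψ t = ∫ z in Metric.closedBall 0 R, a z * tfShift g z t := by
  have h := exists_schwartz_integral (ν := volume.restrict (Metric.closedBall 0 R))
    (fun z : TFPlane d => a z • tfShift g z) (fun n t => ?_) (fun k n => ?_)
  · simpa using h
  · simp only [iteratedFDeriv_schwartz_smul]
    exact ha.1.smul (continuous_iteratedFDeriv_tfShift g n t).aestronglyMeasurable
  · obtain ⟨C, hC, hle⟩ := exists_norm_iteratedFDeriv_tfShift_le g R k n
    refine ⟨fun z => ‖a z‖ * C, ha.norm.mul_const C, ?_⟩
    filter_upwards [ae_restrict_mem Metric.isClosed_closedBall.measurableSet] with z hz t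
    rw [iteratedFDeriv_schwartz_smul, norm_smul, mul_left_comm]
    gcongr
    exact hle z (by simpa using hz) t

end ShiftSuperposition

/-! ### Approximation by Schwartz functions -/

section Approximation

variable {d : ℕ}

theorem stft_of_isGivenBy {u : 𝓢'(Rd d, ℂ)} {h : Rd d → ℂ} (hu : IsGivenBy u h) (g : 𝓢(Rd d, ℂ))
    (z : TFPlane d) : stft g u z = ∫ x, h x * conjShift g z x :=
  hu _

theorem integrable_mul_conjShift {h : Rd d → ℂ} (hm : AEStronglyMeasurable h volume) {M : ℝ}
    (hM : ∀ᵐ x, ‖h x‖ ≤ M) (g : 𝓢(Rd d, ℂ)) (z : TFPlane d) :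
    Integrable fun x => h x * conjShift g z x :=
  integrable_mul_schwartz hm hM _

theorem integral_norm_mul_conjShift_le {h : Rd d → ℂ} {M : ℝ} (hM : ∀ᵐ x, ‖h x‖ ≤ M)
    (g : 𝓢(Rd d, ℂ)) (z : TFPlane d) :
    ∫ x, ‖h x‖ * ‖conjShift g z x‖ ≤ M * ∫ x, ‖g x‖ := by
  calc _ ≤ ∫ x, M * ‖g (x - z.1)‖ := by
        refine integral_mono_of_nonneg (.of_forall fun x => by positivity)
          ((g.integrable.comp_sub_right z.1).norm.const_mul M) ?_
        filter_upwards [hM] with x hx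
        rw [norm_conjShift]
        gcongr
    _ = _ := by
        rw [integral_const_mul, integral_sub_right_eq_self (fun x => ‖g x‖)]

theorem aestronglyMeasurable_stft_of_isGivenBy {u : 𝓢'(Rd d, ℂ)} {h : Rd d → ℂ}
    (hu : IsGivenBy u h) (hm : AEStronglyMeasurable h volume) (g : 𝓢(Rd d, ℂ)) :
    AEStronglyMeasurable (stft g u) volume := by
  have h1 : stft g u = fun z => ∫ x, h x * conjShift g z x :=
    funext fun z => stft_of_isGivenBy hu g z
  rw [h1]
  exact AEStronglyMeasurable.integral_prod_right'
    (f := fun P : TFPlane d × Rd d => h P.2 * conjShift g P.1 P.2)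
    (hm.comp_snd.mul (continuous_conjShift g).aestronglyMeasurable)

theorem norm_stft_le_of_isGivenBy {u : 𝓢'(Rd d, ℂ)} {h : Rd d → ℂ} (hu : IsGivenBy u h) {M : ℝ}
    (hM : ∀ᵐ x, ‖h x‖ ≤ M) (g : 𝓢(Rd d, ℂ)) (z : TFPlane d) :
    ‖stft g u z‖ ≤ M * ∫ x, ‖g x‖ := by
  rw [stft_of_isGivenBy hu]
  refine (norm_integral_le_integral_norm _).trans ?_
  simp only [norm_mul]
  exact integral_norm_mul_conjShift_le hM g z

theorem continuous_stft_tfShift (g : 𝓢(Rd d, ℂ)) (w : TFPlane d) :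
    Continuous fun z => stft g (tfShift g z : 𝓢'(Rd d, ℂ)) w := by
  have h1 := continuous_stft_coe g g
  simp only [stft_tfShift]
  exact (continuous_expI.comp (by fun_prop)).mul (h1.comp (by fun_prop))

theorem integrable_stft_tfShift (g : 𝓢(Rd d, ℂ)) (w : TFPlane d) :
    Integrable fun z => stft g (tfShift g z : 𝓢'(Rd d, ℂ)) w := by
  obtain ⟨C, -, hC⟩ := exists_stft_decay g g (2 * d + 1)
  refine Integrable.mono' (((integrable_one_add_norm_pow_inv (d := d)).comp_sub_right w).const_mul C)
    (continuous_stft_tfShift g w).aestronglyMeasurable (.of_forall fun z => ?_)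
  rw [norm_stft_tfShift, norm_sub_rev z w, ← div_eq_mul_inv, le_div_iff₀' (by positivity)]
  exact hC (w - z)

theorem conj_stft_tfShift (g : 𝓢(Rd d, ℂ)) (z w : TFPlane d) :
    (starRingEnd ℂ) (stft g (tfShift g w : 𝓢'(Rd d, ℂ)) z) =
      stft g (tfShift g z : 𝓢'(Rd d, ℂ)) w := by
  rw [stft_coe_eq_integral, stft_coe_eq_integral, ← integral_conj]
  refine integral_congr_ae (.of_forall fun t => ?_)
  simp only
  rw [map_mul, conj_tfShift, ← conj_tfShift g z, Complex.conj_conj, mul_comm]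

/-- The conjugated inversion formula for a shifted window. By duality it becomes a reproducing
formula for distributions given by bounded functions. -/
theorem integral_stft_tfShift_mul_conjShift (g : 𝓢(Rd d, ℂ)) (w : TFPlane d) (t : Rd d) :
    ∫ z, stft g (tfShift g z : 𝓢'(Rd d, ℂ)) w * conjShift g z t =
      ((∫ x, ‖g x‖ ^ 2 : ℝ) : ℂ) * conjShift g w t := by
  have h1 := congrArg (starRingEnd ℂ) (integral_stft_mul_tfShift g (tfShift g w) t)
  rw [← integral_conj, map_mul, Complex.conj_ofReal, conj_tfShift] at h1
  rw [← h1]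
  refine integral_congr_ae (.of_forall fun z => ?_)
  simp only [map_mul, conj_tfShift, conj_stft_tfShift]

/-- The reproducing formula for the short-time Fourier transform of a bounded function. -/
theorem integral_stft_mul_stft_tfShift {u : 𝓢'(Rd d, ℂ)} {h : Rd d → ℂ} (hu : IsGivenBy u h)
    (hm : AEStronglyMeasurable h volume) {M : ℝ} (hM : ∀ᵐ x, ‖h x‖ ≤ M) (g : 𝓢(Rd d, ℂ))
    (w : TFPlane d) :
    ∫ z, stft g u z * stft g (tfShift g z : 𝓢'(Rd d, ℂ)) w =
      ((∫ x, ‖g x‖ ^ 2 : ℝ) : ℂ) * stft g u w := by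
  have hint : Integrable (fun P : TFPlane d × Rd d => h P.2 * conjShift g P.1 P.2 *
      stft g (tfShift g P.1 : 𝓢'(Rd d, ℂ)) w) (volume.prod volume) := by
    have hmeas : AEStronglyMeasurable (fun P : TFPlane d × Rd d => h P.2 * conjShift g P.1 P.2 *
        stft g (tfShift g P.1 : 𝓢'(Rd d, ℂ)) w) (volume.prod volume) :=
      (hm.comp_snd.mul (continuous_conjShift g).aestronglyMeasurable).mul
        ((continuous_stft_tfShift g w).comp continuous_fst).aestronglyMeasurable
    rw [integrable_prod_iff hmeas]
    refine ⟨.of_forall fun z => (integrable_mul_conjShift hm hM g z).mul_const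
      (stft g (tfShift g z : 𝓢'(Rd d, ℂ)) w), ?_⟩
    refine Integrable.mono' ((integrable_stft_tfShift g w).norm.const_mul (M * ∫ x, ‖g x‖))
      hmeas.norm.integral_prod_right' (.of_forall fun z => ?_)
    rw [Real.norm_of_nonneg (by positivity)]
    simp only [norm_mul]
    rw [integral_mul_const]
    gcongr
    exact integral_norm_mul_conjShift_le hM g z
  simp only [stft_of_isGivenBy hu, ← integral_mul_const]
  rw [integral_integral_swap hint, ← integral_const_mul]
  refine integral_congr_ae (.of_forall fun t => ?_)
  simp only
  have h1 := integral_stft_tfShift_mul_conjShift g w t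
  have h2 : ∀ z, h t * conjShift g z t * stft g (tfShift g z : 𝓢'(Rd d, ℂ)) w =
      h t * (stft g (tfShift g z : 𝓢'(Rd d, ℂ)) w * conjShift g z t) := fun z => by ring
  simp only [h2]
  rw [integral_const_mul, h1]
  ring

theorem exists_stft_superposition (g : 𝓢(Rd d, ℂ)) {a : TFPlane d → ℂ} (R : ℝ)
    (ha : IntegrableOn a (Metric.closedBall 0 R)) : ∃ ψ : 𝓢(Rd d, ℂ), ∀ w,
      stft g (ψ : 𝓢'(Rd d, ℂ)) w =
        ∫ z in Metric.closedBall 0 R, a z * stft g (tfShift g z : 𝓢'(Rd d, ℂ)) w := by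
  obtain ⟨ψ, hψ⟩ := exists_schwartz_superposition g R ha
  refine ⟨ψ, fun w => ?_⟩
  obtain ⟨C, -, hC⟩ := g.decay 0 0
  have hC' : ∀ᵐ x, ‖conjShift g w x‖ ≤ C := .of_forall fun x => by
    rw [norm_conjShift]
    simpa using hC (x - w.1)
  have hint : Integrable (fun P : TFPlane d × Rd d => a P.1 * (tfShift g P.1 P.2 *
      conjShift g w P.2)) ((volume.restrict (Metric.closedBall 0 R)).prod volume) := by
    have hmeas : AEStronglyMeasurable (fun P : TFPlane d × Rd d => a P.1 * (tfShift g P.1 P.2 *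
        conjShift g w P.2)) ((volume.restrict (Metric.closedBall 0 R)).prod volume) :=
      ha.1.comp_fst.mul ((continuous_tfShift g).mul
        ((conjShift g w).continuous.comp continuous_snd)).aestronglyMeasurable
    have hslice : ∀ z, Integrable fun t => tfShift g z t * conjShift g w t := fun z => by
      simpa only [mul_comm] using
        integrable_mul_schwartz (conjShift g w).continuous.aestronglyMeasurable hC' (tfShift g z)
    rw [integrable_prod_iff hmeas]
    refine ⟨.of_forall fun z => (hslice z).const_mul (a z), ?_⟩
    refine Integrable.mono' (ha.norm.mul_const (C * ∫ x, ‖g x‖))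
      hmeas.norm.integral_prod_right' (.of_forall fun z => ?_)
    rw [Real.norm_of_nonneg (by positivity)]
    simp only [norm_mul]
    rw [integral_const_mul]
    gcongr
    refine le_trans (le_of_eq ?_) (integral_norm_mul_conjShift_le hC' g z)
    refine integral_congr_ae (.of_forall fun t => ?_)
    simp only [norm_conjShift, norm_tfShift]
    ring
  rw [stft_coe_eq_integral]
  simp only [hψ, ← integral_mul_const, mul_assoc]
  rw [← integral_integral_swap hint]
  refine integral_congr_ae (.of_forall fun z => ?_)
  simp only
  rw [integral_const_mul, stft_coe_eq_integral]

/-- The left-hand transform decays rapidly in `w - z` and beats the moderate growth of `μ`. Hence a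
superposition of shifts is bounded in M^∞_μ by the weighted L^1 norm of its coefficients. -/
theorem IsModerate.exists_mul_norm_stft_tfShift_le {s : ℝ} (hs : 0 ≤ s) {μ : TFPlane d → ℝ}
    (hμ : IsModerate (polyWeight s) μ) (g : 𝓢(Rd d, ℂ)) : ∃ K : ℝ, 0 ≤ K ∧ ∀ w z,
      μ w * ‖stft g (tfShift g z : 𝓢'(Rd d, ℂ)) w‖ ≤ K * μ z := by
  obtain ⟨C, hC, h1⟩ := hμ.exists_le hs
  obtain ⟨D, hD, h2⟩ := exists_stft_decay g g ⌈s⌉₊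
  refine ⟨C * D, by positivity, fun w z => ?_⟩
  have h3 : (1 + ‖w - z‖) ^ s ≤ (1 + ‖w - z‖) ^ ⌈s⌉₊ := by
    rw [← Real.rpow_natCast]
    exact Real.rpow_le_rpow_of_exponent_le (by linarith [norm_nonneg (w - z)]) (Nat.le_ceil s)
  have h4 := (hμ.pos z).le
  rw [norm_stft_tfShift]
  calc _ ≤ C * (1 + ‖w - z‖) ^ ⌈s⌉₊ * μ z * ‖stft g (g : 𝓢'(Rd d, ℂ)) (w - z)‖ := by
        gcongr
        exact (h1 w z).trans (by gcongr)
    _ = C * ((1 + ‖w - z‖) ^ ⌈s⌉₊ * ‖stft g (g : 𝓢'(Rd d, ℂ)) (w - z)‖) * μ z := by ring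
    _ ≤ _ := by
        gcongr
        exact h2 _

/-- A bounded function in `M^1_μ` is a limit in `M^∞_μ` of Schwartz functions. -/
theorem ModulationSpace.mem_schwartzClosure_of_isGivenBy {s : ℝ} (hs : 0 ≤ s) {μ : TFPlane d → ℝ}
    (hμ : IsModerate (polyWeight s) μ) {g : 𝓢(Rd d, ℂ)} (hg : g ≠ 0) (U : ModulationSpace g ∞ μ)
    {h : Rd d → ℂ} (hu : IsGivenBy (toDistribution g ∞ μ U) h)
    (hm : AEStronglyMeasurable h volume) {M : ℝ} (hM : ∀ᵐ x, ‖h x‖ ≤ M)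
    (h1 : MemLp (fun z => (μ z : ℂ) * stft g (toDistribution g ∞ μ U) z) 1 volume) :
    U ∈ schwartzClosure g ∞ μ := by
  set u := toDistribution g ∞ μ U with hudef
  obtain ⟨K, hK, hKle⟩ := hμ.exists_mul_norm_stft_tfShift_le hs g
  obtain ⟨B, hB⟩ := hμ.exists_le_one_add_norm hs
  set c : ℝ := ∫ x, ‖g x‖ ^ 2 with hc
  have hc0 : 0 < c := integral_norm_sq_pos hg
  have hVm := aestronglyMeasurable_stft_of_isGivenBy hu hm g
  have hVb := norm_stft_le_of_isGivenBy hu hM g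
  have hI : Integrable (fun z => μ z * ‖stft g u z‖) := by
    refine (memLp_one_iff_integrable.1 h1).norm.congr (.of_forall fun z => ?_)
    simp only
    rw [norm_mul, Complex.norm_real, Real.norm_of_nonneg (hμ.pos z).le]
  have htail : Filter.Tendsto
      (fun n : ℕ => ∫ z in (Metric.closedBall (0 : TFPlane d) n)ᶜ, μ z * ‖stft g u z‖)
      Filter.atTop (nhds 0) := by
    have h2 := tendsto_setIntegral_of_antitone (μ := volume)
      (f := fun z => μ z * ‖stft g u z‖)
      (s := fun n : ℕ => (Metric.closedBall (0 : TFPlane d) n)ᶜ)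
      (fun n => Metric.isClosed_closedBall.measurableSet.compl)
      (fun n m hnm => Set.compl_subset_compl.2
        (Metric.closedBall_subset_closedBall (by exact_mod_cast hnm))) ⟨0, hI.integrableOn⟩
    have h3 : ⋂ n : ℕ, (Metric.closedBall (0 : TFPlane d) n)ᶜ = ∅ := by
      rw [← Set.compl_iUnion, Metric.iUnion_closedBall_nat, Set.compl_univ]
    rwa [h3, Measure.restrict_empty, integral_zero_measure] at h2
  refine Metric.mem_closure_iff.2 fun ε hε => ?_
  have hev := (htail.const_mul (c⁻¹ * K)).eventually (gt_mem_nhds (by simpa using hε))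
  obtain ⟨n, hn⟩ := hev.exists
  -- `ψ` is the reproducing formula for `u` truncated to the ball of radius `n`, with `c⁻¹` as its
  -- normalization.
  obtain ⟨ψ, hψ⟩ := exists_stft_superposition g (a := fun z => (c : ℂ)⁻¹ * stft g u z) n
    (Integrable.const_mul (Measure.integrableOn_of_bounded (M := M * ∫ x, ‖g x‖)
      measure_closedBall_lt_top.ne hVm (.of_forall hVb)) _)
  set Ψ : ModulationSpace g ∞ μ := (⟨(ψ : 𝓢'(Rd d, ℂ)),
    memLp_weight_mul_stft_coe hμ.measurable hμ.pos hB ∞ g ψ⟩ : modulationSubmodule g ∞ μ) with hΨ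
  refine ⟨Ψ, ⟨ψ, rfl⟩, ?_⟩
  rw [dist_eq_norm, norm_def]
  refine lt_of_le_of_lt ?_ hn
  -- The full reproducing integral minus its part over the ball: the error is the integral over the
  -- complement.
  have hdiff : ∀ w, stft g u w - stft g (ψ : 𝓢'(Rd d, ℂ)) w = ∫ z in (Metric.closedBall 0 n)ᶜ,
      (c : ℂ)⁻¹ * stft g u z * stft g (tfShift g z : 𝓢'(Rd d, ℂ)) w := by
    intro w
    have hint : Integrable fun z =>
        (c : ℂ)⁻¹ * stft g u z * stft g (tfShift g z : 𝓢'(Rd d, ℂ)) w := by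
      refine (integrable_stft_tfShift g w).bdd_mul (c := ‖(c : ℂ)⁻¹‖ * (M * ∫ x, ‖g x‖))
        (hVm.const_mul _) (.of_forall fun z => ?_)
      rw [norm_mul]
      gcongr
      exact hVb z
    rw [hψ, sub_eq_iff_eq_add', integral_add_compl Metric.isClosed_closedBall.measurableSet hint]
    simp only [mul_assoc]
    rw [integral_const_mul, integral_stft_mul_stft_tfShift hu hm hM, ← hc, ← mul_assoc,
      inv_mul_cancel₀ (by exact_mod_cast hc0.ne'), one_mul]
  set r := ∫ z in (Metric.closedBall (0 : TFPlane d) n)ᶜ, μ z * ‖stft g u z‖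
  have hr : 0 ≤ c⁻¹ * K * r := by
    have : 0 ≤ r := integral_nonneg fun z => mul_nonneg (hμ.pos z).le (norm_nonneg _)
    positivity
  have hbound : ∀ w, ‖(μ w : ℂ) * stft g (toDistribution g ∞ μ (U - Ψ)) w‖ ≤ c⁻¹ * K * r := by
    intro w
    have h2 : stft g (toDistribution g ∞ μ (U - Ψ)) w =
        stft g u w - stft g (ψ : 𝓢'(Rd d, ℂ)) w := rfl
    rw [h2, hdiff, norm_mul, Complex.norm_real, Real.norm_of_nonneg (hμ.pos w).le]
    have h3 : ‖∫ z in (Metric.closedBall 0 n)ᶜ,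
        (c : ℂ)⁻¹ * stft g u z * stft g (tfShift g z : 𝓢'(Rd d, ℂ)) w‖ ≤
        ∫ z in (Metric.closedBall (0 : TFPlane d) n)ᶜ,
          (μ w)⁻¹ * (c⁻¹ * K * (μ z * ‖stft g u z‖)) := by
      refine norm_integral_le_of_norm_le
        ((hI.integrableOn.const_mul _).const_mul _) (.of_forall fun z => ?_)
      rw [norm_mul, norm_mul, norm_inv, Complex.norm_real, Real.norm_of_nonneg hc0.le,
        le_inv_mul_iff₀ (hμ.pos w)]
      calc _ = c⁻¹ * ‖stft g u z‖ * (μ w * ‖stft g (tfShift g z : 𝓢'(Rd d, ℂ)) w‖) := by ring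
        _ ≤ c⁻¹ * ‖stft g u z‖ * (K * μ z) :=
          mul_le_mul_of_nonneg_left (hKle w z) (by positivity)
        _ = _ := by ring
    rw [integral_const_mul, integral_const_mul, le_inv_mul_iff₀ (hμ.pos w)] at h3
    exact h3
  refine ENNReal.toReal_le_of_le_ofReal hr ?_
  rw [eLpNorm_exponent_top]
  exact eLpNormEssSup_le_of_ae_bound (.of_forall hbound)

end Approximation

/-! ### Extension from Schwartz functions and conclusion -/

/-- The extension of a Fourier integral operator from Schwartz functions to a modulation space. -/
theorem IsPhase.exists_fio_extension {d m : ℕ} {Φ : TFPlane d → ℝ} (h : IsPhase Φ)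
    {σ : TFPlane d → ℂ} (hσ : IsSymbol m σ) {s : ℝ} (hs : 0 ≤ s) (hsm : 2 * (d : ℝ) < m - s)
    {μ : TFPlane d → ℝ} (hμ : IsModerate (polyWeight s) μ) {g : 𝓢(Rd d, ℂ)} (hg : g ≠ 0)
    (p : ℝ≥0∞) [Fact (1 ≤ p)] :
    ∃ T : ModulationSpace g p (μ ∘ canonicalTransformation Φ) →L[ℂ] ModulationSpace g p μ,
      ∀ (F : ModulationSpace g p (μ ∘ canonicalTransformation Φ)) (f : 𝓢(Rd d, ℂ)),
        ModulationSpace.toDistribution _ _ _ F = (f : 𝓢'(Rd d, ℂ)) →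
        IsGivenBy (ModulationSpace.toDistribution _ _ _ (T F)) (fio Φ σ f) := by
  set c : ℝ := ∫ η, ‖𝓕 g η‖ ^ 2 with hc
  have hc0 : (c : ℂ) ≠ 0 := by exact_mod_cast (integral_norm_sq_pos (fourier_ne_zero hg)).ne'
  obtain ⟨T, hT⟩ := h.exists_fio_continuousLinearMap hσ hs hsm hμ g (𝓕 g) (c : ℂ)⁻¹ p
  refine ⟨T, fun F f hF q => ?_⟩
  rw [hT, hF, integral_fioIntegrand_stft_coe h hσ.1, ← hc, ← mul_assoc, inv_mul_cancel₀ hc0,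
    one_mul]

theorem IsPhase.exists_modulationSpace_schwartz {d : ℕ} {Φ : TFPlane d → ℝ} (h : IsPhase Φ)
    {s : ℝ} (hs : 0 ≤ s) {μ : TFPlane d → ℝ} (hμ : IsModerate (polyWeight s) μ)
    (g f : 𝓢(Rd d, ℂ)) (p : ℝ≥0∞) :
    ∃ F : ModulationSpace g p (μ ∘ canonicalTransformation Φ),
      ModulationSpace.toDistribution _ _ _ F = (f : 𝓢'(Rd d, ℂ)) := by
  obtain ⟨C, hC⟩ := h.exists_weight_comp_le hs hμ
  exact ⟨(⟨(f : 𝓢'(Rd d, ℂ)), memLp_weight_mul_stft_coe (h.measurable_weight_comp hμ)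
    (fun z => hμ.pos _) hC p g f⟩ : modulationSubmodule g p (μ ∘ canonicalTransformation Φ)), rfl⟩

theorem IsGivenBy.unique {d : ℕ} {u v : 𝓢'(Rd d, ℂ)} {h : Rd d → ℂ} (hu : IsGivenBy u h)
    (hv : IsGivenBy v h) : u = v :=
  DFunLike.ext _ _ fun φ => (hu φ).trans (hv φ).symm

/-- The extension for `p = 1` puts the same distribution in M^1_μ, and it is given by a bounded
function; these are the two properties that make the truncated reproducing formula converge in
M^∞_μ. -/
theorem IsPhase.fio_mem_schwartzClosure {d m : ℕ} {Φ : TFPlane d → ℝ} (h : IsPhase Φ)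
    {σ : TFPlane d → ℂ} (hσ : IsSymbol m σ) {s : ℝ} (hs : 0 ≤ s) (hsm : 2 * (d : ℝ) < m - s)
    {μ : TFPlane d → ℝ} (hμ : IsModerate (polyWeight s) μ) {g : 𝓢(Rd d, ℂ)} (hg : g ≠ 0)
    (f : 𝓢(Rd d, ℂ)) (U : ModulationSpace g ∞ μ)
    (hU : IsGivenBy (ModulationSpace.toDistribution _ _ _ U) (fio Φ σ f)) :
    U ∈ ModulationSpace.schwartzClosure g ∞ μ := by
  obtain ⟨T, hT⟩ := h.exists_fio_extension hσ hs hsm hμ hg 1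
  obtain ⟨F, hF⟩ := h.exists_modulationSpace_schwartz hs hμ g f 1
  obtain ⟨hm, M, -, hM⟩ := exists_fio_bound h hσ.1 f
  refine ModulationSpace.mem_schwartzClosure_of_isGivenBy hs hμ hg U hU hm hM ?_
  rw [hU.unique (hT F f hF)]
  exact ModulationSpace.memLp g 1 μ (T F)

end

theorem theorem4p2 (d N : ℕ) (Φ : TFPlane d → ℝ) (hΦ : IsPhase Φ)
    (σ : TFPlane d → ℂ) (hσ : IsSymbol (2 * N) σ)
    (s : ℝ) (hs₀ : 0 ≤ s) (hs : s < 2 * (N : ℝ) - 2 * (d : ℝ))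
    (μ : TFPlane d → ℝ) (hμ : IsModerate (polyWeight s) μ)
    (g : 𝓢(Rd d, ℂ)) (hg : g ≠ 0) :
    (∀ (p : ℝ≥0∞) [Fact (1 ≤ p)], p ≠ ∞ →
      ∃ T : ModulationSpace g p (μ ∘ canonicalTransformation Φ) →L[ℂ] ModulationSpace g p μ,
        ∀ f : 𝓢(Rd d, ℂ), ∃ F : ModulationSpace g p (μ ∘ canonicalTransformation Φ),
          ModulationSpace.toDistribution _ _ _ F = (f : 𝓢'(Rd d, ℂ)) ∧
          IsGivenBy (ModulationSpace.toDistribution _ _ _ (T F)) (fio Φ σ f)) ∧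
    (∃ T : ModulationSpace.schwartzClosure g ∞ (μ ∘ canonicalTransformation Φ) →L[ℂ]
          ModulationSpace.schwartzClosure g ∞ μ,
        ∀ f : 𝓢(Rd d, ℂ),
          ∃ F : ModulationSpace.schwartzClosure g ∞ (μ ∘ canonicalTransformation Φ),
            ModulationSpace.toDistribution _ _ _ F.1 = (f : 𝓢'(Rd d, ℂ)) ∧
            IsGivenBy (ModulationSpace.toDistribution _ _ _ (T F).1) (fio Φ σ f)) := by
  have hsm : 2 * (d : ℝ) < ((2 * N : ℕ) : ℝ) - s := by
    push_cast
    linarith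
  refine ⟨fun p _ _ => ?_, ?_⟩
  · obtain ⟨T, hT⟩ := hΦ.exists_fio_extension hσ hs₀ hsm hμ hg p
    refine ⟨T, fun f => ?_⟩
    obtain ⟨F, hF⟩ := hΦ.exists_modulationSpace_schwartz hs₀ hμ g f p
    exact ⟨F, hF, hT F f hF⟩
  · obtain ⟨T, hT⟩ := hΦ.exists_fio_extension hσ hs₀ hsm hμ hg ∞
    -- The preimage under `T` of a closed subspace is closed, so it is enough to check Schwartz
    -- functions.
    have hmap : ∀ F ∈ ModulationSpace.schwartzClosure g ∞ (μ ∘ canonicalTransformation Φ),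
        T F ∈ ModulationSpace.schwartzClosure g ∞ μ := by
      intro F hF
      refine (Submodule.isClosed_topologicalClosure _).preimage T.continuous |>.closure_subset_iff.2
        ?_ hF
      rintro G ⟨f, hf⟩
      exact hΦ.fio_mem_schwartzClosure hσ hs₀ hsm hμ hg f (T G) (hT G f hf.symm)
    refine ⟨(T.comp (Submodule.subtypeL _)).codRestrict _ fun F => hmap F.1 F.2, fun f => ?_⟩
    obtain ⟨F, hF⟩ := hΦ.exists_modulationSpace_schwartz hs₀ hμ g f ∞
    exact ⟨⟨F, Submodule.le_topologicalClosure _ ⟨f, hF.symm⟩⟩, hF, hT F f hF⟩
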